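/- For a derivation $D$ of $\mathbb C[t]$, regard $(\mathbb C[t],D)$ as the vertex algebra with vacuum $1$ and $Y(a,x)b=\sum_{k\ge 0}\frac1{k!}(D^ka)\,b\,x^k$, i.e. $a_{-k-1}b=\frac1{k!}(D^ka)b$ and $a_kb=0$ for $k\ge 0$. Let $p>1$, let $g$ be an automorphism of the algebra $\mathbb C[t]$ of order $p$ with $g(t)=\xi t$ (so $\xi$ is a primitive $p$-th root of unity), and put $\mathbb C[t]^r=\{a : ga=\xi^r a\}$ for $0\le r\le p-1$. A $g$-twisted $(\mathbb C[t],D)$-module is a complex vector space $M$ with a linear map $a\mapsto Y_M(a,x)=\sum_{i\in\frac1p\mathbb Z}a_ix^{-i-1}\in(\operatorname{End}M)[[x^{1/p},x^{-1/p}]]$ such that 1. $Y_M(a,x)=\sum_{i\in r/p+\mathbb Z}a_ix^{-i-1}$ for $a\in\mathbb C[t]^r$; 2. $Y_M(a,x)w\in M((x^{1/p}))$ for all $a\in\mathbb C[t]$, $w\in M$; 3. $Y_M(1,x)=\mathrm{id}_M$; 4. for $a\in\mathbb C[t]^r$, $b\in\mathbb C[t]^s$, $m\in r/p+\mathbb Z$,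 $n\in s/p+\mathbb Z$, $l\in\mathbb Z$, $$\sum_{i\ge0}\binom mi(a_{l+i}b)_{m+n-i}=\sum_{i\ge0}\binom li(-1)^i\bigl(a_{l+m-i}b_{n+i}+(-1)^{l+1}b_{l+n-i}a_{m+i}\bigr).$$ A submodule is a subspace stable under all $a_i$; $M$ is indecomposable if it is nonzero and not the direct sum of two nonzero submodules; an isomorphism is a linear bijection commuting with all $a_i$. Let $f\in\mathbb C[t]$ and $D=f(t)\frac{d}{dt}$. **Theorem.** There is a finite-dimensional $g$-twisted $(\mathbb C[t],D)$-module $(M,Y_M)$ with $Y_M(t,x)\ne0$ if and only if $f(t)=c_1t+c_{p+1}t^{p+1}$ for some $c_1,c_{p+1}\in\mathbb C$ with $c_{p+1}\neq0$. Suppose that $f$ has this form. Let $\zeta_p$ be any primitive $p$-th root of unity, let $\gamma_p$ be any complex number with $\gamma_p^{\,p}=(-pc_{p+1})^{-1}$, and let $n\ge1$. Let $E_n$ be the $n\times n$ identity matrix and $J_n$ the $n\times n$ nilpotent Jordan block (ones just above the diagonal, zeros elsewhere). Then for each $0\le l\le p-1$ there is exactly one $g$-twisted $(\mathbb C[t],D)$-module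 structure $M_n^{(p,l)}$ on $\mathbb C^n$ with $$Y(t,x)=\gamma_p\zeta_p^{\,l}\,x^{-1/p}\,(E_n-x^{-1}J_n)^{-1/p}\qquad\text{if }c_1=0,$$ $$Y(t,x)=\gamma_p\zeta_p^{\,l}\Bigl(\frac{-1+\exp(-c_1px)}{-c_1p}\Bigr)^{-1/p}\Bigl(E_n-\frac{\exp(-c_1px)}{-1+\exp(-c_1px)}J_n\Bigr)^{-1/p}\qquad\text{if }c_1\ne0.$$ It is indecomposable and satisfies $Y(t,x)\neq0$. Every $n$-dimensional indecomposable $g$-twisted $(\mathbb C[t],D)$-module with $Y_M(t,x)\ne0$ is isomorphic to one of the $p$ modules $M_n^{(p,l)}$, $0\le l\le p-1$. Here, for $m\in\mathbb Q$, $(x(1+G(x)))^{m}=x^m\sum_{i\ge0}\binom miG(x)^i$ for $G\in x\mathbb C[[x]]$, and $(E_n+F(x)H)^m=\sum_{i\ge0}\binom mi(F(x)H)^i$ for $F\in\mathbb C((x))$ and $H$ a nilpotent matrix. -/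

import Mathlib

open Polynomial

universe u

/-- A vertex algebra over `ℂ`: `mode u n` is the coefficient `u_n` of
`Y(u, x) = ∑ u_n x^(-n-1)`, and `u_{-2} vacuum` is the translation operator applied to `u`. -/
structure VertexAlgebra (V : Type*) [AddCommGroup V] [Module ℂ V] where
  vacuum : V
  mode : V →ₗ[ℂ] (ℤ → Module.End ℂ V)
  truncation : ∀ u v : V, ∃ N : ℤ, ∀ n : ℤ, N ≤ n → mode u n v = 0
  vacuum_mode : ∀ n : ℤ, mode vacuum n = if n = -1 then 1 else 0
  creation : ∀ u : V, mode u (-1) vacuum = u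
  creation_nonneg : ∀ (u : V) (n : ℤ), 0 ≤ n → mode u n vacuum = 0
  /-- `[𝒟, Y(u, x)] = (d/dx) Y(u, x)`. -/
  translation : ∀ (u v : V) (n : ℤ),
    mode (mode u n v) (-2) vacuum - mode u n (mode v (-2) vacuum) =
      (-n : ℂ) • mode u (n - 1) v
  /-- `(x - y)^N [Y(u, x), Y(v, y)] = 0` for some `N`, coefficient by coefficient. -/
  locality : ∀ u v : V, ∃ N : ℕ, ∀ m n : ℤ, ∀ w : V,
    ∑ i ∈ Finset.range (N + 1), ((-1 : ℂ) ^ i * (N.choose i : ℂ)) •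
      (mode u (m + N - i) (mode v (n + i) w) - mode v (n + i) (mode u (m + N - i) w)) = 0

/-- The coefficient `a_n` of `Y(a, x) b = ∑_{k ≥ 0} (1/k!) (D^k a) b x^k`, that is
`a_{-k-1} b = (1/k!) (D^k a) b` and `a_n b = 0` for `n ≥ 0`. -/
noncomputable def Derivation.vertexMode {A : Type*} [CommRing A] [Algebra ℂ A]
    (D : Derivation ℂ A A) : ℤ → (A →ₗ[ℂ] Module.End ℂ A)
  | Int.ofNat _ => 0
  | Int.negSucc k =>
      ((Nat.factorial k : ℂ)⁻¹) • (LinearMap.mul ℂ A ∘ₗ (D : A →ₗ[ℂ] A) ^ k)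

theorem Derivation.vertexMode_nonneg {A : Type*} [CommRing A] [Algebra ℂ A]
    (D : Derivation ℂ A A) (n : ℤ) (hn : 0 ≤ n) : D.vertexMode n = 0 := by
  cases n with
  | ofNat k => rfl
  | negSucc k => exact absurd hn (by simp)

theorem Derivation.vertexMode_negSucc {A : Type*} [CommRing A] [Algebra ℂ A]
    (D : Derivation ℂ A A) (k : ℕ) (a b : A) :
    D.vertexMode (Int.negSucc k) a b =
      ((Nat.factorial k : ℂ)⁻¹) • ((((D : A →ₗ[ℂ] A) ^ k) a) * b) := rfl

theorem Derivation.vertexMode_neg_two {A : Type*} [CommRing A] [Algebra ℂ A]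
    (D : Derivation ℂ A A) (a : A) : D.vertexMode (-2) a 1 = D a := by
  have h := D.vertexMode_negSucc 1 a 1
  simpa using h

theorem Derivation.vertexMode_commute {A : Type*} [CommRing A] [Algebra ℂ A]
    (D : Derivation ℂ A A) (m n : ℤ) (a b w : A) :
    D.vertexMode m a (D.vertexMode n b w) = D.vertexMode n b (D.vertexMode m a w) := by
  cases m with
  | ofNat k => simp [Derivation.vertexMode]
  | negSucc k =>
    cases n with
    | ofNat j => simp [Derivation.vertexMode]
    | negSucc j =>
      simp only [Derivation.vertexMode_negSucc, mul_smul_comm]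
      rw [smul_comm, mul_left_comm]

/-- The vertex algebra `(A, D)` of a commutative `ℂ`-algebra `A` with a derivation `D`:
`Y(a, x) b = ∑_{k ≥ 0} (1/k!) (D^k a) b x^k`, with vacuum `1`. -/
noncomputable def Derivation.vertexAlgebra {A : Type*} [CommRing A] [Algebra ℂ A]
    (D : Derivation ℂ A A) : VertexAlgebra A where
  vacuum := 1
  mode := LinearMap.pi D.vertexMode
  truncation u v := ⟨0, fun n hn => by simp [D.vertexMode_nonneg n hn]⟩
  vacuum_mode n := by
    ext b
    cases n with
    | ofNat k =>
      have h : ¬ ((k : ℤ) = -1) := by omega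
      simp [Derivation.vertexMode, h]
    | negSucc k =>
      cases k with
      | zero =>
        have h := D.vertexMode_negSucc 0 1 b
        simpa using h
      | succ k =>
        have h : ¬ (Int.negSucc (k + 1) = -1) := by omega
        simp [Derivation.vertexMode_negSucc, h, pow_succ]
  creation u := by
    have h := D.vertexMode_negSucc 0 u 1
    simpa using h
  creation_nonneg u n hn := by simp [D.vertexMode_nonneg n hn]
  translation u v n := by
    simp only [LinearMap.pi_apply, Derivation.vertexMode_neg_two]
    cases n with
    | ofNat k =>
      cases k with
      | zero => simp [Derivation.vertexMode]
      | succ k =>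
        have h : (Int.ofNat (k + 1) - 1) = Int.ofNat k := by simp
        rw [h]
        simp [Derivation.vertexMode]
    | negSucc k =>
      have h : Int.negSucc k - 1 = Int.negSucc (k + 1) := by omega
      have h2 : (-((Int.negSucc k : ℤ) : ℂ)) = (k : ℂ) + 1 := by
        rw [Int.cast_negSucc]; push_cast; ring
      have h3 : (k : ℂ) + 1 ≠ 0 := by exact_mod_cast Nat.succ_ne_zero k
      have h4 : ((k : ℂ) + 1) * ((Nat.factorial (k + 1) : ℂ)⁻¹) = (Nat.factorial k : ℂ)⁻¹ := by
        rw [Nat.factorial_succ]; push_cast; field_simp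
      rw [h, h2]
      simp only [Derivation.vertexMode_negSucc, smul_smul, h4, D.map_smul, D.leibniz,
        smul_eq_mul, pow_succ', Module.End.mul_apply, Derivation.coeFn_coe]
      rw [← smul_sub]
      congr 1
      ring
  locality u v := ⟨0, fun m n w => by
    simp [D.vertexMode_commute m n u v w]⟩

/-- The eigenspace `V^r = {u | g u = ξ^r u}` of an operator `g`. -/
def VertexAlgebra.eigenpart {V : Type*} [AddCommGroup V] [Module ℂ V]
    (g : V ≃ₗ[ℂ] V) (ξ : ℂ) (r : ℕ) : Set V :=
  {u | g u = ξ ^ r • u}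

/-- A `g`-twisted module structure on `M` over a vertex algebra, where `g` has order `p` and `ξ`
is the primitive `p`-th root of unity that labels the eigenspaces of `g`.
`mode v i` is the coefficient `v_i` of `Y_M(v, x) = ∑_{i ∈ (1/p)ℤ} v_i x^(-i-1)`.
The sums in `borcherds` have only finitely many nonzero terms, by the truncation properties. -/
structure TwistedModule {V : Type*} [AddCommGroup V] [Module ℂ V] (𝒱 : VertexAlgebra V)
    (g : V ≃ₗ[ℂ] V) (p : ℕ) (ξ : ℂ) (M : Type*) [AddCommGroup M] [Module ℂ M] where
  mode : V →ₗ[ℂ] (ℚ → Module.End ℂ M)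
  support : ∀ (v : V) (i : ℚ), (∀ k : ℤ, i ≠ k / p) → mode v i = 0
  support_eigenpart : ∀ r : ℕ, r < p → ∀ u ∈ VertexAlgebra.eigenpart g ξ r,
    ∀ i : ℚ, (∀ k : ℤ, i ≠ r / p + k) → mode u i = 0
  truncation : ∀ (u : V) (w : M), ∃ N : ℚ, ∀ i : ℚ, N ≤ i → mode u i w = 0
  vacuum_mode : ∀ i : ℚ, mode 𝒱.vacuum i = if i = -1 then 1 else 0
  borcherds : ∀ r : ℕ, r < p → ∀ s : ℕ, s < p →
    ∀ u ∈ VertexAlgebra.eigenpart g ξ r, ∀ v ∈ VertexAlgebra.eigenpart g ξ s,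
    ∀ m n : ℚ, (∃ k : ℤ, m = r / p + k) → (∃ k : ℤ, n = s / p + k) → ∀ (l : ℤ) (w : M),
      ∑ᶠ i : ℕ, ((Ring.choose m i : ℚ) : ℂ) • mode (𝒱.mode u (l + i) v) (m + n - i) w =
      ∑ᶠ i : ℕ, (((Ring.choose l i : ℤ) : ℂ) * (-1) ^ i) •
        (mode u (l + m - i) (mode v (n + i) w) +
          ((-1 : ℂ) ^ (l + 1)) • mode v (l + n - i) (mode u (m + i) w))

namespace TwistedModule

variable {V : Type*} [AddCommGroup V] [Module ℂ V] {𝒱 : VertexAlgebra V}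
  {g : V ≃ₗ[ℂ] V} {p : ℕ} {ξ : ℂ} {M : Type*} [AddCommGroup M] [Module ℂ M]
  {N : Type*} [AddCommGroup N] [Module ℂ N]

/-- The coefficient of `x^e` in `Y_M(v, x)`. -/
def coeff (Y : TwistedModule 𝒱 g p ξ M) (v : V) (e : ℚ) : Module.End ℂ M :=
  Y.mode v (-e - 1)

/-- A submodule: a subspace stable under all coefficients of all `Y_M(v, x)`. -/
def IsStable (Y : TwistedModule 𝒱 g p ξ M) (W : Submodule ℂ M) : Prop :=
  ∀ (v : V) (i : ℚ), ∀ w ∈ W, Y.mode v i w ∈ W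

/-- Nonzero, and not the direct sum of two nonzero submodules. -/
def Indecomposable (Y : TwistedModule 𝒱 g p ξ M) : Prop :=
  Nontrivial M ∧ ∀ W₁ W₂ : Submodule ℂ M, Y.IsStable W₁ → Y.IsStable W₂ →
    IsCompl W₁ W₂ → W₁ = ⊥ ∨ W₂ = ⊥

/-- Isomorphism of twisted modules. -/
def Isomorphic (Y : TwistedModule 𝒱 g p ξ M) (Z : TwistedModule 𝒱 g p ξ N) : Prop :=
  ∃ φ : M ≃ₗ[ℂ] N, ∀ (v : V) (i : ℚ) (w : M), φ (Y.mode v i w) = Z.mode v i (φ w)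

end TwistedModule

/-- The `n × n` nilpotent Jordan block `J_n` (ones just above the diagonal). -/
def jordanBlock (R : Type*) [Zero R] [One R] (n : ℕ) : Matrix (Fin n) (Fin n) R :=
  Matrix.of fun i j => if (i : ℕ) + 1 = j then 1 else 0

/-- `(x (1 + G(x)))^m = x^m ∑_{i ≥ 0} binom(m, i) G(x)^i` for `G` without constant term, as a
series in `x` with rational exponents. The coefficient of `x^k` in `G^i` vanishes for `i > k`. -/
noncomputable def shiftedPow (G : PowerSeries ℂ) (m : ℚ) : HahnSeries ℚ ℂ :=
  HahnSeries.single m 1 * HahnSeries.ofPowerSeries ℚ ℂ (PowerSeries.mk fun k =>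
    ∑ i ∈ Finset.range (k + 1), ((Ring.choose m i : ℚ) : ℂ) * PowerSeries.coeff k (G ^ i))

/-- `(E_n + F H)^m = ∑_{i ≥ 0} binom(m, i) (F H)^i` for an `n × n` matrix `H` with `H^n = 0`. -/
noncomputable def unipotentPow {n : ℕ} (F : HahnSeries ℚ ℂ)
    (H : Matrix (Fin n) (Fin n) (HahnSeries ℚ ℂ)) (m : ℚ) :
    Matrix (Fin n) (Fin n) (HahnSeries ℚ ℂ) :=
  ∑ i ∈ Finset.range n, (HahnSeries.C ((Ring.choose m i : ℚ) : ℂ) : HahnSeries ℚ ℂ) • (F • H) ^ i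

/-- The power series `exp(a x)`. -/
noncomputable def expSeries (a : ℂ) : PowerSeries ℂ :=
  PowerSeries.rescale a (PowerSeries.exp ℂ)

/-- The series `G` with `(-1 + exp(a x)) / a = x (1 + G(x))`, for `a ≠ 0`. -/
noncomputable def expQuotientTail (a : ℂ) : PowerSeries ℂ :=
  (PowerSeries.mk fun k => PowerSeries.coeff (k + 1) (expSeries a) / a) - 1

/-- `κ x^(-1/p) (E_n - x⁻¹ J_n)^(-1/p)`. -/
noncomputable def twistSeriesZero (p : ℕ) (κ : ℂ) (n : ℕ) :
    Matrix (Fin n) (Fin n) (HahnSeries ℚ ℂ) :=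
  (HahnSeries.C κ * HahnSeries.single (-1 / p : ℚ) 1) •
    unipotentPow (-HahnSeries.single (-1 : ℚ) (1 : ℂ)) (jordanBlock (HahnSeries ℚ ℂ) n)
      (-1 / p : ℚ)

/-- `κ ((-1 + exp(-c₁ p x)) / (-c₁ p))^(-1/p)
  (E_n - exp(-c₁ p x) / (-1 + exp(-c₁ p x)) J_n)^(-1/p)`, for `c₁ ≠ 0`. -/
noncomputable def twistSeriesExp (p : ℕ) (c₁ κ : ℂ) (n : ℕ) :
    Matrix (Fin n) (Fin n) (HahnSeries ℚ ℂ) :=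
  (HahnSeries.C κ * shiftedPow (expQuotientTail (-c₁ * p)) (-1 / p : ℚ)) •
    unipotentPow
      (-(HahnSeries.ofPowerSeries ℚ ℂ (expSeries (-c₁ * p)) /
        (-1 + HahnSeries.ofPowerSeries ℚ ℂ (expSeries (-c₁ * p)))))
      (jordanBlock (HahnSeries ℚ ℂ) n) (-1 / p : ℚ)

open Classical in
/-- The series `Y(t, x)` of the explicit module on `ℂ^n` with leading constant `κ`. -/
noncomputable def twistSeries (p : ℕ) (c₁ κ : ℂ) (n : ℕ) :
    Matrix (Fin n) (Fin n) (HahnSeries ℚ ℂ) :=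
  if c₁ = 0 then twistSeriesZero p κ n else twistSeriesExp p c₁ κ n

/-- `Y_M(v, x) = T(x)` for a matrix series `T` and a twisted module structure on `ℂ^n`. -/
def TwistedModule.HasSeries {V : Type*} [AddCommGroup V] [Module ℂ V] {𝒱 : VertexAlgebra V}
    {g : V ≃ₗ[ℂ] V} {p : ℕ} {ξ : ℂ} {n : ℕ} (Y : TwistedModule 𝒱 g p ξ (Fin n → ℂ)) (v : V)
    (T : Matrix (Fin n) (Fin n) (HahnSeries ℚ ℂ)) : Prop :=
  ∀ e : ℚ, Y.coeff v e = Matrix.toLin' (T.map fun h => h.coeff e)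

/-!
On a finite-dimensional twisted module the field `T = Y(t, x)` is a Hahn series with exponents in
`-1/p + ℤ` and commuting coefficients. The Borcherds identity at `l = -1` gives `Y(u, x) = u(T)` for
every polynomial `u` (`TwistedModule.series_eq_aeval`), so `T` determines the module. Conversely, a
solution `T` of the differential equation `T' = f(T)` with exponents in `-1/p + ℤ` and coefficients
in a commutative algebra acting on `M` defines a twisted module (`TwistedModule.ofSolution`); the
Borcherds identity is then the Chu-Vandermonde identity.

*The form of `f`.* The automorphism `g` is not assumed to commute with `D`, and the identity
`Y(D u, x) = Y(u, x)'` follows only on the exponents attached to the eigenspace of `u`. Hence `T` solves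
`T' = f₁(T)`, where `f₁` is the part of `f` with exponents in `1 + pℤ`
(`TwistedModule.series_X_euler`). A solution with nilpotent coefficients vanishes
(`HahnSeries.eq_zero_of_euler_eq`), so if `T ≠ 0` some character of the coefficient algebra takes
`T` to a nonzero scalar solution. Comparison of leading exponents shows that this solution has order
`-1/p` and that `f₁ = c₁ t + c t^(p+1)` with `c ≠ 0` (`HahnSeries.order_and_form_of_euler_eq`). Finally
`f = f₁`: the powers of the scalar solution are independent in each class of exponents, hence all
powers of `f d/dt` and `f₁ d/dt` have the same class-preserving parts, and this forces equality by a
comparison of formal flows (`Polynomial.eq_of_derivation_pow_class`).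

*The modules.* For `f = c₁ t + c t^(p+1)` the equation is of Bernoulli type: `V = T^(-p)` satisfies the
linear equation `V' = -p (c₁ V + c)`. Its solutions that matter are `-p c (E + H N)` with explicit scalar
series `E`, `H` (`HahnSeries.IsFundamental`) and a nilpotent constant `N`, and extraction of the
`-1/p`-th power by the binomial series gives the series of the theorem
(`HahnSeries.twistSolution`). For `N = J_n` the coefficient of `x^(-1/p-1)` is `J_n` times an invertible
operator, so submodules are invariant under an operator with a one-dimensional kernel, and the
module is indecomposable.

*Classification.* The coefficient algebra of an indecomposable module is local with residue field `ℂ`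
(`TwistedModule.Indecomposable.exists_character`). The constant term of `V` then determines `N`,
and the `p`-th root is unique up to a root of unity
(`HahnSeries.exists_eq_twistSolution`). All coefficients of `T` are polynomials in `N`, so `N` has no
nontrivial invariant decomposition and is a single Jordan block (`exists_equiv_jordanBlock`).
-/


/-! ### Hahn series with rational exponents -/

namespace HahnSeries

/-- The coefficientwise `ℂ`-algebra structure. Over commutative coefficients instance search also
finds `HahnSeries.powerSeriesAlgebra`, which is not definitionally equal to it; the priority makes
all `ℂ`-algebra structures below the coefficientwise one. -/
noncomputable instance (priority := 2000) instAlgebraComplex {R : Type*} [Semiring R]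
    [Algebra ℂ R] : Algebra ℂ (HahnSeries ℚ R) := HahnSeries.instAlgebra

/-- Application of an algebra homomorphism to all coefficients of a Hahn series. -/
noncomputable def mapAlgHom {R S : Type*} [Semiring R] [Algebra ℂ R] [Semiring S] [Algebra ℂ S]
    (φ : R →ₐ[ℂ] S) : HahnSeries ℚ R →ₐ[ℂ] HahnSeries ℚ S where
  toFun h := h.map φ
  map_one' := HahnSeries.map_one (φ : R →+* S).toMonoidWithZeroHom
  map_mul' _ _ := HahnSeries.map_mul ((φ : R →+* S) : R →ₙ+* S)
  map_zero' := HahnSeries.map_zero ((φ : R →+* S) : ZeroHom R S)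
  map_add' _ _ := HahnSeries.map_add ((φ : R →+* S) : R →+ S)
  commutes' r := by
    ext e
    simp only [algebraMap_apply, map_coeff, C_apply, coeff_single]
    split_ifs <;> simp

@[simp]
theorem mapAlgHom_coeff {R S : Type*} [Semiring R] [Algebra ℂ R] [Semiring S] [Algebra ℂ S]
    (φ : R →ₐ[ℂ] S) (h : HahnSeries ℚ R) (e : ℚ) :
    (mapAlgHom φ h).coeff e = φ (h.coeff e) := rfl

theorem mapAlgHom_single {R S : Type*} [Semiring R] [Algebra ℂ R] [Semiring S] [Algebra ℂ S]
    (φ : R →ₐ[ℂ] S) (e : ℚ) (r : R) :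
    mapAlgHom φ (single e r) = single e (φ r) :=
  HahnSeries.map_single ((φ : R →+* S) : ZeroHom R S)

theorem coeff_sum' {ι R : Type*} [Semiring R] (s : Finset ι) (F : ι → HahnSeries ℚ R) (e : ℚ) :
    (∑ i ∈ s, F i).coeff e = ∑ i ∈ s, (F i).coeff e :=
  map_sum (coeff.addMonoidHom e) F s

section Euler

variable {R : Type*} [Ring R] [Algebra ℂ R]

/-- The Euler operator `x d/dx` on series with rational exponents. -/
noncomputable def euler (h : HahnSeries ℚ R) : HahnSeries ℚ R where
  coeff e := (e : ℂ) • h.coeff e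
  isPWO_support' := h.isPWO_support.mono fun e he h0 => he (by simp [h0])

@[simp]
theorem euler_coeff (h : HahnSeries ℚ R) (e : ℚ) : (euler h).coeff e = (e : ℂ) • h.coeff e := rfl

theorem euler_add (a b : HahnSeries ℚ R) : euler (a + b) = euler a + euler b := by
  ext e; simp

theorem euler_neg (a : HahnSeries ℚ R) : euler (-a) = -euler a := by
  ext e; simp

theorem euler_sub (a b : HahnSeries ℚ R) : euler (a - b) = euler a - euler b := by
  ext e; simp [smul_sub]

theorem euler_C (r : R) : euler (C r : HahnSeries ℚ R) = 0 := by
  ext e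
  by_cases he : e = 0 <;> simp [C_apply, he]

theorem euler_one : euler (1 : HahnSeries ℚ R) = 0 := by
  rw [← C_one, euler_C]

theorem euler_single (q : ℚ) (r : R) : euler (single q r) = single q ((q : ℂ) • r) := by
  ext e
  by_cases he : e = q <;> simp [he]

theorem euler_mul (a b : HahnSeries ℚ R) : euler (a * b) = euler a * b + a * euler b := by
  ext e
  have ha : (euler a).support ⊆ a.support := fun e he h0 => he (by simp [h0])
  have hb : (euler b).support ⊆ b.support := fun e he h0 => he (by simp [h0])
  rw [coeff_add, coeff_mul_left' a.isPWO_support ha, coeff_mul_right' b.isPWO_support hb,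
    euler_coeff, coeff_mul, Finset.smul_sum, ← Finset.sum_add_distrib]
  refine Finset.sum_congr rfl fun ij hij => ?_
  have h := (Finset.mem_antidiagonal.1 hij).2.2
  rw [euler_coeff, euler_coeff, smul_mul_assoc, mul_smul_comm, ← add_smul, ← h]
  push_cast
  rfl

theorem euler_pow {R : Type*} [CommRing R] [Algebra ℂ R] (a : HahnSeries ℚ R) (n : ℕ) :
    euler (a ^ n) * a = n * a ^ n * euler a := by
  induction n with
  | zero => simp [euler_one]
  | succ n ih =>
    rw [pow_succ, euler_mul, add_mul, mul_right_comm, ih]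
    push_cast
    ring

theorem mapAlgHom_euler {S : Type*} [Ring S] [Algebra ℂ S] (φ : R →ₐ[ℂ] S)
    (h : HahnSeries ℚ R) : mapAlgHom φ (euler h) = euler (mapAlgHom φ h) := by
  ext e; simp

end Euler

section ExponentClass

variable {R : Type*} [Ring R]

/-- All exponents of the series lie in the coset `α + ℤ`. -/
def SupportedIn (h : HahnSeries ℚ R) (α : ℚ) : Prop :=
  ∀ e : ℚ, h.coeff e ≠ 0 → ∃ k : ℤ, e = α + k

theorem SupportedIn.add_int {h : HahnSeries ℚ R} {α β : ℚ} (hh : h.SupportedIn α)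
    (hαβ : ∃ k : ℤ, α = β + k) : h.SupportedIn β := by
  intro e he
  obtain ⟨k, hk⟩ := hh e he
  obtain ⟨j, hj⟩ := hαβ
  exact ⟨j + k, by rw [hk, hj]; push_cast; ring⟩

theorem supportedIn_zero (α : ℚ) : (0 : HahnSeries ℚ R).SupportedIn α := by
  intro e he; simp at he

theorem SupportedIn.add {a b : HahnSeries ℚ R} {α : ℚ} (ha : a.SupportedIn α)
    (hb : b.SupportedIn α) : (a + b).SupportedIn α := by
  intro e he
  by_cases h : a.coeff e = 0
  · exact hb e (by simpa [h] using he)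
  · exact ha e h

theorem SupportedIn.sum {ι : Type*} {s : Finset ι} {F : ι → HahnSeries ℚ R} {α : ℚ}
    (hF : ∀ i ∈ s, (F i).SupportedIn α) : (∑ i ∈ s, F i).SupportedIn α := by
  classical
  induction s using Finset.induction_on with
  | empty => simpa using supportedIn_zero α
  | insert i s hi ih =>
    rw [Finset.sum_insert hi]
    exact (hF i (Finset.mem_insert_self i s)).add
      (ih fun j hj => hF j (Finset.mem_insert_of_mem hj))

theorem SupportedIn.mul {a b : HahnSeries ℚ R} {α β : ℚ} (ha : a.SupportedIn α)
    (hb : b.SupportedIn β) : (a * b).SupportedIn (α + β) := by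
  intro e he
  obtain ⟨q, hq, q', hq', rfl⟩ := support_mul_subset (R := R) he
  obtain ⟨k, hk⟩ := ha q hq
  obtain ⟨j, hj⟩ := hb q' hq'
  exact ⟨k + j, by simp only [hk, hj]; push_cast; ring⟩

theorem supportedIn_single (q : ℚ) (r : R) : (single q r).SupportedIn q := by
  intro e he
  refine ⟨0, ?_⟩
  by_contra h
  exact he (coeff_single_of_ne (by simpa using h))

theorem supportedIn_C (r : R) : (C r : HahnSeries ℚ R).SupportedIn 0 := supportedIn_single 0 r

theorem SupportedIn.pow {a : HahnSeries ℚ R} {α : ℚ} (ha : a.SupportedIn α) (n : ℕ) :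
    (a ^ n).SupportedIn (n * α) := by
  induction n with
  | zero => simpa using supportedIn_C (1 : R)
  | succ n ih =>
    rw [pow_succ]
    refine (ih.mul ha).add_int ⟨0, by push_cast; ring⟩

theorem supportedIn_ofPowerSeries (G : PowerSeries R) :
    (ofPowerSeries ℚ R G).SupportedIn 0 := by
  intro e he
  rw [ofPowerSeries_apply] at he
  by_contra h
  refine he (embDomain_of_notMem_range ?_)
  rintro ⟨n, rfl⟩
  exact h ⟨n, by simp⟩

theorem ofPowerSeries_coeff_nat (G : PowerSeries R) (n : ℕ) :
    (ofPowerSeries ℚ R G).coeff (n : ℚ) = PowerSeries.coeff n G :=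
  ofPowerSeries_apply_coeff G n

theorem ofPowerSeries_coeff_of_neg (G : PowerSeries R) {e : ℚ} (he : e < 0) :
    (ofPowerSeries ℚ R G).coeff e = 0 := by
  rw [ofPowerSeries_apply]
  refine embDomain_of_notMem_range ?_
  rintro ⟨n, rfl⟩
  have : (0 : ℚ) ≤ n := n.cast_nonneg
  simp at he
  linarith

theorem ofPowerSeries_coeff_eq_zero (G : PowerSeries R) {e : ℚ} (he : ∀ n : ℕ, e ≠ n) :
    (ofPowerSeries ℚ R G).coeff e = 0 := by
  rw [ofPowerSeries_apply]
  refine embDomain_of_notMem_range ?_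
  rintro ⟨n, rfl⟩
  exact he n (by simp)

/-- The support of a Hahn series over `ℚ` is bounded below. -/
theorem exists_coeff_eq_zero_of_lt (h : HahnSeries ℚ R) :
    ∃ B : ℚ, ∀ e < B, h.coeff e = 0 :=
  ⟨h.order, fun _ he => coeff_eq_zero_of_lt_order he⟩

/-- The coefficients of a product as sums over the integers that index the coset of one factor. -/
theorem coeff_mul_eq_finsum (a b : HahnSeries ℚ R) {α : ℚ} (ha : a.SupportedIn α) (e : ℚ) :
    (a * b).coeff e = ∑ᶠ j : ℤ, a.coeff (α + j) * b.coeff (e - (α + j)) := by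
  have h1 : (a * b).coeff e = ∑ᶠ q : ℚ, a.coeff q * b.coeff (e - q) := by
    rw [coeff_mul, finsum_eq_sum_of_support_subset (s :=
      (Finset.antidiagonal a.isPWO_support b.isPWO_support e).image Prod.fst)]
    · rw [Finset.sum_image]
      · refine Finset.sum_congr rfl fun ij hij => ?_
        have h := (Finset.mem_antidiagonal.1 hij).2.2
        rw [← h, add_sub_cancel_left]
      · intro x hx y hy hxy
        have h1 := (Finset.mem_antidiagonal.1 hx).2.2
        have h2 := (Finset.mem_antidiagonal.1 hy).2.2
        ext
        · exact hxy
        · linarith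
    · intro q hq
      simp only [Finset.coe_image, Set.mem_image, Finset.mem_coe, Finset.mem_antidiagonal]
      refine ⟨(q, e - q), ⟨fun h0 => hq (by simp [h0]), fun h0 => hq ?_, by simp⟩, rfl⟩
      simp only [h0, mul_zero]
  rw [h1]
  have hinj : Function.Injective fun j : ℤ => α + (j : ℚ) := fun x y hxy => by simpa using hxy
  rw [← finsum_mem_range (f := fun q : ℚ => a.coeff q * b.coeff (e - q)) hinj,
    ← finsum_mem_univ]
  refine finsum_mem_inter_support_eq _ _ _ ?_
  ext q
  simp only [Set.mem_inter_iff, Set.mem_univ, true_and, Function.mem_support, Set.mem_range]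
  refine ⟨fun h => ⟨?_, h⟩, fun h => h.2⟩
  obtain ⟨k, hk⟩ := ha q fun h0 => h (by simp [h0])
  exact ⟨k, hk.symm⟩

theorem hasFiniteSupport_coeff_mul (a b : HahnSeries ℚ R) (α β : ℚ) :
    {j : ℤ | a.coeff (α + j) * b.coeff (β - j) ≠ 0}.Finite := by
  obtain ⟨A, hA⟩ := a.exists_coeff_eq_zero_of_lt
  obtain ⟨B, hB⟩ := b.exists_coeff_eq_zero_of_lt
  refine (Set.finite_Icc ⌊A - α⌋ ⌈β - B⌉).subset fun j hj => ⟨?_, ?_⟩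
  · by_contra h
    have h2 : (j : ℚ) < A - α := lt_of_lt_of_le (Int.cast_lt.2 (not_le.1 h)) (Int.floor_le _)
    exact hj (by rw [hA _ (by linarith), zero_mul])
  · by_contra h
    have h2 : β - B < (j : ℚ) := lt_of_le_of_lt (Int.le_ceil _) (Int.cast_lt.2 (not_le.1 h))
    exact hj (by rw [hB _ (by linarith), mul_zero])

end ExponentClass

/-- A function supported on the part of a coset of `(1/p)ℤ` in `ℚ` above a bound is the
coefficient function of a Hahn series. -/
theorem isPWO_of_bounded_coset {s : Set ℚ} {p : ℕ} (hp : 0 < p) {B : ℚ}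
    (hs : ∀ e ∈ s, ∃ k : ℤ, e = k / p) (hB : ∀ e ∈ s, B ≤ e) : s.IsPWO := by
  have hp' : (0 : ℚ) < p := by exact_mod_cast hp
  have h1 : (Set.Ici ⌊B * p⌋ : Set ℤ).IsPWO :=
    Set.IsWF.isPWO (BddBelow.wellFoundedOn_lt ⟨⌊B * p⌋, fun _ h => h⟩)
  refine (h1.image_of_monotone (f := fun k : ℤ => (k : ℚ) / p) ?_).mono ?_
  · intro x y hxy
    have : (x : ℚ) ≤ y := by exact_mod_cast hxy
    exact div_le_div_of_nonneg_right this hp'.le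
  · intro e he
    obtain ⟨k, hk⟩ := hs e he
    refine ⟨k, ?_, hk.symm⟩
    have h2 := hB e he
    rw [hk, le_div_iff₀ hp'] at h2
    exact Int.floor_le_iff.2 (by linarith)

end HahnSeries

/-! ### Binomial identities -/

section BinomialSums

theorem Ring.choose_neg_succ_mul (k i : ℕ) :
    Ring.choose (-((k : ℤ) + 1)) i * (-1) ^ i = ((k + i).choose k : ℕ) := by
  rw [Ring.choose_neg, show (k : ℤ) + 1 + i - 1 = ((k + i : ℕ) : ℤ) by push_cast; ring,
    Ring.choose_natCast, ← Nat.choose_symm_add, Units.smul_def, Int.coe_negOnePow_natCast, smul_eq_mul]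
  rw [mul_right_comm, ← mul_pow]
  simp

theorem Ring.choose_int_add_of_neg (k i : ℕ) :
    Ring.choose ((-((k : ℤ) + 1) - i) + k) k = (-1) ^ k * ((k + i).choose k : ℕ) := by
  rw [show (-((k : ℤ) + 1) - i) + k = -((i : ℤ) + 1) by ring,
    show (k + i).choose k = (i + k).choose i by rw [Nat.choose_symm_add, add_comm],
    ← Ring.choose_neg_succ_mul i k, mul_comm ((-1 : ℤ) ^ k), mul_assoc, ← mul_pow]
  simp

theorem Ring.sub_mul_choose (r : ℚ) (q : ℕ) :
    (r - q) * Ring.choose r q = (q + 1) * Ring.choose r (q + 1) := by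
  have h1 := Ring.descPochhammer_eq_factorial_smul_choose r q
  have h2 := Ring.descPochhammer_eq_factorial_smul_choose r (q + 1)
  have hq : ((q.factorial : ℕ) : ℚ) ≠ 0 := by exact_mod_cast q.factorial_ne_zero
  rw [descPochhammer_succ_right, Polynomial.smeval_mul, h1] at h2
  simp only [nsmul_eq_mul, Nat.factorial_succ, Polynomial.smeval_sub, Polynomial.smeval_X, pow_one,
    Polynomial.smeval_natCast, pow_zero, mul_one] at h2
  push_cast at h2
  refine mul_left_cancel₀ hq ?_
  linear_combination h2

variable {M : Type*} [AddCommGroup M] [Module ℂ M]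

/-- For a negative integer `l = -(k + 1)`, the right-hand side of the twisted Borcherds identity is
one sum over `ℤ`: the summands with indices `-k, …, -1` that it lacks have coefficient `0`. -/
theorem finsum_choose_neg (G : ℤ → M) (hG : G.support.Finite) (k : ℕ) :
    ∑ᶠ i : ℕ, (((Ring.choose (-((k : ℤ) + 1)) i : ℤ) : ℂ) * (-1) ^ i) •
      (G i + ((-1 : ℂ) ^ (-((k : ℤ) + 1) + 1)) • G (-((k : ℤ) + 1) - i)) =
    ∑ᶠ j : ℤ, ((Ring.choose (j + k) k : ℤ) : ℂ) • G j := by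
  have hc : ∀ i : ℕ, (((Ring.choose (-((k : ℤ) + 1)) i : ℤ) : ℂ) * (-1) ^ i) =
      ((k + i).choose k : ℕ) := fun i => by
    have := congrArg (Int.cast : ℤ → ℂ) (Ring.choose_neg_succ_mul k i)
    push_cast at this
    exact this
  have hs : (-1 : ℂ) ^ (-((k : ℤ) + 1) + 1) = (-1) ^ k := by
    rw [show -((k : ℤ) + 1) + 1 = -(k : ℤ) by ring, zpow_neg, zpow_natCast, ← inv_pow]
    norm_num
  simp only [hc, hs]
  set F : ℤ → M := fun j => ((Ring.choose (j + k) k : ℤ) : ℂ) • G j with hF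
  have hFG : F.support ⊆ G.support := fun j hj h0 => hj (by simp [hF, h0])
  have hf : Function.Injective fun i : ℕ => (i : ℤ) := Nat.cast_injective
  have hg : Function.Injective fun i : ℕ => -((k : ℤ) + 1) - i := fun x y hxy => by
    simpa using hxy
  have h1 : ∀ i : ℕ, F i = (((k + i).choose k : ℕ) : ℂ) • G i := fun i => by
    simp only [hF]
    rw [show (i : ℤ) + k = ((k + i : ℕ) : ℤ) by push_cast; ring, Ring.choose_natCast]
    simp
  have h2 : ∀ i : ℕ, F (-((k : ℤ) + 1) - i) =
      (((k + i).choose k : ℕ) : ℂ) • ((-1 : ℂ) ^ k) • G (-((k : ℤ) + 1) - i) := fun i => by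
    simp only [hF]
    rw [Ring.choose_int_add_of_neg, smul_smul, mul_comm]
    push_cast
    rfl
  have hsplit : ∑ᶠ j : ℤ, F j = ∑ᶠ i : ℕ, F i + ∑ᶠ i : ℕ, F (-((k : ℤ) + 1) - i) := by
    rw [← finsum_mem_range hf, ← finsum_mem_range hg, ← finsum_mem_union', ← finsum_mem_univ]
    · refine finsum_mem_inter_support_eq _ _ _ ?_
      ext j
      simp only [Set.univ_inter, Function.mem_support, Set.mem_inter_iff, Set.mem_union,
        Set.mem_range]
      refine ⟨fun h => ⟨?_, h⟩, fun h => h.2⟩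
      rcases le_or_gt 0 j with hj | hj
      · exact Or.inl ⟨j.toNat, by omega⟩
      · right
        refine ⟨(-(k + 1) - j).toNat, ?_⟩
        have : j + k < 0 := by
          by_contra hjk
          refine h ?_
          simp only [hF]
          rw [show j + k = ((j + k).toNat : ℤ) by omega, Ring.choose_natCast,
            Nat.choose_eq_zero_of_lt (by omega)]
          simp
        omega
    · rw [Set.disjoint_left]
      rintro _ ⟨a, rfl⟩ ⟨b, hb⟩
      simp only at hb
      omega
    · exact (hG.subset hFG).subset Set.inter_subset_right
    · exact (hG.subset hFG).subset Set.inter_subset_right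
  rw [hsplit, ← finsum_add_distrib]
  · simp only [h1, h2, smul_add]
  · exact ((hG.subset hFG).preimage hf.injOn).subset fun i hi => hi
  · exact ((hG.subset hFG).preimage hg.injOn).subset fun i hi => hi

/-- For an integer `l ≥ 0` the right-hand side of the twisted Borcherds identity for commuting modes
vanishes: the substitution `i ↦ l - i` exchanges its two halves up to sign. -/
theorem finsum_choose_nat (G : ℤ → M) (l : ℕ) :
    ∑ᶠ i : ℕ, (((Ring.choose (l : ℤ) i : ℤ) : ℂ) * (-1) ^ i) •
      (G i + ((-1 : ℂ) ^ ((l : ℤ) + 1)) • G ((l : ℤ) - i)) = 0 := by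
  rw [finsum_eq_sum_of_support_subset (s := Finset.range (l + 1))]
  · simp only [smul_add, Finset.sum_add_distrib]
    rw [← Finset.sum_range_reflect, ← Finset.sum_add_distrib]
    refine Finset.sum_eq_zero fun i hi => ?_
    have hi' : i ≤ l := Nat.lt_succ_iff.1 (Finset.mem_range.1 hi)
    have h1 : l + 1 - 1 - i = l - i := by omega
    rw [h1, Ring.choose_natCast, Ring.choose_natCast, Nat.choose_symm hi', smul_smul,
      Nat.cast_sub hi', ← add_smul]
    have h2 : (-1 : ℂ) ^ (l - i) = (-1) ^ l * (-1) ^ i := by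
      have h3 : (-1 : ℂ) ^ i * (-1) ^ i = 1 := by rw [← mul_pow]; simp
      rw [show (-1 : ℂ) ^ l = (-1) ^ (l - i) * (-1) ^ i by rw [← pow_add, Nat.sub_add_cancel hi'],
        mul_assoc, h3, mul_one]
    have h4 : (-1 : ℂ) ^ ((l : ℤ) + 1) = -(-1) ^ l := by
      rw [zpow_add_one₀ (by norm_num), zpow_natCast]; ring
    rw [h2, h4]
    convert zero_smul ℂ _
    ring
  · intro i hi
    by_contra h
    have : l < i := by simpa using h
    refine hi ?_
    simp [Ring.choose_natCast, Nat.choose_eq_zero_of_lt this]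

end BinomialSums

/-! ### Eigenspaces of the automorphism, and polynomials in a series -/

section Eigenspaces

theorem AlgEquiv.apply_eq_comp_of_scale {g : ℂ[X] ≃ₐ[ℂ] ℂ[X]} {ξ : ℂ} (hξ : g X = C ξ * X)
    (u : ℂ[X]) : g u = u.comp (C ξ * X) := by
  have h : (g : ℂ[X] →ₐ[ℂ] ℂ[X]) = aeval (C ξ * X) := by
    refine Polynomial.algHom_ext ?_
    simpa using hξ
  have h2 := DFunLike.congr_fun h u
  simpa [aeval_def, comp, eval₂_eq_eval_map] using h2

theorem isPrimitiveRoot_of_orderOf_scale {g : ℂ[X] ≃ₐ[ℂ] ℂ[X]} {ξ : ℂ} (hξ : g X = C ξ * X)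
    {p : ℕ} (hg : orderOf g = p) : IsPrimitiveRoot ξ p := by
  have hpow : ∀ k : ℕ, (g ^ k) X = C (ξ ^ k) * X := by
    intro k
    induction k with
    | zero => simp
    | succ k ih =>
      rw [pow_succ', AlgEquiv.mul_apply, ih, map_mul, hξ]
      have : g (C (ξ ^ k)) = C (ξ ^ k) := g.commutes (ξ ^ k)
      rw [this, ← mul_assoc, ← C_mul, ← pow_succ]
  have hiff : ∀ k : ℕ, g ^ k = 1 ↔ ξ ^ k = 1 := by
    intro k
    constructor
    · intro h
      have h1 := hpow k
      rw [h, AlgEquiv.one_apply] at h1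
      have h2 := congrArg (fun q : ℂ[X] => q.coeff 1) h1
      simp only [coeff_C_mul, coeff_X_one, mul_one] at h2
      exact h2.symm
    · intro h
      have h1 : ((g ^ k : ℂ[X] ≃ₐ[ℂ] ℂ[X]) : ℂ[X] →ₐ[ℂ] ℂ[X]) = AlgHom.id ℂ _ := by
        refine Polynomial.algHom_ext ?_
        simpa [h] using hpow k
      ext1 u
      exact DFunLike.congr_fun h1 u
  refine (IsPrimitiveRoot.iff_def ξ p).2 ⟨(hiff p).1 ?_, fun l hl => ?_⟩
  · rw [← hg, pow_orderOf_eq_one]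
  · rw [← hg]
    exact orderOf_dvd_of_pow_eq_one ((hiff l).2 hl)

variable {g : ℂ[X] ≃ₐ[ℂ] ℂ[X]} {ξ : ℂ} {p : ℕ}

theorem X_pow_mem_eigenpart (hξ : g X = C ξ * X) (hp : IsPrimitiveRoot ξ p) (k : ℕ) :
    (X ^ k : ℂ[X]) ∈ VertexAlgebra.eigenpart g.toLinearEquiv ξ (k % p) := by
  have h1 : ξ ^ (k % p) = ξ ^ k := by
    conv_rhs => rw [← Nat.mod_add_div k p, pow_add, pow_mul, hp.pow_eq_one, one_pow, mul_one]
  have h2 : g (X ^ k) = ξ ^ k • X ^ k := by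
    rw [map_pow, hξ, mul_pow, ← C_pow, smul_eq_C_mul]
  rw [← h1] at h2
  exact h2

/-- If `T` has exponents in `-1/p + ℤ` and `u` lies in the eigenspace of `ξ^r`, then every monomial
of `u(T)` has exponents in `-r/p + ℤ`. -/
theorem exists_int_of_mem_eigenpart (hξ : g X = C ξ * X) (hp : IsPrimitiveRoot ξ p) (hp0 : 0 < p)
    {r : ℕ} {u : ℂ[X]} (hu : u ∈ VertexAlgebra.eigenpart g.toLinearEquiv ξ r) (k : ℕ)
    (hk : u.coeff k ≠ 0) : ∃ j : ℤ, (k : ℚ) * (-1 / p) = -(r / p) + j := by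
  have h1 : g u = ξ ^ r • u := hu
  rw [AlgEquiv.apply_eq_comp_of_scale hξ] at h1
  have h2 := congrArg (fun q : ℂ[X] => q.coeff k) h1
  simp only [comp_C_mul_X_coeff, coeff_smul, smul_eq_mul] at h2
  have h3 : ξ ^ k = ξ ^ r := mul_left_cancel₀ hk (by rw [h2, mul_comm])
  have hξ0 : ξ ≠ 0 := hp.ne_zero hp0.ne'
  have h4 : ξ ^ ((r : ℤ) - k) = 1 := by
    rw [zpow_sub₀ hξ0, zpow_natCast, zpow_natCast, h3, div_self (pow_ne_zero _ hξ0)]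
  obtain ⟨j, hj⟩ := (hp.zpow_eq_one_iff_dvd _).1 h4
  refine ⟨j, ?_⟩
  have hp' : (p : ℚ) ≠ 0 := by exact_mod_cast hp0.ne'
  have hj' : (r : ℚ) - k = p * j := by exact_mod_cast hj
  field_simp
  linarith

end Eigenspaces

namespace HahnSeries

theorem coeff_smul_complex {R : Type*} [Ring R] [Algebra ℂ R] (c : ℂ) (h : HahnSeries ℚ R)
    (e : ℚ) : (c • h).coeff e = c • h.coeff e := rfl

theorem coeff_aeval {R : Type*} [Ring R] [Algebra ℂ R] (T : HahnSeries ℚ R) (u : ℂ[X]) (e : ℚ) :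
    (aeval T u).coeff e = ∑ i ∈ Finset.range (u.natDegree + 1), u.coeff i • (T ^ i).coeff e := by
  rw [aeval_eq_sum_range, coeff_sum']
  rfl

theorem SupportedIn.smul {R : Type*} [Ring R] [Algebra ℂ R] {h : HahnSeries ℚ R} {α : ℚ}
    (hh : h.SupportedIn α) (c : ℂ) : (c • h).SupportedIn α := fun e he =>
  hh e fun h0 => he (by rw [coeff_smul_complex, h0, smul_zero])

theorem supportedIn_aeval {R : Type*} [Ring R] [Algebra ℂ R] {T : HahnSeries ℚ R} {α β : ℚ}
    (hT : T.SupportedIn α) {u : ℂ[X]} (hu : ∀ k : ℕ, u.coeff k ≠ 0 → ∃ j : ℤ, k * α = β + j) :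
    (aeval T u).SupportedIn β := by
  rw [aeval_eq_sum_range]
  refine SupportedIn.sum fun k _ => ?_
  by_cases hk : u.coeff k = 0
  · rw [hk, zero_smul]
    exact supportedIn_zero β
  · exact ((hT.pow k).smul _).add_int (hu k hk)

section Translation

variable {R : Type*} [CommRing R] [Algebra ℂ R] {T : HahnSeries ℚ R} {f : ℂ[X]}

theorem euler_aeval (hT : euler T = single 1 1 * aeval T f) (u : ℂ[X]) :
    euler (aeval T u) = single 1 1 * aeval T ((f • derivative' : Derivation ℂ ℂ[X] ℂ[X]) u) := by
  induction u using Polynomial.induction_on with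
  | C a =>
    have h : (f • derivative' : Derivation ℂ ℂ[X] ℂ[X]) (Polynomial.C a) = 0 :=
      Derivation.map_algebraMap _ a
    rw [h, aeval_C, HahnSeries.algebraMap_apply, euler_C, map_zero, mul_zero]
  | add u v hu hv => rw [map_add, euler_add, hu, hv, map_add, map_add, mul_add]
  | monomial n a h =>
    have hX : (f • derivative' : Derivation ℂ ℂ[X] ℂ[X]) X = f := by simp
    rw [pow_succ, ← mul_assoc, map_mul, euler_mul, h, Derivation.leibniz _ (Polynomial.C a * X ^ n), hX, aeval_X, hT]
    simp only [smul_eq_mul, map_add, map_mul, aeval_X]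
    ring

theorem coeff_aeval_derivation (hT : euler T = single 1 1 * aeval T f) (u : ℂ[X]) (e : ℚ) :
    (aeval T ((f • derivative' : Derivation ℂ ℂ[X] ℂ[X]) u)).coeff e =
      ((e + 1 : ℚ) : ℂ) • (aeval T u).coeff (e + 1) := by
  have h := congrArg (fun s : HahnSeries ℚ R => s.coeff (e + 1)) (euler_aeval hT u)
  simp only [euler_coeff, coeff_single_mul_add, one_mul] at h
  exact h.symm

/-- `D = f d/dt` acts on the series `u(T)` as `d/dx`, and `D^q` as its `q`-th iterate. -/
theorem coeff_aeval_derivation_pow (hT : euler T = single 1 1 * aeval T f) (u : ℂ[X]) (q : ℕ)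
    (e : ℚ) :
    (aeval T ((((f • derivative' : Derivation ℂ ℂ[X] ℂ[X]) : ℂ[X] →ₗ[ℂ] ℂ[X]) ^ q) u)).coeff e =
      ((q.factorial * Ring.choose (e + q) q : ℚ) : ℂ) • (aeval T u).coeff (e + q) := by
  induction q generalizing e with
  | zero => simp
  | succ q ih =>
    rw [pow_succ', Module.End.mul_apply, Derivation.coeFn_coe, coeff_aeval_derivation hT, ih,
      smul_smul, ← Rat.cast_mul]
    have h1 : e + 1 + q = e + (q + 1 : ℕ) := by push_cast; ring
    have h2 := Ring.sub_mul_choose (e + (q + 1 : ℕ)) q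
    rw [h1]
    congr 2
    rw [Nat.factorial_succ]
    push_cast at h2 ⊢
    linear_combination (q.factorial : ℚ) * h2

end Translation

end HahnSeries

/-! ### The twisted module defined by a solution of `T' = f(T)` -/

namespace HahnSeries

variable {R : Type*} [CommRing R] [Algebra ℂ R] {T : HahnSeries ℚ R} {f : ℂ[X]}

/-- The left-hand side of the twisted Borcherds identity at `l = -(k + 1)`, for the modes read off
from a solution `T` of `x T' = x f(T)`: the Chu-Vandermonde identity sums the binomials. -/
theorem sum_choose_coeff_vertexMode (hT : euler T = single 1 1 * aeval T f) (u v : ℂ[X])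
    {α : ℚ} (hu : (aeval T u).SupportedIn α) (m n : ℚ) (hm : ∃ k : ℤ, -m = α + k) (k : ℕ) :
    ∑ i ∈ Finset.range (k + 1), ((Ring.choose m i : ℚ) : ℂ) •
      (aeval T ((f • derivative' : Derivation ℂ ℂ[X] ℂ[X]).vertexMode (-((k : ℤ) + 1) + i) u v)).coeff
        (-(m + n - i) - 1) =
    ∑ᶠ j : ℤ, ((Ring.choose (j + k) k : ℤ) : ℂ) •
      ((aeval T u).coeff (-(-((k : ℤ) + 1 : ℚ) + m - j) - 1) * (aeval T v).coeff (-(n + j) - 1)) := by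
  set D : Derivation ℂ ℂ[X] ℂ[X] := f • derivative' with hD
  set F : ℤ → R := fun j => (aeval T u).coeff (-(-((k : ℤ) + 1 : ℚ) + m - j) - 1) *
    (aeval T v).coeff (-(n + j) - 1) with hF
  have hfin : F.support.Finite := by
    have := hasFiniteSupport_coeff_mul (aeval T u) (aeval T v) (k - m) (-n - 1)
    refine this.subset fun j hj => ?_
    have h1 : (-(-((k : ℤ) + 1 : ℚ) + m - j) - 1) = k - m + j := by push_cast; ring
    have h2 : -(n + j : ℚ) - 1 = -n - 1 - j := by ring
    simp only [hF, Function.mem_support, h1, h2] at hj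
    exact hj
  have hterm : ∀ i ∈ Finset.range (k + 1), ((Ring.choose m i : ℚ) : ℂ) •
      (aeval T (D.vertexMode (-((k : ℤ) + 1) + i) u v)).coeff (-(m + n - i) - 1) =
      ∑ᶠ j : ℤ, ((Ring.choose m i * Ring.choose (k - m + j) (k - i) : ℚ) : ℂ) • F j := by
    intro i hi
    obtain ⟨q, hq⟩ : ∃ q, k = i + q := ⟨k - i, by have := Finset.mem_range.1 hi; omega⟩
    have hneg : -((k : ℤ) + 1) + i = Int.negSucc q := by
      rw [Int.negSucc_eq, hq]; push_cast; ring
    have hs : (aeval T (((D : ℂ[X] →ₗ[ℂ] ℂ[X]) ^ q) u)).SupportedIn α := by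
      intro e he
      rw [coeff_aeval_derivation_pow hT] at he
      obtain ⟨z, hz⟩ := hu (e + q) fun h0 => he (by rw [h0, smul_zero])
      exact ⟨z - q, by push_cast; linarith⟩
    rw [hneg, Derivation.vertexMode_negSucc, map_smul, map_mul, coeff_smul_complex]
    obtain ⟨z, hz⟩ := hm
    have hs' := hs.add_int (β := i - m) ⟨-z - i, by push_cast; linarith⟩
    rw [coeff_mul_eq_finsum _ _ hs', smul_finsum, smul_finsum]
    refine finsum_congr fun j => ?_
    rw [coeff_aeval_derivation_pow hT, smul_mul_assoc, smul_smul, smul_smul]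
    have e1 : (i - m + j + q : ℚ) = k - m + j := by rw [hq]; push_cast; ring
    have e2 : (-(m + n - i) - 1 - (i - m + j) : ℚ) = -(n + j) - 1 := by ring
    have e3 : (-(-((k : ℤ) + 1 : ℚ) + m - j) - 1) = k - m + j := by push_cast; ring
    have e4 : k - i = q := by omega
    have hq0 : (q.factorial : ℂ) ≠ 0 := by exact_mod_cast q.factorial_ne_zero
    simp only [hF]
    rw [e1, e2, e3, e4]
    congr 1
    push_cast
    field_simp
  rw [Finset.sum_congr rfl hterm, ← finsum_sum_comm]
  · refine finsum_congr fun j => ?_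
    rw [← Finset.sum_smul, ← Rat.cast_sum]
    congr 1
    have hv := Ring.add_choose_eq (r := m) (s := k - m + j) k (Commute.all _ _)
    rw [Finset.Nat.sum_antidiagonal_eq_sum_range_succ_mk] at hv
    rw [← hv, show m + (k - m + j) = ((j + k : ℤ) : ℚ) by push_cast; ring]
    have := Ring.map_choose (Int.castRingHom ℚ) (j + k) k
    simp only [Int.coe_castRingHom] at this
    rw [← this]
    simp
  · intro i _
    exact hfin.subset fun j hj h0 => hj (by simp only [h0, smul_zero])

end HahnSeries

namespace TwistedModule

variable {g : ℂ[X] ≃ₐ[ℂ] ℂ[X]} {ξ : ℂ} {p : ℕ} {f : ℂ[X]}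

open HahnSeries

/-- The twisted module with `Y(t, x) = T`, for a solution `T` of `T' = f(T)` with coefficients in a
commutative algebra `R` that acts on `M`. -/
noncomputable def ofSolution {R : Type*} [CommRing R] [Algebra ℂ R] {M : Type*} [AddCommGroup M]
    [Module ℂ M] (ρ : R →ₐ[ℂ] Module.End ℂ M) (hp : 0 < p) (hξ : g X = Polynomial.C ξ * X)
    (hprim : IsPrimitiveRoot ξ p) (T : HahnSeries ℚ R) (hsupp : T.SupportedIn (-1 / p))
    (hT : euler T = single 1 1 * aeval T f) :
    TwistedModule (f • derivative' : Derivation ℂ ℂ[X] ℂ[X]).vertexAlgebra g.toLinearEquiv p ξ M :=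
  have hp' : (p : ℚ) ≠ 0 := by exact_mod_cast hp.ne'
  have heig : ∀ r : ℕ, ∀ u ∈ VertexAlgebra.eigenpart g.toLinearEquiv ξ r,
      (aeval T u).SupportedIn (-(r / p)) := fun r u hu =>
    supportedIn_aeval hsupp (exists_int_of_mem_eigenpart hξ hprim hp hu)
  { mode :=
      { toFun := fun u i => ρ ((aeval T u).coeff (-i - 1))
        map_add' := fun u v => by ext1 i; simp
        map_smul' := fun c u => by
          ext1 i
          rw [map_smul, coeff_smul_complex, map_smul]
          rfl }
    support := by
      intro v i hi
      have h : (aeval T v).coeff (-i - 1) = 0 := by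
        rw [coeff_aeval]
        refine Finset.sum_eq_zero fun k _ => ?_
        by_contra h0
        obtain ⟨j, hj⟩ := (hsupp.pow k) (-i - 1) fun h1 => h0 (by rw [h1, smul_zero])
        refine hi (k - p * (j + 1)) ?_
        push_cast
        field_simp at hj ⊢
        linarith
      simp [h]
    support_eigenpart := by
      intro r _ u hu i hi
      have h : (aeval T u).coeff (-i - 1) = 0 := by
        by_contra h0
        obtain ⟨j, hj⟩ := heig r u hu (-i - 1) h0
        exact hi (-j - 1) (by push_cast; linarith)
      simp [h]
    truncation := by
      intro u w
      obtain ⟨B, hB⟩ := (aeval T u).exists_coeff_eq_zero_of_lt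
      refine ⟨-B, fun i hi => ?_⟩
      have h : (aeval T u).coeff (-i - 1) = 0 := hB _ (by linarith)
      simp [h]
    vacuum_mode := by
      intro i
      have h : (aeval T (1 : ℂ[X])).coeff (-i - 1) = if i = -1 then 1 else 0 := by
        rw [map_one, HahnSeries.coeff_one]
        by_cases hi : i = -1
        · rw [if_pos hi, if_pos (by linarith)]
        · rw [if_neg hi, if_neg fun h => hi (by linarith)]
      change ρ ((aeval T (1 : ℂ[X])).coeff (-i - 1)) = _
      rw [h]
      split_ifs <;> simp
    borcherds := by
      rintro r _ s _ u hu v hv m n ⟨km, hm⟩ ⟨kn, hn⟩ l w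
      change ∑ᶠ i : ℕ, ((Ring.choose m i : ℚ) : ℂ) •
        ρ ((aeval T ((f • derivative' : Derivation ℂ ℂ[X] ℂ[X]).vertexMode (l + i) u v)).coeff
          (-(m + n - i) - 1)) w = ∑ᶠ i : ℕ, (((Ring.choose l i : ℤ) : ℂ) * (-1) ^ i) •
        (ρ ((aeval T u).coeff (-(l + m - i) - 1)) (ρ ((aeval T v).coeff (-(n + i) - 1)) w) +
          ((-1 : ℂ) ^ (l + 1)) •
            ρ ((aeval T v).coeff (-(l + n - i) - 1)) (ρ ((aeval T u).coeff (-(m + i) - 1)) w))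
      set F : ℤ → R := fun j => (aeval T u).coeff (-(l + m - j) - 1) *
        (aeval T v).coeff (-(n + j) - 1) with hF
      have hFfin : F.support.Finite := by
        have := hasFiniteSupport_coeff_mul (aeval T u) (aeval T v) (-(l + m) - 1) (-n - 1)
        refine this.subset fun j hj => ?_
        have h1 : (-(l + m - j : ℚ) - 1) = -(l + m) - 1 + j := by ring
        have h2 : -(n + j : ℚ) - 1 = -n - 1 - j := by ring
        simp only [hF, Function.mem_support, h1, h2] at hj
        exact hj
      set G : ℤ → M := fun j => ρ (F j) w with hG
      have hGfin : G.support.Finite := hFfin.subset fun j hj h0 => hj (by simp [hG, h0])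
      have hR : ∀ i : ℕ,
          (ρ ((aeval T u).coeff (-(l + m - i) - 1)) (ρ ((aeval T v).coeff (-(n + i) - 1)) w) +
          ((-1 : ℂ) ^ (l + 1)) •
            ρ ((aeval T v).coeff (-(l + n - i) - 1)) (ρ ((aeval T u).coeff (-(m + i) - 1)) w)) =
          G i + ((-1 : ℂ) ^ (l + 1)) • G (l - i) := by
        intro i
        simp only [hG, hF, map_mul, Module.End.mul_apply]
        push_cast
        congr 2
        rw [← Module.End.mul_apply, ← map_mul, mul_comm, map_mul, Module.End.mul_apply,
          show (l + m - (l - i) : ℚ) = m + i by ring, show (n + (l - i) : ℚ) = l + n - i by ring]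
      simp only [hR]
      rcases le_or_gt 0 l with hl | hl
      · obtain ⟨l, rfl⟩ := Int.eq_ofNat_of_zero_le hl
        rw [finsum_choose_nat]
        refine (finsum_congr fun i => ?_).trans finsum_zero
        rw [Derivation.vertexMode_nonneg _ _ (by positivity)]
        simp
      · obtain ⟨k, rfl⟩ : ∃ k : ℕ, l = -((k : ℤ) + 1) := ⟨(-l - 1).toNat, by omega⟩
        rw [finsum_choose_neg G hGfin k,
          finsum_eq_sum_of_support_subset (s := Finset.range (k + 1))]
        · have h := congrArg (fun c => ρ c w) (sum_choose_coeff_vertexMode hT u v (heig r u hu) m n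
            ⟨-km, by rw [hm]; push_cast; ring⟩ k)
          simp only [map_sum, map_smul, LinearMap.sum_apply, LinearMap.smul_apply] at h
          rw [h]
          have hfold : ∀ j : ℤ, (aeval T u).coeff (-(-((k : ℤ) + 1 : ℚ) + m - j) - 1) *
              (aeval T v).coeff (-(n + j) - 1) = F j := by
            intro j
            simp only [hF]
            push_cast
            rfl
          simp only [hfold]
          have hfin : (Function.support fun j : ℤ =>
              ((Ring.choose (j + k) k : ℤ) : ℂ) • F j).Finite :=
            hFfin.subset fun j hj h0 => hj (by simp only [h0, smul_zero])
          let ev : R →+ M := (LinearMap.applyₗ (R := ℂ) w).toAddMonoidHom.comp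
            (ρ : R →ₗ[ℂ] Module.End ℂ M).toAddMonoidHom
          have h2 := ev.map_finsum hfin
          change ev _ = _
          rw [h2]
          refine finsum_congr fun j => ?_
          change ρ (((Ring.choose (j + k) k : ℤ) : ℂ) • F j) w = _
          rw [map_smul]
          rfl
        · intro i hi
          by_contra h
          have hik : k < i := by simpa using h
          refine hi ?_
          simp only
          rw [Derivation.vertexMode_nonneg _ _ (by omega)]
          simp }

theorem ofSolution_mode {R : Type*} [CommRing R] [Algebra ℂ R] {M : Type*} [AddCommGroup M]
    [Module ℂ M] (ρ : R →ₐ[ℂ] Module.End ℂ M) (hp : 0 < p) (hξ : g X = Polynomial.C ξ * X)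
    (hprim : IsPrimitiveRoot ξ p) (T : HahnSeries ℚ R) (hsupp : T.SupportedIn (-1 / p))
    (hT : euler T = single 1 1 * aeval T f) (u : ℂ[X]) (i : ℚ) :
    (ofSolution ρ hp hξ hprim T hsupp hT).mode u i = ρ ((aeval T u).coeff (-i - 1)) := rfl

end TwistedModule

/-! ### The field `Y(t, x)` determines the module -/

theorem Derivation.vertexAlgebra_mode {A : Type*} [CommRing A] [Algebra ℂ A]
    (D : Derivation ℂ A A) (u : A) (n : ℤ) : D.vertexAlgebra.mode u n = D.vertexMode n u := rfl

namespace TwistedModule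

open HahnSeries

section Series

variable {V : Type*} [AddCommGroup V] [Module ℂ V] {𝒱 : VertexAlgebra V}
  {g : V ≃ₗ[ℂ] V} {p : ℕ} {ξ : ℂ} {M : Type*} [AddCommGroup M] [Module ℂ M]

theorem exists_truncation_uniform [FiniteDimensional ℂ M] (Y : TwistedModule 𝒱 g p ξ M) (v : V) :
    ∃ N : ℚ, ∀ i : ℚ, N ≤ i → Y.mode v i = 0 := by
  let b := Module.finBasis ℂ M
  choose N hN using fun j => Y.truncation v (b j)
  obtain ⟨B, hB⟩ := (Set.finite_range N).bddAbove
  refine ⟨B, fun i hi => b.ext fun j => ?_⟩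
  rw [hN j i ((hB ⟨j, rfl⟩).trans hi), LinearMap.zero_apply]

/-- The series `Y_M(v, x)`. It is a Hahn series because a finite-dimensional module truncates the
modes of `v` uniformly. -/
noncomputable def series [FiniteDimensional ℂ M] (Y : TwistedModule 𝒱 g p ξ M) (hp : 0 < p)
    (v : V) : HahnSeries ℚ (Module.End ℂ M) where
  coeff e := Y.coeff v e
  isPWO_support' := by
    obtain ⟨N, hN⟩ := Y.exists_truncation_uniform v
    refine isPWO_of_bounded_coset hp (B := -N - 1) (fun e he => ?_) fun e he => ?_
    · by_contra h
      refine he (Y.support v _ fun k hk => h ⟨-k - p, ?_⟩)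
      have hp' : (p : ℚ) ≠ 0 := by exact_mod_cast hp.ne'
      push_cast
      field_simp at hk ⊢
      linarith
    · by_contra h
      exact he (hN _ (by linarith))

theorem series_coeff [FiniteDimensional ℂ M] (Y : TwistedModule 𝒱 g p ξ M) (hp : 0 < p) (v : V)
    (e : ℚ) : (Y.series hp v).coeff e = Y.mode v (-e - 1) := rfl

theorem mode_eq_series_coeff [FiniteDimensional ℂ M] (Y : TwistedModule 𝒱 g p ξ M) (hp : 0 < p)
    (v : V) (i : ℚ) : Y.mode v i = (Y.series hp v).coeff (-i - 1) := by
  rw [series_coeff, show -(-i - 1) - 1 = i by ring]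

end Series

section Polynomials

variable {g : ℂ[X] ≃ₐ[ℂ] ℂ[X]} {ξ : ℂ} {p : ℕ} {D : Derivation ℂ ℂ[X] ℂ[X]} {M : Type*} [AddCommGroup M] [Module ℂ M]

/-- The twisted Borcherds identity at `l = 0` says that all modes commute, because the vertex algebra
has no nonnegative modes. -/
theorem mode_commute
    (Y : TwistedModule D.vertexAlgebra g.toLinearEquiv p ξ M)
    {r s : ℕ} (hr : r < p) (hs : s < p) {u v : ℂ[X]}
    (hu : u ∈ VertexAlgebra.eigenpart g.toLinearEquiv ξ r)
    (hv : v ∈ VertexAlgebra.eigenpart g.toLinearEquiv ξ s) (m n : ℚ) :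
    Commute (Y.mode u m) (Y.mode v n) := by
  by_cases hm : ∃ k : ℤ, m = r / p + k
  swap
  · rw [Y.support_eigenpart r hr u hu m fun k hk => hm ⟨k, hk⟩]
    exact Commute.zero_left _
  by_cases hn : ∃ k : ℤ, n = s / p + k
  swap
  · rw [Y.support_eigenpart s hs v hv n fun k hk => hn ⟨k, hk⟩]
    exact Commute.zero_right _
  ext w
  have h := Y.borcherds r hr s hs u hu v hv m n hm hn 0 w
  rw [finsum_eq_single (a := 0), finsum_eq_single (a := 0)] at h
  · have h0 : D.vertexAlgebra.mode u (0 + (0 : ℕ)) v = 0 := by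
      rw [Derivation.vertexAlgebra_mode, Derivation.vertexMode_nonneg _ _ (by simp)]
      simp
    rw [h0] at h
    simp only [map_zero, Pi.zero_apply, LinearMap.zero_apply, smul_zero, Ring.choose_zero_right,
      Int.cast_one, pow_zero, mul_one, one_smul, zero_add, zpow_one, neg_smul, Int.cast_zero,
      Nat.cast_zero, sub_zero, add_zero] at h
    exact (add_neg_eq_zero.1 h.symm)
  · intro i hi
    rw [Ring.choose_zero_pos ℤ (Nat.pos_of_ne_zero hi)]
    simp
  · intro i _
    have h0 : D.vertexAlgebra.mode u (0 + (i : ℕ)) v = 0 := by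
      rw [Derivation.vertexAlgebra_mode, Derivation.vertexMode_nonneg _ _ (by simp)]
      simp
    rw [h0]
    simp

variable (Y : TwistedModule D.vertexAlgebra g.toLinearEquiv p ξ M)

/-- Twisted Borcherds identity at `v = 1`. It only sees the modes of `D^k u` whose indices lie in
the coset attached to `u`: the algebra automorphism `g` need not commute with `D`. -/
theorem mode_derivation_pow {r : ℕ} (hr : r < p) {u : ℂ[X]}
    (hu : u ∈ VertexAlgebra.eigenpart g.toLinearEquiv ξ r) (k : ℕ) (m : ℚ)
    (hm : ∃ j : ℤ, m = r / p + j) :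
    Y.mode (((D : ℂ[X] →ₗ[ℂ] ℂ[X]) ^ k) u) m =
      ((k.factorial * (-1) ^ k * Ring.choose m k : ℚ) : ℂ) • Y.mode u (m - k) := by
  induction k using Nat.strong_induction_on generalizing m with
  | _ k ih =>
  rcases Nat.eq_zero_or_pos k with rfl | hk
  · simp
  have hp0 : 0 < p := by omega
  have h1 : (1 : ℂ[X]) ∈ VertexAlgebra.eigenpart g.toLinearEquiv ξ 0 := by
    simp [VertexAlgebra.eigenpart]
  have hv : ∀ i : ℚ, Y.mode 1 i = if i = -1 then 1 else 0 := Y.vacuum_mode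
  ext w
  have h := Y.borcherds r hr 0 hp0 u hu 1 h1 m 0 hm ⟨0, by simp⟩ (-((k : ℤ) + 1)) w
  have h2 : (∑ᶠ i : ℕ, (((Ring.choose (-((k : ℤ) + 1)) i : ℤ) : ℂ) * (-1) ^ i) •
      (Y.mode u (((-((k : ℤ) + 1) : ℤ) : ℚ) + m - i) (Y.mode 1 (0 + (i : ℚ)) w) +
        ((-1 : ℂ) ^ (-((k : ℤ) + 1) + 1)) •
          Y.mode 1 (((-((k : ℤ) + 1) : ℤ) : ℚ) + 0 - i) (Y.mode u (m + i) w))) = 0 := by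
    refine (finsum_congr fun i => ?_).trans finsum_zero
    have hi : (0 : ℚ) ≤ i := i.cast_nonneg
    have hk' : (0 : ℚ) < k := by exact_mod_cast hk
    rw [hv, hv, if_neg (by linarith), if_neg (by push_cast; linarith)]
    simp
  rw [h2, finsum_eq_sum_of_support_subset (s := Finset.range (k + 1))] at h
  · have hterm : ∀ i ∈ Finset.range k, ((Ring.choose m (i + 1) : ℚ) : ℂ) •
        Y.mode (D.vertexAlgebra.mode u (-((k : ℤ) + 1) + (i + 1 : ℕ)) 1) (m + 0 - (i + 1 : ℕ)) w =
        (((-1) ^ (k - (i + 1)) * k.choose (i + 1) * Ring.choose m k : ℚ) : ℂ) •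
          Y.mode u (m - k) w := by
      intro i hi
      obtain ⟨q, hq⟩ : ∃ q, k = i + 1 + q :=
        ⟨k - (i + 1), by have := Finset.mem_range.1 hi; omega⟩
      have hneg : -((k : ℤ) + 1) + (i + 1 : ℕ) = Int.negSucc q := by
        rw [Int.negSucc_eq, hq]; push_cast; ring
      have hmode : D.vertexAlgebra.mode u (-((k : ℤ) + 1) + (i + 1 : ℕ)) 1 =
          ((q.factorial : ℂ)⁻¹) • (((D : ℂ[X] →ₗ[ℂ] ℂ[X]) ^ q) u) := by
        rw [hneg]
        have := D.vertexMode_negSucc q u 1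
        rw [mul_one] at this
        exact this
      obtain ⟨j, hj⟩ := hm
      rw [hmode, map_smul, Pi.smul_apply, add_zero,
        ih q (by omega) (m - (i + 1 : ℕ)) ⟨j - (i + 1), by rw [hj]; push_cast; ring⟩]
      have hch := Ring.choose_smul_choose m (n := k) (k := i + 1) (by omega)
      rw [show k - (i + 1) = q by omega, nsmul_eq_mul] at hch
      rw [show k - (i + 1) = q by omega, mul_assoc ((-1 : ℚ) ^ q), hch, LinearMap.smul_apply,
        LinearMap.smul_apply, smul_smul, smul_smul,
        show m - (i + 1 : ℕ) - q = m - k by rw [hq]; push_cast; ring]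
      have hq0 : (q.factorial : ℂ) ≠ 0 := by exact_mod_cast q.factorial_ne_zero
      congr 1
      push_cast
      field_simp
    rw [Finset.sum_range_succ', Finset.sum_congr rfl hterm, ← Finset.sum_smul, ← Rat.cast_sum] at h
    have hmode : D.vertexAlgebra.mode u (-((k : ℤ) + 1) + (0 : ℕ)) 1 =
        ((k.factorial : ℂ)⁻¹) • (((D : ℂ[X] →ₗ[ℂ] ℂ[X]) ^ k) u) := by
      have h3 := D.vertexMode_negSucc k u 1
      rw [mul_one, Int.negSucc_eq] at h3
      simpa [Derivation.vertexAlgebra_mode] using h3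
    have halt : ∑ i ∈ Finset.range k, ((-1) ^ (k - (i + 1)) * k.choose (i + 1) * Ring.choose m k : ℚ)
        = -((-1) ^ k * Ring.choose m k) := by
      have h3 := add_pow (1 : ℚ) (-1) k
      rw [add_neg_cancel, zero_pow hk.ne', Finset.sum_range_succ'] at h3
      simp only [one_pow, one_mul, tsub_zero, Nat.choose_zero_right, Nat.cast_one, mul_one] at h3
      rw [← Finset.sum_mul]
      linear_combination -(Ring.choose m k) * h3
    have hk0 : (k.factorial : ℂ) ≠ 0 := by exact_mod_cast k.factorial_ne_zero
    rw [hmode, halt, map_smul, Pi.smul_apply, Ring.choose_zero_right] at h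
    simp only [Rat.cast_one, one_smul, Nat.cast_zero, sub_zero, add_zero, LinearMap.smul_apply] at h
    rw [LinearMap.smul_apply]
    have h4 := eq_neg_of_add_eq_zero_right h
    rw [inv_smul_eq_iff₀ hk0, ← neg_smul, smul_smul] at h4
    rw [h4]
    congr 1
    push_cast
    ring
  · intro i hi
    by_contra h3
    have hik : k + 1 ≤ i := by simpa using h3
    refine hi ?_
    have h0 : D.vertexAlgebra.mode u (-((k : ℤ) + 1) + i) 1 = 0 := by
      rw [Derivation.vertexAlgebra_mode, Derivation.vertexMode_nonneg _ _ (by omega)]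
      simp
    simp only
    rw [h0]
    simp

variable [FiniteDimensional ℂ M]

theorem series_supportedIn (hp : 0 < p) {r : ℕ} (hr : r < p) {u : ℂ[X]}
    (hu : u ∈ VertexAlgebra.eigenpart g.toLinearEquiv ξ r) :
    (Y.series hp u).SupportedIn (-(r / p)) := by
  intro e he
  by_contra h
  refine he ?_
  rw [series_coeff, Y.support_eigenpart r hr u hu]
  rintro k hk
  exact h ⟨-k - 1, by push_cast; linarith⟩

theorem X_mem_eigenpart (hξ : g X = Polynomial.C ξ * X) (hprim : IsPrimitiveRoot ξ p) (hp : 1 < p) :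
    (X : ℂ[X]) ∈ VertexAlgebra.eigenpart g.toLinearEquiv ξ 1 := by
  have h := X_pow_mem_eigenpart hξ hprim 1
  rwa [pow_one, Nat.mod_eq_of_lt hp] at h

theorem series_X_supportedIn (hξ : g X = Polynomial.C ξ * X) (hprim : IsPrimitiveRoot ξ p)
    (hp : 1 < p) (hp0 : 0 < p) : (Y.series hp0 X).SupportedIn (-1 / p) :=
  (Y.series_supportedIn hp0 hp (X_mem_eigenpart hξ hprim hp)).add_int
    ⟨0, by push_cast; ring⟩

theorem series_X_coeff_commute (hξ : g X = Polynomial.C ξ * X) (hprim : IsPrimitiveRoot ξ p)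
    (hp : 1 < p) (hp0 : 0 < p) (d e : ℚ) :
    Commute ((Y.series hp0 X).coeff d) ((Y.series hp0 X).coeff e) :=
  Y.mode_commute hp hp (X_mem_eigenpart hξ hprim hp) (X_mem_eigenpart hξ hprim hp) _ _

/-- The twisted Borcherds identity at `l = -1`: the modes of a product are those of the product of
the series. -/
theorem mode_mul {r s : ℕ} (hr : r < p) (hs : s < p) (hp0 : 0 < p) {u v : ℂ[X]}
    (hu : u ∈ VertexAlgebra.eigenpart g.toLinearEquiv ξ r)
    (hv : v ∈ VertexAlgebra.eigenpart g.toLinearEquiv ξ s) (m n : ℚ)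
    (hm : ∃ k : ℤ, m = r / p + k) (hn : ∃ k : ℤ, n = s / p + k) :
    Y.mode (u * v) (m + n) = (Y.series hp0 u * Y.series hp0 v).coeff (-(m + n) - 1) := by
  ext w
  have h := Y.borcherds r hr s hs u hu v hv m n hm hn (-1) w
  set G : ℤ → M := fun j => Y.mode u (-1 + m - j) (Y.mode v (n + j) w) with hG
  have hGF : ∀ j : ℤ, Y.mode u (-1 + m - j) * Y.mode v (n + j) =
      (Y.series hp0 u).coeff (-m + j) * (Y.series hp0 v).coeff (-(m + n) - 1 - (-m + j)) := by
    intro j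
    rw [series_coeff, series_coeff, show -(-m + (j : ℚ)) - 1 = -1 + m - j by ring,
      show -(-(m + n) - 1 - (-m + (j : ℚ))) - 1 = n + j by ring]
  have hF : (Function.support fun j : ℤ => (Y.series hp0 u).coeff (-m + j) *
      (Y.series hp0 v).coeff (-(m + n) - 1 - (-m + j))).Finite := by
    refine (hasFiniteSupport_coeff_mul (Y.series hp0 u) (Y.series hp0 v) (-m) (-n - 1)).subset
      fun j hj => ?_
    have h1 : -(m + n) - 1 - (-m + j) = -n - 1 - j := by ring
    simpa only [Function.mem_support, Set.mem_ofPred_eq, h1] using hj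
  have hGfin : G.support.Finite := hF.subset fun j hj h0 => hj <| by
    simp only at h0
    simp only [hG]
    rw [← Module.End.mul_apply, hGF, h0, LinearMap.zero_apply]
  have hR : ∀ i : ℕ, (Y.mode u (((-1 : ℤ) : ℚ) + m - i) (Y.mode v (n + i) w) +
      ((-1 : ℂ) ^ ((-1 : ℤ) + 1)) • Y.mode v (((-1 : ℤ) : ℚ) + n - i) (Y.mode u (m + i) w)) =
      G i + ((-1 : ℂ) ^ (-(((0 : ℕ) : ℤ) + 1) + 1)) • G (-(((0 : ℕ) : ℤ) + 1) - i) := by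
    intro i
    have hc := DFunLike.congr_fun (Y.mode_commute hr hs hu hv (m + i) (-1 + n - i)).eq w
    simp only [Module.End.mul_apply] at hc
    have e1 : (-1 : ℂ) ^ ((-1 : ℤ) + 1) = 1 := by norm_num
    have e2 : (-1 : ℂ) ^ (-(((0 : ℕ) : ℤ) + 1) + 1) = 1 := by norm_num
    rw [e1, e2, one_smul, one_smul]
    simp only [hG]
    push_cast
    rw [← hc, show (-1 + m - (-1 - i) : ℚ) = m + i by ring,
      show (n + (-1 - i) : ℚ) = -1 + n - i by ring]
  simp only [hR] at h
  rw [show (-1 : ℤ) = -(((0 : ℕ) : ℤ) + 1) by norm_num] at h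
  have hch := finsum_choose_neg G hGfin 0
  rw [hch, finsum_eq_single (a := 0)] at h
  · have h0 : D.vertexAlgebra.mode u
        (-(((0 : ℕ) : ℤ) + 1) + (0 : ℕ)) v = u * v := by
      have := Derivation.vertexMode_negSucc D 0 u v
      simpa [Derivation.vertexAlgebra_mode] using this
    rw [h0] at h
    simp only [Ring.choose_zero_right, Rat.cast_one, one_smul, Nat.cast_zero, sub_zero,
      Int.cast_one] at h
    rw [h, coeff_mul_eq_finsum (α := -m)]
    · let ev : Module.End ℂ M →+ M := (LinearMap.applyₗ (R := ℂ) w).toAddMonoidHom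
      change _ = ev _
      rw [ev.map_finsum hF]
      refine finsum_congr fun j => ?_
      rw [← hGF]
      rfl
    · refine (Y.series_supportedIn hp0 hr hu).add_int ?_
      obtain ⟨k, hk⟩ := hm
      exact ⟨k, by linarith⟩
  · intro i hi
    have h0 : D.vertexAlgebra.mode u
        (-(((0 : ℕ) : ℤ) + 1) + (i : ℕ)) v = 0 := by
      rw [Derivation.vertexAlgebra_mode, Derivation.vertexMode_nonneg _ _ (by push_cast; omega)]
      simp
    rw [h0]
    simp

theorem series_one (hp0 : 0 < p) : Y.series hp0 1 = 1 := by
  ext1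
  funext e
  rw [series_coeff, HahnSeries.coeff_one]
  have h := Y.vacuum_mode (-e - 1)
  change Y.mode 1 (-e - 1) = _ at h
  rw [h]
  by_cases he : e = 0
  · rw [if_pos he, if_pos (by linarith)]
  · rw [if_neg he, if_neg fun h => he (by linarith)]

theorem series_X_pow_succ (hξ : g X = Polynomial.C ξ * X) (hprim : IsPrimitiveRoot ξ p)
    (hp : 1 < p) (hp0 : 0 < p) (k : ℕ) :
    Y.series hp0 (X ^ (k + 1)) = Y.series hp0 (X ^ k) * Y.series hp0 X := by
  have hp' : (p : ℚ) ≠ 0 := by exact_mod_cast hp0.ne'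
  have hX := X_mem_eigenpart hξ hprim hp
  have hk := X_pow_mem_eigenpart hξ hprim k
  have hk1 := X_pow_mem_eigenpart hξ hprim (k + 1)
  have hdiv : ∀ k : ℕ, ∃ j : ℤ, -(((k % p : ℕ) : ℚ) / p) = k * (-1 / p) + j := fun k => by
    refine ⟨(k / p : ℕ), ?_⟩
    have h : ((k % p : ℕ) : ℚ) + p * (k / p : ℕ) = k := by exact_mod_cast Nat.mod_add_div k p
    rw [Int.cast_natCast]
    field_simp
    linarith
  have h1 := (Y.series_supportedIn hp0 (Nat.mod_lt k hp0) hk).add_int (hdiv k)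
  have h2 := (Y.series_supportedIn hp0 (Nat.mod_lt (k + 1) hp0) hk1).add_int (hdiv (k + 1))
  have h3 := h1.mul (Y.series_X_supportedIn hξ hprim hp hp0)
  ext1
  funext e
  by_cases he : ∃ z : ℤ, e = (k + 1 : ℕ) * (-1 / p) + z
  · obtain ⟨z, hz⟩ := he
    obtain ⟨j, hj⟩ := hdiv k
    have h := Y.mode_mul (Nat.mod_lt k hp0) hp hp0 hk hX (((k % p : ℕ) : ℚ) / p)
      (-e - 1 - ((k % p : ℕ) : ℚ) / p) ⟨0, by simp⟩
      ⟨j - z - 1, by push_cast at hz ⊢; rw [hz]; linear_combination hj⟩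
    rw [← pow_succ] at h
    rw [series_coeff]
    convert h using 2
    · ring
    · ring
  · have h4 : (Y.series hp0 (X ^ (k + 1))).coeff e = 0 := by
      by_contra h
      exact he (h2 e h)
    have h5 : (Y.series hp0 (X ^ k) * Y.series hp0 X).coeff e = 0 := by
      by_contra h
      obtain ⟨z, hz⟩ := h3 e h
      exact he ⟨z, by rw [hz]; push_cast; ring⟩
    rw [h4, h5]

/-- The field `Y(u, x)` is the polynomial `u` evaluated at `Y(t, x)`. -/
theorem series_eq_aeval (hξ : g X = Polynomial.C ξ * X) (hprim : IsPrimitiveRoot ξ p)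
    (hp : 1 < p) (hp0 : 0 < p) (u : ℂ[X]) :
    Y.series hp0 u = aeval (Y.series hp0 X) u := by
  have hpow : ∀ k : ℕ, Y.series hp0 (X ^ k) = Y.series hp0 X ^ k := by
    intro k
    induction k with
    | zero => rw [pow_zero, pow_zero, series_one]
    | succ k ih => rw [Y.series_X_pow_succ hξ hprim hp hp0, ih, pow_succ]
  induction u using Polynomial.induction_on' with
  | add u v hu hv =>
    rw [map_add, ← hu, ← hv]
    ext1
    funext e
    simp only [HahnSeries.coeff_add, series_coeff, map_add, Pi.add_apply]
  | monomial k a =>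
    rw [← C_mul_X_pow_eq_monomial, ← smul_eq_C_mul, map_smul, map_pow, aeval_X, ← hpow]
    ext1
    funext e
    rw [coeff_smul_complex]
    simp only [series_coeff, map_smul, Pi.smul_apply]

/-- `Y(D^k u, x)` agrees with the `k`-th derivative of `Y(u, x)` on the exponents attached to the
eigenspace of `u`. -/
theorem series_derivation_pow_coeff (hp0 : 0 < p) {r : ℕ} (hr : r < p) {u : ℂ[X]}
    (hu : u ∈ VertexAlgebra.eigenpart g.toLinearEquiv ξ r) (k : ℕ) (e : ℚ)
    (he : ∃ j : ℤ, e = -(r / p) + j) :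
    (Y.series hp0 (((D : ℂ[X] →ₗ[ℂ] ℂ[X]) ^ k) u)).coeff e =
      ((k.factorial * Ring.choose (e + k) k : ℚ) : ℂ) • (Y.series hp0 u).coeff (e + k) := by
  obtain ⟨j, hj⟩ := he
  rw [series_coeff, series_coeff, Y.mode_derivation_pow hr hu k (-e - 1)
    ⟨-j - 1, by rw [hj]; push_cast; ring⟩, show -e - 1 - k = -(e + k) - 1 by ring]
  congr 2
  rw [show -e - 1 = -(e + 1) by ring, Ring.choose_neg, show e + 1 + k - 1 = e + k by ring,
    Units.smul_def, Int.coe_negOnePow_natCast, zsmul_eq_mul]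
  push_cast
  rw [mul_assoc, ← mul_assoc ((-1) ^ k), ← mul_pow]
  simp

end Polynomials

end TwistedModule

/-! ### Leading terms of scalar solutions -/

namespace HahnSeries

theorem coeff_pow_of_lt {K : Type*} [Field K] (s : HahnSeries ℚ K) (i : ℕ) {e : ℚ}
    (he : e < i * s.order) : (s ^ i).coeff e = 0 :=
  coeff_eq_zero_of_lt_order (by rw [order_pow, nsmul_eq_mul]; exact he)

theorem coeff_pow_order_ne_zero {K : Type*} [Field K] {s : HahnSeries ℚ K} (hs : s ≠ 0) (i : ℕ) :
    (s ^ i).coeff (i * s.order) ≠ 0 := by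
  have h := (coeff_order_eq_zero (x := s ^ i)).not.2 (pow_ne_zero i hs)
  rwa [order_pow, nsmul_eq_mul] at h

/-- Comparison of leading exponents: a nonzero scalar solution of `s' = f(s)` has a pole of order
`1/p`, which fixes the degree of `f`. -/
theorem order_and_form_of_euler_eq {p : ℕ} (hp : 1 < p) {s : HahnSeries ℚ ℂ} (hs : s ≠ 0)
    (hsupp : s.SupportedIn (-1 / p)) {f : ℂ[X]} (hf : ∀ k, f.coeff k ≠ 0 → k ≡ 1 [MOD p])
    (hode : euler s = single 1 1 * aeval s f) :
    s.order = -1 / p ∧ f.coeff (p + 1) ≠ 0 ∧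
      f = Polynomial.C (f.coeff 1) * X + Polynomial.C (f.coeff (p + 1)) * X ^ (p + 1) := by
  have hp0 : (0 : ℚ) < p := by exact_mod_cast (by omega : 0 < p)
  set e := s.order with he
  have ha : s.coeff e ≠ 0 := (coeff_order_eq_zero (x := s)).not.2 hs
  obtain ⟨z, hz⟩ := hsupp e ha
  have hez : e * p = -1 + z * p := by rw [hz]; field_simp
  have he0 : e ≠ 0 := by
    intro h0
    rw [h0, zero_mul] at hez
    have h1 : (p : ℤ) * z = 1 := by
      have : (p : ℚ) * z = 1 := by linarith
      exact_mod_cast this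
    have h2 : (p : ℤ) ∣ 1 := ⟨z, h1.symm⟩
    have := Int.eq_one_of_dvd_one (by omega) h2
    omega
  have hcoeff : ∀ q : ℚ, (q : ℂ) • s.coeff q = (aeval s f).coeff (q - 1) := by
    intro q
    have h := congrArg (fun t : HahnSeries ℚ ℂ => t.coeff q) hode
    simpa only [euler_coeff, coeff_single_mul, one_mul] using h
  have hlead : (aeval s f).coeff (e - 1) ≠ 0 := by
    rw [← hcoeff, smul_eq_mul]
    exact mul_ne_zero (by exact_mod_cast he0) ha
  rw [coeff_aeval] at hlead
  obtain ⟨i, hi, hi0⟩ := Finset.exists_ne_zero_of_sum_ne_zero hlead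
  have hfi : f.coeff i ≠ 0 := fun h0 => hi0 (by rw [h0, zero_smul])
  have hi1 : 1 ≤ i := by
    rcases Nat.eq_zero_or_pos i with rfl | h
    · have := hf 0 hfi
      rw [Nat.ModEq, Nat.zero_mod, Nat.mod_eq_of_lt hp] at this
      omega
    · exact h
  have hie : i * e ≤ e - 1 := by
    by_contra h
    exact hi0 (by rw [coeff_pow_of_lt s i (not_le.1 h), smul_zero])
  have hneg : e < 0 := by
    by_contra h
    have h1 : (1 : ℚ) ≤ i := by exact_mod_cast hi1
    nlinarith
  set d := f.natDegree with hd
  have hf0 : f ≠ 0 := fun h0 => hfi (by rw [h0, Polynomial.coeff_zero])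
  have hfd : f.coeff d ≠ 0 := by
    rw [hd, ← Polynomial.leadingCoeff]; exact Polynomial.leadingCoeff_ne_zero.2 hf0
  have hid : i ≤ d := Nat.lt_succ_iff.1 (Finset.mem_range.1 hi)
  have hde1 : d * e ≤ e - 1 := by
    have : (i : ℚ) ≤ d := by exact_mod_cast hid
    nlinarith
  have hde2 : e ≤ d * e + 1 := by
    have h1 : (aeval s f).coeff (d * e) ≠ 0 := by
      rw [coeff_aeval, Finset.sum_eq_single d]
      · exact smul_ne_zero hfd (coeff_pow_order_ne_zero hs d)
      · intro j hj hjd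
        have hjd' : (j : ℚ) < d := by
          exact_mod_cast lt_of_le_of_ne (Nat.lt_succ_iff.1 (Finset.mem_range.1 hj)) hjd
        rw [coeff_pow_of_lt s j (by nlinarith), smul_zero]
      · intro h
        exact absurd (Finset.mem_range.2 (Nat.lt_succ_self d)) h
    have h2 : s.coeff (d * e + 1) ≠ 0 := by
      intro h0
      have h3 := hcoeff (d * e + 1)
      rw [h0, smul_zero, add_sub_cancel_right] at h3
      exact h1 h3.symm
    exact order_le_of_coeff_ne_zero h2
  have hd1 := hf d hfd
  have hdi : 1 ≤ d := hi1.trans hid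
  obtain ⟨m, hm⟩ := (Nat.modEq_iff_dvd' hdi).1 hd1.symm
  have hdm : d = p * m + 1 := by omega
  -- `(d - 1) e = -1` with `d - 1 = p m` and `p e = p z - 1` leaves only `m = 1` and `z = 0`.
  have hmz : (m : ℤ) * (1 - z * p) = 1 := by
    have h1 : (d : ℚ) * e = e - 1 := le_antisymm hde1 (by linarith)
    have h2 : (m : ℚ) * (1 - z * p) = 1 := by
      rw [hdm] at h1
      push_cast at h1
      linear_combination -h1 + m * hez
    exact_mod_cast h2
  have hm1 : (m : ℤ) = 1 := Int.eq_one_of_dvd_one (by positivity) ⟨_, hmz.symm⟩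
  have hz0 : z = 0 := by
    rw [hm1] at hmz
    have h1 : z * p = 0 := by linarith
    rcases mul_eq_zero.1 h1 with h | h
    · exact h
    · omega
  have hm1' : m = 1 := by exact_mod_cast hm1
  have hdp : d = p + 1 := by rw [hdm, hm1', mul_one]
  refine ⟨by rw [hz, hz0]; simp, hdp ▸ hfd, ?_⟩
  ext k
  simp only [Polynomial.coeff_add, coeff_C_mul, Polynomial.coeff_X, coeff_X_pow]
  by_cases hk : f.coeff k = 0
  · have h1 : k ≠ p + 1 := fun h => hfd (by rw [hdp, ← h, hk])
    rw [hk, if_neg h1]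
    split_ifs with h2
    · rw [h2, hk]; simp
    · simp
  · have h1 := hf k hk
    have h2 : k ≤ p + 1 := hdp ▸ le_natDegree_of_ne_zero hk
    have h3 : 1 ≤ k := by
      rcases Nat.eq_zero_or_pos k with rfl | h
      · rw [Nat.ModEq, Nat.zero_mod, Nat.mod_eq_of_lt hp] at h1
        omega
      · exact h
    obtain ⟨j, hj⟩ := (Nat.modEq_iff_dvd' h3).1 h1.symm
    have h4 : j = 0 ∨ j = 1 := by
      have : p * j ≤ p * 1 := by omega
      have := Nat.le_of_mul_le_mul_left this (by omega)
      omega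
    rcases h4 with rfl | rfl
    · have : k = 1 := by omega
      subst this
      simp only [mul_one, if_true]
      rw [if_neg (by omega)]; simp
    · have : k = p + 1 := by omega
      subst this
      rw [if_neg (by omega)]; simp

/-- The powers of a series of order `-1/p` are linearly independent, residue class by residue class
of the exponents. -/
theorem coeff_eq_zero_of_aeval_class {p : ℕ} (hp0 : 0 < p) {s : HahnSeries ℚ ℂ} (hs : s ≠ 0)
    (hsupp : s.SupportedIn (-1 / p)) (hord : s.order = -1 / p) {w : ℂ[X]} {r : ℕ}
    (hw : ∀ e : ℚ, (∃ j : ℤ, e = -(r / p) + j) → (aeval s w).coeff e = 0) {j : ℕ}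
    (hj : j ≡ r [MOD p]) : w.coeff j = 0 := by
  have hp' : (0 : ℚ) < p := by exact_mod_cast hp0
  by_contra hwj
  set S := w.support.filter fun i => i ≡ r [MOD p] with hS
  have hne : S.Nonempty := ⟨j, by simp [hS, hwj, hj]⟩
  set d := S.max' hne with hd
  have hdS : d ∈ S := S.max'_mem hne
  obtain ⟨hdw, hdr⟩ := Finset.mem_filter.1 hdS
  have hdw' : w.coeff d ≠ 0 := mem_support_iff.1 hdw
  have hdz : ∃ z : ℤ, (d : ℚ) * s.order = -(r / p) + z := by
    obtain ⟨z, hz⟩ := (Nat.modEq_iff_dvd.1 hdr)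
    refine ⟨z, ?_⟩
    have hz' : (r : ℚ) - d = p * z := by exact_mod_cast hz
    rw [hord]
    field_simp
    linarith
  have h := hw _ hdz
  rw [coeff_aeval, Finset.sum_eq_single d] at h
  · exact smul_ne_zero hdw' (coeff_pow_order_ne_zero hs d) h
  · intro i _ hid
    by_cases hwi : w.coeff i = 0
    · rw [hwi, zero_smul]
    rcases lt_or_gt_of_ne hid with hlt | hgt
    · have : (i : ℚ) < d := by exact_mod_cast hlt
      have hneg : s.order < 0 := by rw [hord]; exact div_neg_of_neg_of_pos (by norm_num) hp'
      rw [coeff_pow_of_lt s i (by nlinarith), smul_zero]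
    · by_contra h0
      obtain ⟨z, hz⟩ := (hsupp.pow i) _ fun h1 => h0 (by rw [h1, smul_zero])
      have hir : i ≡ r [MOD p] := by
        refine Nat.ModEq.trans (Nat.modEq_iff_dvd.2 ⟨-z, ?_⟩) hdr
        rw [hord] at hz
        field_simp at hz
        have : (d : ℚ) - i = p * -z := by linarith
        exact_mod_cast this
      have : i ∈ S := Finset.mem_filter.2 ⟨mem_support_iff.2 hwi, hir⟩
      exact absurd (S.le_max' i this) (not_le.2 hgt)
  · intro hd'
    exact absurd (Finset.mem_range.2 (Nat.lt_succ_iff.2 (le_natDegree_of_ne_zero hdw'))) hd'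

end HahnSeries

/-! ### Flows and exponent classes modulo `p` -/

namespace Derivation

variable {A : Type*} [CommRing A] [Algebra ℂ A]

/-- The formal flow `exp(z D) u` of a derivation `D`, as a power series in `z`. -/
noncomputable def flow (D : Derivation ℂ A A) (u : A) : PowerSeries A :=
  PowerSeries.mk fun k => ((Nat.factorial k : ℂ)⁻¹) • (((D : A →ₗ[ℂ] A) ^ k) u)

theorem coeff_flow (D : Derivation ℂ A A) (u : A) (k : ℕ) :
    PowerSeries.coeff k (D.flow u) = ((Nat.factorial k : ℂ)⁻¹) • (((D : A →ₗ[ℂ] A) ^ k) u) :=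
  PowerSeries.coeff_mk _ _

theorem coeff_derivative_flow (D : Derivation ℂ A A) (u : A) (k : ℕ) :
    PowerSeries.coeff k (PowerSeries.derivative A (D.flow u)) =
      D (PowerSeries.coeff k (D.flow u)) := by
  rw [PowerSeries.coeff_derivative, coeff_flow, coeff_flow, pow_succ', Module.End.mul_apply,
    D.map_smul, Derivation.coeFn_coe, Nat.factorial_succ]
  have h : ((k : A) + 1) = algebraMap ℂ A (k + 1) := by simp
  have h3 : (k : ℂ) + 1 ≠ 0 := by exact_mod_cast Nat.succ_ne_zero k
  rw [h, mul_comm, ← Algebra.smul_def, smul_smul]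
  congr 1
  push_cast
  field_simp

/-- The equation `G' = D G` has at most one power series solution with given constant term. -/
theorem eq_of_coeff_derivative (D : Derivation ℂ A A) {G H : PowerSeries A}
    (hG : ∀ k, PowerSeries.coeff k (PowerSeries.derivative A G) = D (PowerSeries.coeff k G))
    (hH : ∀ k, PowerSeries.coeff k (PowerSeries.derivative A H) = D (PowerSeries.coeff k H))
    (h0 : PowerSeries.coeff 0 G = PowerSeries.coeff 0 H) : G = H := by
  ext k
  induction k with
  | zero => exact h0
  | succ k ih =>
    have h1 := hG k
    have h2 := hH k
    rw [PowerSeries.coeff_derivative] at h1 h2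
    have h3 : (k : ℂ) + 1 ≠ 0 := by exact_mod_cast Nat.succ_ne_zero k
    have h4 : ((k : A) + 1) = algebraMap ℂ A (k + 1) := by simp
    rw [← ih, ← h1, h4, mul_comm, mul_comm _ (algebraMap ℂ A _), ← Algebra.smul_def,
      ← Algebra.smul_def] at h2
    have h5 := congrArg (fun a => ((k : ℂ) + 1)⁻¹ • a) h2
    simp only [inv_smul_smul₀ h3] at h5
    exact h5.symm

theorem flow_mul (D : Derivation ℂ A A) (u v : A) : D.flow (u * v) = D.flow u * D.flow v := by
  refine D.eq_of_coeff_derivative (D.coeff_derivative_flow _) (fun k => ?_) (by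
    rw [PowerSeries.coeff_mul, Finset.Nat.antidiagonal_zero, Finset.sum_singleton, coeff_flow,
      coeff_flow, coeff_flow]
    simp)
  rw [Derivation.leibniz, map_add, smul_eq_mul, smul_eq_mul, mul_comm (D.flow v),
    PowerSeries.coeff_mul, PowerSeries.coeff_mul, PowerSeries.coeff_mul, map_sum,
    ← Finset.sum_add_distrib]
  refine Finset.sum_congr rfl fun ij _ => ?_
  rw [coeff_derivative_flow, coeff_derivative_flow, D.leibniz, smul_eq_mul, smul_eq_mul]
  ring

theorem flow_one (D : Derivation ℂ A A) : D.flow (1 : A) = 1 := by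
  refine D.eq_of_coeff_derivative (D.coeff_derivative_flow _) (fun k => ?_) (by simp [coeff_flow])
  rw [Derivation.map_one_eq_zero, map_zero, PowerSeries.coeff_one]
  split_ifs <;> simp

theorem flow_pow (D : Derivation ℂ A A) (u : A) (n : ℕ) : D.flow (u ^ n) = D.flow u ^ n := by
  induction n with
  | zero => rw [pow_zero, pow_zero, flow_one]
  | succ n ih => rw [pow_succ, pow_succ, flow_mul, ih]

end Derivation

namespace Polynomial

/-- All exponents of the polynomial are congruent to `m` modulo `p`. -/
def InClass (p : ℕ) (q : ℂ[X]) (m : ℕ) : Prop := ∀ k, q.coeff k ≠ 0 → k ≡ m [MOD p]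

theorem InClass.smul {p : ℕ} {q : ℂ[X]} {m : ℕ} (hq : q.InClass p m) (c : ℂ) :
    (c • q).InClass p m := fun k hk => hq k fun h0 => hk (by rw [coeff_smul, h0, smul_zero])

theorem InClass.derivation {p : ℕ} {f q : ℂ[X]} {m : ℕ} (hf : f.InClass p 1) (hq : q.InClass p m) :
    ((f • derivative' : Derivation ℂ ℂ[X] ℂ[X]) q).InClass p m := by
  intro k hk
  rw [Derivation.smul_apply, smul_eq_mul, coeff_mul] at hk
  obtain ⟨⟨i, j⟩, hij, h0⟩ := Finset.exists_ne_zero_of_sum_ne_zero hk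
  rw [Finset.HasAntidiagonal.mem_antidiagonal] at hij
  have h1 := hf i (left_ne_zero_of_mul h0)
  have h2 : (derivative q).coeff j ≠ 0 := right_ne_zero_of_mul h0
  rw [coeff_derivative] at h2
  have h3 := hq _ (left_ne_zero_of_mul h2)
  simp only at hij
  rw [← hij, add_comm]
  exact (Nat.ModEq.add_left j h1).trans h3

theorem InClass.derivation_pow {p : ℕ} {f q : ℂ[X]} {m : ℕ} (hf : f.InClass p 1)
    (hq : q.InClass p m) (k : ℕ) :
    ((((f • derivative' : Derivation ℂ ℂ[X] ℂ[X]) : ℂ[X] →ₗ[ℂ] ℂ[X]) ^ k) q).InClass p m := by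
  induction k with
  | zero => simpa using hq
  | succ k ih =>
    rw [pow_succ', Module.End.mul_apply]
    exact InClass.derivation hf ih

theorem coeff_mul_eq_of_class {p : ℕ} {a b q : ℂ[X]} {m n J : ℕ} (hq : q.InClass p m)
    (hab : ∀ j, j ≡ n [MOD p] → a.coeff j = b.coeff j) (hJ : n + m ≡ J [MOD p]) :
    (a * q).coeff J = (b * q).coeff J := by
  rw [coeff_mul, coeff_mul]
  refine Finset.sum_congr rfl fun ij hij => ?_
  rw [Finset.HasAntidiagonal.mem_antidiagonal] at hij
  by_cases h0 : q.coeff ij.2 = 0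
  · rw [h0, mul_zero, mul_zero]
  · have h1 := hq _ h0
    rw [hab]
    refine Nat.ModEq.add_right_cancel h1 ?_
    rw [hij]
    exact hJ.symm

/-- If the class-preserving part of every power of `D = f d/dt` is the corresponding power of
`D₁ = f₁ d/dt`, then `D = D₁`. With `E = exp(z D) t` and `E₁ = exp(z D₁) t`, the binomial expansion
of `(E - E₁)^p` has the same terms with exponents divisible by `p` as that of `(E₁ - E₁)^p = 0`, while
its coefficient at `z^p` is `(f - f₁)^p`, whose leading exponent is divisible by `p`. -/
theorem eq_of_derivation_pow_class {p : ℕ} {f f₁ : ℂ[X]}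
    (hf₁ : f₁.InClass p 1)
    (h : ∀ n b j : ℕ, j ≡ n [MOD p] →
      ((((f • derivative' : Derivation ℂ ℂ[X] ℂ[X]) : ℂ[X] →ₗ[ℂ] ℂ[X]) ^ b) (X ^ n)).coeff j =
      ((((f₁ • derivative' : Derivation ℂ ℂ[X] ℂ[X]) : ℂ[X] →ₗ[ℂ] ℂ[X]) ^ b) (X ^ n)).coeff j)
    (hp : 0 < p) : f = f₁ := by
  set D : Derivation ℂ ℂ[X] ℂ[X] := f • derivative' with hD
  set D₁ : Derivation ℂ ℂ[X] ℂ[X] := f₁ • derivative' with hD₁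
  set E := D.flow X with hE
  set E₁ := D₁.flow X with hE₁
  have hDX : D X = f := by simp [hD]
  have hD₁X : D₁ X = f₁ := by simp [hD₁]
  have hsum : ∀ J : ℕ, J ≡ 0 [MOD p] → (PowerSeries.coeff p ((E - E₁) ^ p)).coeff J = 0 := by
    intro J hJ
    have hzero : (PowerSeries.coeff p ((E₁ + -E₁) ^ p)).coeff J = 0 := by
      rw [add_neg_cancel, zero_pow hp.ne', map_zero, Polynomial.coeff_zero]
    rw [← hzero, sub_eq_add_neg, add_pow, add_pow, map_sum, map_sum, finsetSum_coeff,
      finsetSum_coeff]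
    refine Finset.sum_congr rfl fun n hn => ?_
    have hnp : n ≤ p := Nat.lt_succ_iff.1 (Finset.mem_range.1 hn)
    have hQ : (-E₁) ^ (p - n) * ((p.choose n : ℕ) : PowerSeries ℂ[X]) =
        PowerSeries.C (C ((-1) ^ (p - n) * (p.choose n : ℂ))) * D₁.flow (X ^ (p - n)) := by
      rw [Derivation.flow_pow, ← hE₁, neg_pow]
      simp only [map_mul, map_pow, map_neg, map_one, map_natCast]
      ring
    rw [mul_assoc, mul_assoc, hQ, ← Derivation.flow_pow, ← Derivation.flow_pow,
      PowerSeries.coeff_mul, PowerSeries.coeff_mul, finsetSum_coeff, finsetSum_coeff]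
    refine Finset.sum_congr rfl fun ab _ => ?_
    refine coeff_mul_eq_of_class (p := p) (m := p - n) (n := n) ?_ (fun j hj => ?_) ?_
    · rw [PowerSeries.coeff_C_mul, Derivation.coeff_flow, ← smul_eq_C_mul]
      refine InClass.smul (InClass.smul (InClass.derivation_pow hf₁ ?_ _) _) _
      intro k hk
      rw [coeff_X_pow] at hk
      by_cases hkn : k = p - n
      · rw [hkn]
      · exact absurd (if_neg hkn) hk
    · rw [Derivation.coeff_flow, Derivation.coeff_flow, coeff_smul, coeff_smul, h n _ j hj]
    · rw [Nat.add_sub_cancel' hnp]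
      exact ((Nat.modEq_zero_iff_dvd.2 dvd_rfl)).trans hJ.symm
  have hlow : PowerSeries.coeff p ((E - E₁) ^ p) = (f - f₁) ^ p := by
    obtain ⟨η, hη⟩ : (PowerSeries.X : PowerSeries ℂ[X]) ∣ E - E₁ := by
      rw [PowerSeries.X_dvd_iff, ← PowerSeries.coeff_zero_eq_constantCoeff_apply, map_sub,
        hE, hE₁, Derivation.coeff_flow, Derivation.coeff_flow]
      simp
    have h1 : PowerSeries.coeff 1 (E - E₁) = f - f₁ := by
      rw [map_sub, hE, hE₁, Derivation.coeff_flow, Derivation.coeff_flow]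
      simp [hDX, hD₁X]
    have h2 := PowerSeries.coeff_succ_X_mul 0 η
    rw [← hη, zero_add, h1] at h2
    have h3 := PowerSeries.coeff_X_pow_mul (η ^ p) p 0
    rw [← mul_pow, ← hη, zero_add] at h3
    rw [h3, h2, PowerSeries.coeff_zero_eq_constantCoeff_apply, map_pow,
      PowerSeries.coeff_zero_eq_constantCoeff_apply]
  by_contra hne
  have h1 : f - f₁ ≠ 0 := sub_ne_zero.2 hne
  have h2 := hsum (p * (f - f₁).natDegree) (Nat.modEq_zero_iff_dvd.2 ⟨_, rfl⟩)
  rw [hlow, coeff_pow_mul_natDegree] at h2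
  exact pow_ne_zero _ (leadingCoeff_ne_zero.2 h1) h2

end Polynomial

/-! ### Nilpotent solutions and commutative models -/

namespace HahnSeries

section Nilpotent

variable {R : Type*} [CommRing R]

theorem coeff_mul_mem {I J : Ideal R} {a b : HahnSeries ℚ R} (ha : ∀ e, a.coeff e ∈ I)
    (hb : ∀ e, b.coeff e ∈ J) (e : ℚ) : (a * b).coeff e ∈ I * J := by
  rw [coeff_mul]
  exact Ideal.sum_mem _ fun ij _ => Ideal.mul_mem_mul (ha _) (hb _)

theorem coeff_pow_mem {I : Ideal R} {a : HahnSeries ℚ R} (ha : ∀ e, a.coeff e ∈ I) (n : ℕ) (e : ℚ) :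
    (a ^ n).coeff e ∈ I ^ n := by
  induction n generalizing e with
  | zero => simp
  | succ n ih =>
    rw [pow_succ, pow_succ]
    exact coeff_mul_mem ih ha e

theorem isNilpotent_of_coeff [IsNoetherianRing R] {a : HahnSeries ℚ R}
    (ha : ∀ e, IsNilpotent (a.coeff e)) : IsNilpotent a := by
  obtain ⟨n, hn⟩ := IsNoetherianRing.isNilpotent_nilradical R
  refine ⟨n, ?_⟩
  ext e
  have h := coeff_pow_mem (I := nilradical R) (fun e => mem_nilradical.2 (ha e)) n e
  rw [hn] at h
  simpa using h

/-- A solution of `x T' = x f(T)`, `f` without constant term, with nilpotent coefficients and no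
integral exponents vanishes: modulo a power of the nilradical the equation becomes linear, and
`e T_e = c T_{e-1}` propagates `0` upwards. -/
theorem eq_zero_of_euler_eq [Algebra ℂ R] [IsNoetherianRing R] {p : ℕ} (hp : 1 < p)
    {T : HahnSeries ℚ R} (hsupp : T.SupportedIn (-1 / p)) {f : ℂ[X]} (hf : f.InClass p 1)
    (hode : euler T = single 1 1 * aeval T f) (hnil : ∀ e, IsNilpotent (T.coeff e)) : T = 0 := by
  obtain ⟨J, hJ⟩ := IsNoetherianRing.isNilpotent_nilradical R
  have hcoeff : ∀ q : ℚ, (q : ℂ) • T.coeff q = (aeval T f).coeff (q - 1) := by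
    intro q
    have h := congrArg (fun t : HahnSeries ℚ R => t.coeff q) hode
    simpa only [euler_coeff, coeff_single_mul, one_mul] using h
  obtain ⟨B, hB⟩ := T.exists_coeff_eq_zero_of_lt
  have hsmul : ∀ (I : Ideal R) (c : ℂ) (r : R), r ∈ I → c • r ∈ I := fun I c r hr => by
    rw [Algebra.smul_def]; exact I.mul_mem_left _ hr
  have key : ∀ j : ℕ, ∀ e, T.coeff e ∈ nilradical R ^ (j + 1) := by
    intro j
    induction j with
    | zero => intro e; rw [zero_add, pow_one]; exact mem_nilradical.2 (hnil e)
    | succ j ih =>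
      have hstep : ∀ n : ℕ, ∀ e : ℚ, e < B + n → T.coeff e ∈ nilradical R ^ (j + 1 + 1) := by
        intro n
        induction n with
        | zero => intro e he; rw [hB e (by simpa using he)]; exact Ideal.zero_mem _
        | succ n ihn =>
          intro e he
          by_cases he0 : e = 0
          · have : T.coeff e = 0 := by
              by_contra h0
              obtain ⟨z, hz⟩ := hsupp e h0
              have hp0 : (p : ℚ) ≠ 0 := by exact_mod_cast (by omega : p ≠ 0)
              rw [he0] at hz
              field_simp at hz
              have h1 : (p : ℤ) * z = 1 := by
                have : (p : ℚ) * z = 1 := by linarith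
                exact_mod_cast this
              have := Int.eq_one_of_dvd_one (by omega) (⟨z, h1.symm⟩ : (p : ℤ) ∣ 1)
              omega
            rw [this]; exact Ideal.zero_mem _
          have he0' : (e : ℂ) ≠ 0 := by exact_mod_cast he0
          have h1 : T.coeff e = (e : ℂ)⁻¹ • (aeval T f).coeff (e - 1) := by
            rw [← hcoeff, inv_smul_smul₀ he0']
          rw [h1, coeff_aeval]
          refine hsmul _ _ _ (Ideal.sum_mem _ fun i _ => ?_)
          rcases Nat.lt_or_ge i 2 with hi | hi
          · interval_cases i
            · have : f.coeff 0 = 0 := by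
                by_contra h0
                have := hf 0 h0
                rw [Nat.ModEq, Nat.zero_mod, Nat.mod_eq_of_lt hp] at this
                omega
              rw [this, zero_smul]; exact Ideal.zero_mem _
            · rw [pow_one]
              exact hsmul _ _ _ (ihn _ (by push_cast at he; linarith))
          · refine hsmul _ _ _ ?_
            have h2 := coeff_pow_mem ih i (e - 1)
            rw [← pow_mul] at h2
            refine Ideal.pow_le_pow_right ?_ h2
            nlinarith
      intro e
      obtain ⟨n, hn⟩ := exists_nat_gt (e - B)
      exact hstep n e (by linarith)
  ext e
  have h := Ideal.pow_le_pow_right (Nat.le_succ J) (key J e)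
  rw [hJ] at h
  simpa using h

end Nilpotent

open scoped IsMulCommutative in
/-- Series with commuting coefficients in the endomorphisms of a finite-dimensional space have
their coefficients in a finite-dimensional commutative algebra. -/
theorem exists_commutative_model {M : Type u} [AddCommGroup M] [Module ℂ M] [FiniteDimensional ℂ M]
    (T : HahnSeries ℚ (Module.End ℂ M)) (hT : ∀ d e, Commute (T.coeff d) (T.coeff e)) :
    ∃ (R : Type u) (_ : CommRing R) (_ : Algebra ℂ R) (_ : FiniteDimensional ℂ R)
      (ρ : R →ₐ[ℂ] Module.End ℂ M) (S : HahnSeries ℚ R),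
      Function.Injective ρ ∧ mapAlgHom ρ S = T := by
  let A := Algebra.adjoin ℂ (Set.range T.coeff)
  have hmul : IsMulCommutative A := Algebra.isMulCommutative_adjoin ℂ (by
    rintro _ ⟨d, rfl⟩ _ ⟨e, rfl⟩
    exact hT d e)
  let hcomm : CommRing A := inferInstance
  have hfin : FiniteDimensional ℂ A := inferInstanceAs (FiniteDimensional ℂ A.toSubmodule)
  refine ⟨A, hcomm, A.algebra, hfin, A.val,
    { coeff := fun e => ⟨T.coeff e, Algebra.subset_adjoin ⟨e, rfl⟩⟩
      isPWO_support' := T.isPWO_support.mono fun e he h0 => he (Subtype.ext h0) },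
    Subtype.val_injective, ?_⟩
  ext1
  rfl

end HahnSeries

/-- The characters of a finite-dimensional commutative algebra detect its non-nilpotent elements. -/
theorem exists_character_of_not_isNilpotent {R : Type*} [CommRing R] [Algebra ℂ R]
    [FiniteDimensional ℂ R] {c : R} (hc : ¬ IsNilpotent c) : ∃ χ : R →ₐ[ℂ] ℂ, χ c ≠ 0 := by
  rw [← mem_nilradical, nilradical_eq_sInf, Ideal.mem_sInf] at hc
  push Not at hc
  obtain ⟨P, hP, hcP⟩ := hc
  have hP' : P.IsPrime := hP
  have hbij : Function.Bijective (algebraMap ℂ (R ⧸ P)) :=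
    IsAlgClosed.algebraMap_bijective_of_isIntegral
  let e : ℂ ≃ₐ[ℂ] (R ⧸ P) := AlgEquiv.ofBijective (Algebra.ofId ℂ (R ⧸ P)) hbij
  refine ⟨(e.symm : (R ⧸ P) →ₐ[ℂ] ℂ).comp (Ideal.Quotient.mkₐ ℂ P), fun h => hcP ?_⟩
  have h1 : e.symm (Ideal.Quotient.mk P c) = 0 := h
  rw [EmbeddingLike.map_eq_zero_iff] at h1
  exact Ideal.Quotient.eq_zero_iff_mem.1 h1

/-! ### The necessary form of the derivation -/

namespace Polynomial

/-- The part of `f` with exponents congruent to `m` modulo `p`. -/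
noncomputable def classPart (p m : ℕ) (f : ℂ[X]) : ℂ[X] :=
  ∑ k ∈ (Finset.range (f.natDegree + 1)).filter fun k => k ≡ m [MOD p],
    Polynomial.monomial k (f.coeff k)

theorem coeff_classPart (p m : ℕ) (f : ℂ[X]) (k : ℕ) :
    (classPart p m f).coeff k = if k ≡ m [MOD p] then f.coeff k else 0 := by
  rw [classPart, finsetSum_coeff]
  simp only [coeff_monomial]
  rw [Finset.sum_ite_eq']
  by_cases hk : k ≤ f.natDegree
  · simp [hk]
  · simp [hk, coeff_eq_zero_of_natDegree_lt (not_le.1 hk)]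

theorem inClass_classPart (p m : ℕ) (f : ℂ[X]) : (classPart p m f).InClass p m := by
  intro k hk
  rw [coeff_classPart] at hk
  by_contra h
  exact hk (if_neg h)

end Polynomial

namespace HahnSeries

theorem coeff_aeval_classPart {R : Type*} [Ring R] [Algebra ℂ R] {p : ℕ} (hp : 0 < p)
    {T : HahnSeries ℚ R} (hT : T.SupportedIn (-1 / p)) (f : ℂ[X]) (m : ℕ) (e : ℚ)
    (he : ∃ j : ℤ, e = m * (-1 / p) + j) :
    (aeval T (classPart p m f)).coeff e = (aeval T f).coeff e := by
  have h : (aeval T (f - classPart p m f)).coeff e = 0 := by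
    rw [coeff_aeval]
    refine Finset.sum_eq_zero fun i _ => ?_
    rw [Polynomial.coeff_sub, coeff_classPart]
    by_cases hi : i ≡ m [MOD p]
    · rw [if_pos hi, sub_self, zero_smul]
    · by_contra h0
      obtain ⟨z, hz⟩ := (hT.pow i) e fun h1 => h0 (by rw [h1, smul_zero])
      obtain ⟨j, hj⟩ := he
      refine hi (Nat.modEq_iff_dvd.2 ⟨j - z, ?_⟩)
      have hp0 : (p : ℚ) ≠ 0 := by exact_mod_cast hp.ne'
      rw [hj] at hz
      field_simp at hz
      have : (m : ℚ) - i = p * (j - z) := by linarith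
      exact_mod_cast this
  rw [map_sub, HahnSeries.coeff_sub, sub_eq_zero] at h
  exact h.symm

theorem supportedIn_mapAlgHom {R S : Type*} [Ring R] [Algebra ℂ R] [Ring S] [Algebra ℂ S]
    (φ : R →ₐ[ℂ] S) {T : HahnSeries ℚ R} {α : ℚ} (hT : T.SupportedIn α) :
    (mapAlgHom φ T).SupportedIn α := fun e he =>
  hT e fun h0 => he (by rw [mapAlgHom_coeff, h0, map_zero])

theorem mapAlgHom_injective {R S : Type*} [Ring R] [Algebra ℂ R] [Ring S] [Algebra ℂ S]
    {φ : R →ₐ[ℂ] S} (hφ : Function.Injective φ) : Function.Injective (mapAlgHom φ) := by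
  intro a b hab
  ext e
  exact hφ (congrArg (fun h : HahnSeries ℚ S => h.coeff e) hab)

theorem mapAlgHom_aeval {R S : Type*} [Ring R] [Algebra ℂ R] [Ring S] [Algebra ℂ S]
    (φ : R →ₐ[ℂ] S) (T : HahnSeries ℚ R) (u : ℂ[X]) :
    mapAlgHom φ (aeval T u) = aeval (mapAlgHom φ T) u :=
  (aeval_algHom_apply (mapAlgHom φ) T u).symm

theorem mapAlgHom_euler_eq {R S : Type*} [Ring R] [Algebra ℂ R] [Ring S] [Algebra ℂ S]
    (φ : R →ₐ[ℂ] S) {T : HahnSeries ℚ R} {f : ℂ[X]} (h : euler T = single 1 1 * aeval T f) :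
    euler (mapAlgHom φ T) = single 1 1 * aeval (mapAlgHom φ T) f := by
  rw [← mapAlgHom_euler, h, map_mul, mapAlgHom_single, map_one, mapAlgHom_aeval]

end HahnSeries

namespace TwistedModule

open HahnSeries

variable {g : ℂ[X] ≃ₐ[ℂ] ℂ[X]} {ξ : ℂ} {p : ℕ} {f : ℂ[X]} {M : Type u} [AddCommGroup M] [Module ℂ M]
  [FiniteDimensional ℂ M]
  (Y : TwistedModule (f • derivative' : Derivation ℂ ℂ[X] ℂ[X]).vertexAlgebra g.toLinearEquiv p ξ M)

/-- `Y(t, x)` solves `T' = f₁(T)`, where `f₁` is the part of `f` with exponents in `1 + pℤ`: the other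
terms of `f(T)` have exponents off the coset on which `Y(f, x) = Y(D t, x)` is known to be `T'`. -/
theorem series_X_euler (hξ : g X = Polynomial.C ξ * X) (hprim : IsPrimitiveRoot ξ p)
    (hp : 1 < p) (hp0 : 0 < p) :
    euler (Y.series hp0 X) = single 1 1 * aeval (Y.series hp0 X) (classPart p 1 f) := by
  have hsupp := Y.series_X_supportedIn hξ hprim hp hp0
  ext1
  funext e
  rw [euler_coeff, coeff_single_mul, one_mul]
  by_cases he : ∃ j : ℤ, e = -1 / p + j
  · obtain ⟨j, hj⟩ := he
    rw [coeff_aeval_classPart hp0 hsupp f 1 (e - 1) ⟨j - 1, by rw [hj]; push_cast; ring⟩]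
    have h := Y.series_derivation_pow_coeff hp0 hp (X_mem_eigenpart hξ hprim hp) 1 (e - 1)
      ⟨j - 1, by rw [hj]; push_cast; ring⟩
    rw [pow_one, Derivation.coeFn_coe, Y.series_eq_aeval hξ hprim hp hp0] at h
    have hDX : (f • derivative' : Derivation ℂ ℂ[X] ℂ[X]) X = f := by simp
    rw [hDX, Nat.cast_one, sub_add_cancel, Ring.choose_one_right] at h
    rw [h]
    simp
  · have h1 : (Y.series hp0 X).coeff e = 0 := by
      by_contra h0
      exact he (hsupp e h0)
    have h2 : (aeval (Y.series hp0 X) (classPart p 1 f)).coeff (e - 1) = 0 := by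
      by_contra h0
      have hcl : (aeval (Y.series hp0 X) (classPart p 1 f)).SupportedIn (-1 / p) := by
        refine supportedIn_aeval hsupp fun k hk => ?_
        obtain ⟨z, hz⟩ := Nat.modEq_iff_dvd.1 (inClass_classPart p 1 f k hk)
        refine ⟨z, ?_⟩
        have hz' : (1 : ℚ) - k = p * z := by exact_mod_cast hz
        have hp' : (p : ℚ) ≠ 0 := by exact_mod_cast hp0.ne'
        field_simp
        linarith
      obtain ⟨j, hj⟩ := hcl _ h0
      exact he ⟨j + 1, by push_cast; linarith⟩
    rw [h1, h2, smul_zero]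

/-- A commutative model for the coefficients of `Y(t, x)`. -/
theorem exists_model (hξ : g X = Polynomial.C ξ * X) (hprim : IsPrimitiveRoot ξ p)
    (hp : 1 < p) (hp0 : 0 < p) :
    ∃ (R : Type u) (_ : CommRing R) (_ : Algebra ℂ R) (_ : FiniteDimensional ℂ R)
      (ρ : R →ₐ[ℂ] Module.End ℂ M) (T : HahnSeries ℚ R),
      Function.Injective ρ ∧ mapAlgHom ρ T = Y.series hp0 X ∧ T.SupportedIn (-1 / p) ∧
      euler T = single 1 1 * aeval T (classPart p 1 f) := by
  obtain ⟨R, _, _, hfin, ρ, T, hρ, hT⟩ :=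
    exists_commutative_model (Y.series hp0 X) (Y.series_X_coeff_commute hξ hprim hp hp0)
  refine ⟨R, _, _, hfin, ρ, T, hρ, hT, fun e he => ?_, ?_⟩
  · refine Y.series_X_supportedIn hξ hprim hp hp0 e fun h0 => he ?_
    rw [← hT, mapAlgHom_coeff] at h0
    exact hρ (by rw [h0, map_zero])
  · refine mapAlgHom_injective hρ ?_
    rw [mapAlgHom_euler, map_mul, mapAlgHom_single, map_one, mapAlgHom_aeval, hT]
    exact Y.series_X_euler hξ hprim hp hp0

/-- The derivation of a twisted module with `Y(t, x) ≠ 0` has the form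
`(c₁ t + c t^(p+1)) d/dt`, `c ≠ 0`. -/
theorem exists_form (hξ : g X = Polynomial.C ξ * X) (hprim : IsPrimitiveRoot ξ p)
    (hp : 1 < p) (hY : Y.mode X ≠ 0) :
    ∃ c₁ c : ℂ, c ≠ 0 ∧ f = Polynomial.C c₁ * X + Polynomial.C c * X ^ (p + 1) := by
  have hp0 : 0 < p := by omega
  obtain ⟨R, _, _, _, ρ, T, hρ, hT, hsupp, hode⟩ := Y.exists_model hξ hprim hp hp0
  have hT0 : T ≠ 0 := by
    rintro rfl
    refine hY ?_
    ext1 i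
    rw [Y.mode_eq_series_coeff hp0, ← hT, map_zero]
    rfl
  have hnoeth : IsNoetherianRing R := isNoetherian_of_tower ℂ inferInstance
  obtain ⟨e₀, he₀⟩ : ∃ e, ¬ IsNilpotent (T.coeff e) := by
    by_contra! h
    exact hT0 (eq_zero_of_euler_eq hp hsupp (inClass_classPart p 1 f) hode h)
  obtain ⟨χ, hχ⟩ := exists_character_of_not_isNilpotent he₀
  set s := mapAlgHom χ T with hs
  have hs0 : s ≠ 0 := fun h => hχ (by rw [← mapAlgHom_coeff, ← hs, h, HahnSeries.coeff_zero])
  have hssupp : s.SupportedIn (-1 / p) := supportedIn_mapAlgHom χ hsupp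
  have hsode := mapAlgHom_euler_eq χ hode
  obtain ⟨hord, hc, hform⟩ :=
    order_and_form_of_euler_eq hp hs0 hssupp (inClass_classPart p 1 f) hsode
  -- The powers of `s` separate residue classes of exponents, so `D` and the derivation of the class
  -- part of `f` have the same class-preserving parts, power by power.
  have hf : f = classPart p 1 f := by
    refine eq_of_derivation_pow_class (inClass_classPart p 1 f) (fun n b j hj => ?_) hp0
    rw [← sub_eq_zero, ← Polynomial.coeff_sub]
    refine coeff_eq_zero_of_aeval_class (r := n % p) hp0 hs0 hssupp hord (fun e he => ?_)
      (hj.trans (Nat.mod_modEq n p).symm)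
    have h := Y.series_derivation_pow_coeff hp0 (Nat.mod_lt n hp0) (X_pow_mem_eigenpart hξ hprim n)
      b e he
    rw [Y.series_eq_aeval hξ hprim hp hp0, Y.series_eq_aeval hξ hprim hp hp0 (X ^ n), ← hT,
      ← mapAlgHom_aeval, ← mapAlgHom_aeval, mapAlgHom_coeff, mapAlgHom_coeff, ← map_smul] at h
    have h2 := congrArg χ (hρ h)
    rw [map_smul, ← mapAlgHom_coeff, ← mapAlgHom_coeff, mapAlgHom_aeval, mapAlgHom_aeval, ← hs] at h2
    rw [map_sub, HahnSeries.coeff_sub, h2, coeff_aeval_derivation_pow hsode, sub_self]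
  exact ⟨_, _, hc, hf.trans hform⟩

end TwistedModule

/-! ### Binomial series and the fundamental scalar series -/

section BinomialSeries

namespace PowerSeries

theorem binomialSeries_pow_natCast (r : ℚ) (k : ℕ) :
    binomialSeries ℂ (k * r) = binomialSeries ℂ r ^ k := by
  induction k with
  | zero => simp
  | succ k ih => rw [pow_succ, ← ih, ← binomialSeries_add]; congr 1; push_cast; ring

/-- `((1 + X)^(-1/p))^p (1 + X) = 1`. -/
theorem binomialSeries_neg_inv_pow {p : ℕ} (hp : 0 < p) :
    binomialSeries ℂ (-1 / p : ℚ) ^ p * (1 + X) = 1 := by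
  have hp' : (p : ℚ) ≠ 0 := by exact_mod_cast hp.ne'
  have h1 := binomialSeries_nat (R := ℚ) (A := ℂ) 1
  rw [pow_one] at h1
  rw [← binomialSeries_pow_natCast, ← h1, ← binomialSeries_add,
    show (p : ℚ) * (-1 / p) + (1 : ℕ) = 0 by field_simp; norm_num, binomialSeries_zero]

/-- Truncated at order `n`, power series can be evaluated at an element with `U^n = 0`. -/
theorem aeval_trunc_coe {A : Type*} [CommRing A] [Algebra ℂ A] {U : A} {n : ℕ} (hU : U ^ n = 0)
    (P : ℂ[X]) : Polynomial.aeval U (trunc n (P : PowerSeries ℂ)) = Polynomial.aeval U P := by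
  have h1 : (Polynomial.X : ℂ[X]) ^ n ∣ P - trunc n (P : PowerSeries ℂ) := by
    rw [Polynomial.X_pow_dvd_iff]
    intro d hd
    rw [Polynomial.coeff_sub, coeff_trunc, if_pos hd, Polynomial.coeff_coe, sub_self]
  obtain ⟨Q, hQ⟩ := h1
  have h2 := congrArg (Polynomial.aeval U) hQ
  rw [map_sub, map_mul, map_pow, Polynomial.aeval_X, hU, zero_mul, sub_eq_zero] at h2
  exact h2.symm

theorem aeval_trunc_mul {A : Type*} [CommRing A] [Algebra ℂ A] {U : A} {n : ℕ} (hU : U ^ n = 0)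
    (G H : PowerSeries ℂ) :
    Polynomial.aeval U (trunc n (G * H)) = Polynomial.aeval U (trunc n G) * Polynomial.aeval U (trunc n H) := by
  rw [← trunc_trunc_mul_trunc, ← Polynomial.coe_mul, aeval_trunc_coe hU, map_mul]

theorem aeval_trunc_pow {A : Type*} [CommRing A] [Algebra ℂ A] {U : A} {n : ℕ} (hU : U ^ n = 0)
    (G : PowerSeries ℂ) (k : ℕ) :
    Polynomial.aeval U (trunc n (G ^ k)) = Polynomial.aeval U (trunc n G) ^ k := by
  induction k with
  | zero =>
    rw [pow_zero, pow_zero, ← Polynomial.coe_one, aeval_trunc_coe hU, map_one]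
  | succ k ih => rw [pow_succ, pow_succ, aeval_trunc_mul hU, ih]

theorem aeval_trunc_eq_sum {A : Type*} [CommRing A] [Algebra ℂ A] (U : A) (n : ℕ)
    (G : PowerSeries ℂ) :
    Polynomial.aeval U (trunc n G) = ∑ i ∈ Finset.range n, coeff i G • U ^ i := by
  rw [trunc_apply, map_sum, Nat.Ico_zero_eq_range]
  refine Finset.sum_congr rfl fun i _ => ?_
  rw [Polynomial.aeval_monomial, Algebra.smul_def]

theorem coeff_binomialSeries_complex (r : ℚ) (i : ℕ) :
    coeff i (binomialSeries ℂ r) = ((Ring.choose r i : ℚ) : ℂ) := by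
  rw [binomialSeries_coeff, Rat.smul_def, mul_one]

/-- `((1 + U)^(-1/p))^p (1 + U) = 1` for nilpotent `U`. -/
theorem sum_choose_pow_mul {A : Type*} [CommRing A] [Algebra ℂ A] {U : A} {n : ℕ} (hU : U ^ n = 0)
    {p : ℕ} (hp : 0 < p) :
    (∑ i ∈ Finset.range n, ((Ring.choose (-1 / p : ℚ) i : ℚ) : ℂ) • U ^ i) ^ p * (1 + U) = 1 := by
  have h := congrArg (fun G => Polynomial.aeval U (trunc n G)) (binomialSeries_neg_inv_pow hp)
  have h1 : (1 + X : PowerSeries ℂ) = ((1 + Polynomial.X : ℂ[X]) : PowerSeries ℂ) := by simp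
  have h2 : (1 : PowerSeries ℂ) = ((1 : ℂ[X]) : PowerSeries ℂ) := by simp
  rw [aeval_trunc_mul hU, aeval_trunc_pow hU, h1, aeval_trunc_coe hU, h2, aeval_trunc_coe hU,
    aeval_trunc_eq_sum] at h
  simpa only [coeff_binomialSeries_complex, map_add, map_one, Polynomial.aeval_X] using h

/-- The same identity for `(1 + G)^(-1/p)` with `G` a power series without constant term. -/
theorem mk_sum_choose_pow_mul {G : PowerSeries ℂ} (hG : constantCoeff G = 0) {p : ℕ}
    (hp : 0 < p) :
    (mk fun k => ∑ i ∈ Finset.range (k + 1), ((Ring.choose (-1 / p : ℚ) i : ℚ) : ℂ) *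
      coeff k (G ^ i)) ^ p * (1 + G) = 1 := by
  have hs : HasSubst G := HasSubst.of_constantCoeff_zero' hG
  have h1 : (mk fun k => ∑ i ∈ Finset.range (k + 1), ((Ring.choose (-1 / p : ℚ) i : ℚ) : ℂ) *
      coeff k (G ^ i)) = (binomialSeries ℂ (-1 / p : ℚ)).subst G := by
    ext k
    rw [coeff_mk, coeff_subst' hs, finsum_eq_sum_of_support_subset (s := Finset.range (k + 1))]
    · simp only [coeff_binomialSeries_complex, smul_eq_mul]
    · intro i hi
      by_contra h
      have hik : k < i := by simpa using h
      refine hi ?_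
      obtain ⟨Q, hQ⟩ := pow_dvd_pow_of_dvd (X_dvd_iff.2 hG) i
      simp only
      rw [hQ, coeff_X_pow_mul', if_neg (not_le.2 hik), smul_zero]
  have h2 := congrArg (fun H => subst G H) (binomialSeries_neg_inv_pow hp)
  simp only [subst_mul hs, subst_pow hs, subst_add hs, subst_X hs] at h2
  have h3 : subst G (1 : PowerSeries ℂ) = (1 : PowerSeries ℂ) := by
    rw [← coe_substAlgHom hs, map_one]
  rw [h3] at h2
  rw [h1, h2]

end PowerSeries

end BinomialSeries

namespace HahnSeries

/-- The scalar series behind the explicit modules: `E` vanishes to first order at `0` and solves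
`E' = a E + 1`, `H` is invertible and solves `H' = a H`, `β` is `E^(-1/p)` and `F` is `H / E`. -/
structure IsFundamental (p : ℕ) (a : ℂ) (β F E H : HahnSeries ℚ ℂ) : Prop where
  pow_mul : β ^ p * E = 1
  mul_eq : E * F = H
  euler_E : euler E = single 1 1 * (C a * E + 1)
  euler_H : euler H = single 1 1 * (C a * H)
  supportedIn : β.SupportedIn (-1 / p)
  supportedIn_H : H.SupportedIn 0
  order_E : E.order = 1
  order_H : H.order = 0
  ne_zero : H ≠ 0

theorem isFundamental_zero {p : ℕ} (hp : 0 < p) :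
    IsFundamental p 0 (single (-1 / p : ℚ) 1) (-single (-1 : ℚ) (1 : ℂ)) (single 1 1) (-1) := by
  have hp' : (p : ℚ) ≠ 0 := by exact_mod_cast hp.ne'
  refine ⟨?_, ?_, ?_, ?_, supportedIn_single _ _, ?_, order_single one_ne_zero, ?_, by simp⟩
  · rw [single_pow, single_mul_single, one_pow, one_mul, nsmul_eq_mul,
      show (p : ℚ) * (-1 / p) + 1 = 0 by field_simp; norm_num, single_zero_one]
  · have h : single (1 : ℚ) (1 : ℂ) * single (-1 : ℚ) (1 : ℂ) = 1 := by
      rw [single_mul_single]; simp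
    linear_combination -h
  · rw [euler_single]; simp
  · rw [euler_neg, euler_one]; simp
  · exact fun e he => supportedIn_C (1 : ℂ) e fun h => he (by
      rw [coeff_neg, ← C_one, h, neg_zero])
  · rw [order_neg, order_one]

theorem euler_ofPowerSeries (G : PowerSeries ℂ) :
    euler (ofPowerSeries ℚ ℂ G) =
      single 1 1 * ofPowerSeries ℚ ℂ (PowerSeries.derivative ℂ G) := by
  ext e
  rw [euler_coeff, coeff_single_mul, one_mul]
  by_cases he : ∃ n : ℕ, e = n
  · obtain ⟨n, rfl⟩ := he
    rcases n with _ | n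
    · rw [ofPowerSeries_coeff_of_neg (PowerSeries.derivative ℂ G) (e := ((0 : ℕ) : ℚ) - 1)
        (by norm_num)]
      simp
    · rw [ofPowerSeries_coeff_nat, show ((n + 1 : ℕ) : ℚ) - 1 = n by push_cast; ring,
        ofPowerSeries_coeff_nat, PowerSeries.coeff_derivative, smul_eq_mul]
      push_cast
      ring
  · push Not at he
    rw [ofPowerSeries_coeff_eq_zero _ he, ofPowerSeries_coeff_eq_zero, smul_zero]
    intro n hn
    exact he (n + 1) (by push_cast; linarith)

theorem derivative_expSeries (a : ℂ) :
    PowerSeries.derivative ℂ (expSeries a) = PowerSeries.C a * expSeries a := by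
  ext k
  rw [PowerSeries.coeff_derivative, PowerSeries.coeff_C_mul, expSeries, PowerSeries.coeff_rescale,
    PowerSeries.coeff_rescale, PowerSeries.coeff_exp, PowerSeries.coeff_exp, Nat.factorial_succ]
  have h3 : (k : ℂ) + 1 ≠ 0 := by exact_mod_cast Nat.succ_ne_zero k
  have h4 : (k.factorial : ℂ) ≠ 0 := by exact_mod_cast k.factorial_ne_zero
  simp only [map_div₀, map_one, map_natCast]
  push_cast
  field_simp
  ring

theorem coeff_zero_expSeries (a : ℂ) : PowerSeries.coeff 0 (expSeries a) = 1 := by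
  rw [expSeries, PowerSeries.coeff_rescale, PowerSeries.coeff_exp]
  simp

theorem coeff_one_expSeries (a : ℂ) : PowerSeries.coeff 1 (expSeries a) = a := by
  rw [expSeries, PowerSeries.coeff_rescale, PowerSeries.coeff_exp]
  simp

/-- `x (1 + G) = (exp(a x) - 1) / a`. -/
theorem single_mul_one_add_expQuotientTail {a : ℂ} (ha : a ≠ 0) :
    single 1 1 * ofPowerSeries ℚ ℂ (1 + expQuotientTail a) =
      C a⁻¹ * (ofPowerSeries ℚ ℂ (expSeries a) - 1) := by
  have h : PowerSeries.X * (1 + expQuotientTail a) =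
      PowerSeries.C a⁻¹ * (expSeries a - 1) := by
    ext k
    rcases k with _ | k
    · rw [PowerSeries.coeff_zero_X_mul, PowerSeries.coeff_C_mul, map_sub, coeff_zero_expSeries]
      simp
    · rw [PowerSeries.coeff_succ_X_mul, PowerSeries.coeff_C_mul, map_sub, expQuotientTail,
        add_sub_cancel, PowerSeries.coeff_mk, PowerSeries.coeff_one, if_neg (Nat.succ_ne_zero k)]
      field_simp
      ring
  have h2 := congrArg (ofPowerSeries ℚ ℂ) h
  rw [map_mul, map_mul, map_sub, map_one, ofPowerSeries_X, ofPowerSeries_C] at h2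
  exact h2

theorem order_eq_of_coeff {h : HahnSeries ℚ ℂ} {q : ℚ} (hq : h.coeff q ≠ 0)
    (hlt : ∀ e < q, h.coeff e = 0) : h.order = q := by
  refine le_antisymm (order_le_of_coeff_ne_zero hq) ?_
  by_contra hlt'
  exact (coeff_order_eq_zero (x := h)).not.2 (ne_zero_of_coeff_ne_zero hq) (hlt _ (not_le.1 hlt'))

theorem isFundamental_exp {p : ℕ} (hp : 0 < p) {a : ℂ} (ha : a ≠ 0) :
    IsFundamental p a (shiftedPow (expQuotientTail a) (-1 / p : ℚ))
      (-(ofPowerSeries ℚ ℂ (expSeries a) / (-1 + ofPowerSeries ℚ ℂ (expSeries a))))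
      (C a⁻¹ * (ofPowerSeries ℚ ℂ (expSeries a) - 1))
      (-(C a⁻¹ * ofPowerSeries ℚ ℂ (expSeries a))) := by
  have hp' : (p : ℚ) ≠ 0 := by exact_mod_cast hp.ne'
  set ε := ofPowerSeries ℚ ℂ (expSeries a) with hε
  have hε0 : ε.coeff 0 = 1 := by
    have := ofPowerSeries_coeff_nat (expSeries a) 0
    rw [coeff_zero_expSeries, Nat.cast_zero] at this
    exact this
  have hεneg : ∀ e < 0, ε.coeff e = 0 := fun e he => ofPowerSeries_coeff_of_neg _ he
  have hε1 : ε.coeff 1 = a := by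
    have := ofPowerSeries_coeff_nat (expSeries a) 1
    rw [coeff_one_expSeries, Nat.cast_one] at this
    exact this
  have hai : a⁻¹ ≠ 0 := inv_ne_zero ha
  have hCa : (C a * C a⁻¹ : HahnSeries ℚ ℂ) = 1 := by
    rw [← map_mul, mul_inv_cancel₀ ha, C_one]
  have hEcoeff : ∀ e, (C a⁻¹ * (ε - 1)).coeff e = a⁻¹ * (ε.coeff e - if e = 0 then 1 else 0) := by
    intro e
    rw [C_mul_eq_smul, HahnSeries.coeff_smul, HahnSeries.coeff_sub, smul_eq_mul, ← single_zero_one]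
    congr 2
    rw [coeff_single]
    congr
  have hE1 : (C a⁻¹ * (ε - 1)).coeff 1 ≠ 0 := by
    rw [hEcoeff, hε1]; simp [ha]
  have hEne : C a⁻¹ * (ε - 1) ≠ 0 := ne_zero_of_coeff_ne_zero hE1
  have hsub : -1 + ε ≠ 0 := by
    intro h
    apply hEne
    rw [show ε - 1 = -1 + ε by ring, h, mul_zero]
  have hH0 : (-(C a⁻¹ * ε)).coeff 0 ≠ 0 := by
    rw [HahnSeries.coeff_neg, C_mul_eq_smul, HahnSeries.coeff_smul, hε0]
    simp [ha]
  have heuler : euler ε = single 1 1 * (C a * ε) := by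
    rw [hε, euler_ofPowerSeries, derivative_expSeries, map_mul, ofPowerSeries_C]
  have hG0 : PowerSeries.constantCoeff (expQuotientTail a) = 0 := by
    rw [expQuotientTail, ← PowerSeries.coeff_zero_eq_constantCoeff_apply, map_sub,
      PowerSeries.coeff_mk, zero_add, coeff_one_expSeries, div_self ha]
    simp
  refine ⟨?_, ?_, ?_, ?_, ?_, ?_, ?_, ?_, ne_zero_of_coeff_ne_zero hH0⟩
  · have h := congrArg (ofPowerSeries ℚ ℂ) (PowerSeries.mk_sum_choose_pow_mul hG0 hp)
    rw [map_mul, map_pow, map_one] at h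
    rw [← single_mul_one_add_expQuotientTail ha, shiftedPow, mul_pow, mul_mul_mul_comm, h,
      single_pow, single_mul_single, one_pow, one_mul, mul_one, nsmul_eq_mul,
      show (p : ℚ) * (-1 / p) + 1 = 0 by field_simp; norm_num, single_zero_one]
  · field_simp
    ring
  · rw [euler_mul, euler_C, zero_mul, zero_add, euler_sub, euler_one, sub_zero, heuler]
    linear_combination (single 1 1 : HahnSeries ℚ ℂ) * hCa
  · rw [euler_neg, euler_mul, euler_C, zero_mul, zero_add, heuler]
    ring
  · rw [shiftedPow]
    have h := (supportedIn_single (-1 / p : ℚ) (1 : ℂ)).mul (supportedIn_ofPowerSeries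
      (PowerSeries.mk fun k => ∑ i ∈ Finset.range (k + 1), ((Ring.choose (-1 / p : ℚ) i : ℚ) : ℂ) *
      PowerSeries.coeff k (expQuotientTail a ^ i)))
    rwa [add_zero] at h
  · intro e he
    refine supportedIn_ofPowerSeries (expSeries a) e fun h => he ?_
    rw [HahnSeries.coeff_neg, C_mul_eq_smul, HahnSeries.coeff_smul, hε, h, smul_zero, neg_zero]
  · refine order_eq_of_coeff hE1 fun e he => ?_
    rw [hEcoeff]
    by_cases h0 : e = 0
    · rw [h0, hε0]; simp
    · rw [if_neg h0]
      rcases lt_or_gt_of_ne h0 with hlt | hgt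
      · rw [hεneg e hlt]; simp
      · rw [hε, ofPowerSeries_coeff_eq_zero]
        · simp
        · rintro n rfl
          have h1 : 0 < n := by exact_mod_cast hgt
          have h2 : n < 1 := by exact_mod_cast he
          omega
  · refine order_eq_of_coeff hH0 fun e he => ?_
    rw [HahnSeries.coeff_neg, C_mul_eq_smul, HahnSeries.coeff_smul, hεneg e he]
    simp

/-- One choice of scalar series describes both cases of the explicit formula. -/
theorem exists_isFundamental {p : ℕ} (hp : 0 < p) (c₁ : ℂ) :
    ∃ β F E H : HahnSeries ℚ ℂ, IsFundamental p (-c₁ * p) β F E H ∧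
      ∀ (κ : ℂ) (n : ℕ), twistSeries p c₁ κ n =
        (C κ * β) • unipotentPow F (jordanBlock (HahnSeries ℚ ℂ) n) (-1 / p : ℚ) := by
  by_cases hc : c₁ = 0
  · have h := isFundamental_zero hp
    refine ⟨_, _, _, _, by rw [hc, neg_zero, zero_mul]; exact h, fun κ n => ?_⟩
    rw [twistSeries, if_pos hc, twistSeriesZero]
  · have ha : -c₁ * p ≠ 0 := mul_ne_zero (neg_ne_zero.2 hc) (by exact_mod_cast hp.ne')
    refine ⟨_, _, _, _, isFundamental_exp hp ha, fun κ n => ?_⟩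
    rw [twistSeries, if_neg hc, twistSeriesExp]

end HahnSeries

/-! ### Explicit solutions of the Bernoulli equation -/

namespace HahnSeries

section TwistSolution

variable {R : Type*} [CommRing R] [Algebra ℂ R]

/-- Passing from `V` to `S = V^(-1/p)` turns the linear equation `V' = -p (c₁ V + c)` into the
Bernoulli equation `S' = c₁ S + c S^(p+1)`. -/
theorem euler_eq_of_pow_mul_eq_one {p : ℕ} (hp : 0 < p) {S V : HahnSeries ℚ R}
    (hSV : S ^ p * V = 1) {c₁ c : ℂ}
    (hV : euler V = single 1 1 * (algebraMap ℂ _ (-c₁ * p) * V + algebraMap ℂ _ (-p * c))) :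
    euler S = single 1 1 * aeval S (Polynomial.C c₁ * X + Polynomial.C c * X ^ (p + 1)) := by
  have h1 := congrArg euler hSV
  rw [euler_mul, euler_one] at h1
  have h2 := euler_pow S p
  have hp' : (p : ℂ) ≠ 0 := by exact_mod_cast hp.ne'
  have h3 : (p : HahnSeries ℚ R) * algebraMap ℂ _ (p : ℂ)⁻¹ = 1 := by
    rw [← map_natCast (algebraMap ℂ (HahnSeries ℚ R)) p, ← map_mul, mul_inv_cancel₀ hp', map_one]
  simp only [map_add, map_mul, map_pow, aeval_C, aeval_X, map_neg, map_natCast] at hV ⊢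
  have h4 : (p : HahnSeries ℚ R) * (euler S - single 1 1 * (algebraMap ℂ _ c₁ * S +
      algebraMap ℂ _ c * S ^ (p + 1))) = 0 := by
    linear_combination S * h1 - V * h2 - S ^ (p + 1) * hV +
      (-(p : HahnSeries ℚ R) * euler S + single 1 1 * algebraMap ℂ _ c₁ * p * S) * hSV
  calc _ = (euler S - single 1 1 * (algebraMap ℂ _ c₁ * S + algebraMap ℂ _ c * S ^ (p + 1))) +
      single 1 1 * (algebraMap ℂ _ c₁ * S + algebraMap ℂ _ c * S ^ (p + 1)) := by ring
    _ = _ := by linear_combination (algebraMap ℂ _ (p : ℂ)⁻¹) * h4 - (euler S - single 1 1 *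
      (algebraMap ℂ _ c₁ * S + algebraMap ℂ _ c * S ^ (p + 1))) * h3

/-- The converse of `euler_eq_of_pow_mul_eq_one`. -/
theorem euler_eq_of_bernoulli {p : ℕ} (hp : 0 < p) {S V : HahnSeries ℚ R}
    (hSV : S ^ p * V = 1) {c₁ c : ℂ}
    (hS : euler S = single 1 1 * aeval S (Polynomial.C c₁ * X + Polynomial.C c * X ^ (p + 1))) :
    euler V = single 1 1 * (algebraMap ℂ _ (-c₁ * p) * V + algebraMap ℂ _ (-p * c)) := by
  obtain ⟨q, rfl⟩ : ∃ q, p = q + 1 := ⟨p - 1, by omega⟩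
  have h1 := congrArg euler hSV
  rw [euler_mul, euler_one] at h1
  have h2 := euler_pow S (q + 1)
  simp only [map_add, map_mul, map_pow, aeval_C, aeval_X, map_neg, map_natCast] at hS ⊢
  have hA : S ^ (q + 2) * (euler V - single 1 1 * (-algebraMap ℂ _ c₁ * ((q + 1 : ℕ) :
      HahnSeries ℚ R) * V + -((q + 1 : ℕ) : HahnSeries ℚ R) * algebraMap ℂ _ c)) = 0 := by
    linear_combination S * h1 - V * h2 - (q + 1 : ℕ) * S ^ (q + 1) * V * hS +
      (- (q + 1 : ℕ) * single 1 1 * algebraMap ℂ _ c * S ^ (q + 2)) * hSV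
  have hB : S ^ (q + 2) * (S ^ q * V ^ 2) = 1 := by
    linear_combination (S ^ (q + 1) * V + 1) * hSV
  linear_combination (S ^ q * V ^ 2) * hA - (euler V - single 1 1 * (-algebraMap ℂ _ c₁ *
    ((q + 1 : ℕ) : HahnSeries ℚ R) * V + -((q + 1 : ℕ) : HahnSeries ℚ R) * algebraMap ℂ _ c)) * hB

/-- The series `κ β (1 + F N)^(-1/p)` with a nilpotent element `N` of a commutative algebra. -/
noncomputable def twistSolution (p n : ℕ) (κ : ℂ) (β F : HahnSeries ℚ ℂ) (N : R) :
    HahnSeries ℚ R :=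
  mapAlgHom (Algebra.ofId ℂ R) (C κ * β) * ∑ i ∈ Finset.range n,
    ((Ring.choose (-1 / p : ℚ) i : ℚ) : ℂ) • (mapAlgHom (Algebra.ofId ℂ R) F * C N) ^ i

theorem coeff_mapAlgHom_mul_C (h : HahnSeries ℚ ℂ) (N : R) (e : ℚ) :
    (mapAlgHom (Algebra.ofId ℂ R) h * C N).coeff e = h.coeff e • N := by
  rw [C_apply, coeff_mul_single_zero, mapAlgHom_coeff, Algebra.smul_def]
  rfl

theorem coeff_twistSolution (p n : ℕ) (κ : ℂ) (β F : HahnSeries ℚ ℂ) (N : R) (e : ℚ) :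
    (twistSolution p n κ β F N).coeff e = ∑ i ∈ Finset.range n,
      (C κ * β * (C ((Ring.choose (-1 / p : ℚ) i : ℚ) : ℂ) * F ^ i)).coeff e • N ^ i := by
  rw [twistSolution, Finset.mul_sum, coeff_sum']
  refine Finset.sum_congr rfl fun i _ => ?_
  have h : mapAlgHom (Algebra.ofId ℂ R) (C ((Ring.choose (-1 / p : ℚ) i : ℚ) : ℂ)) =
      algebraMap ℂ (HahnSeries ℚ R) ((Ring.choose (-1 / p : ℚ) i : ℚ) : ℂ) :=
    (mapAlgHom (Algebra.ofId ℂ R)).commutes _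
  rw [← coeff_mapAlgHom_mul_C]
  simp only [map_mul, map_pow, mul_pow, Algebra.smul_def, h]
  congr 1
  ring

variable {p : ℕ} {a : ℂ} {β F E H : HahnSeries ℚ ℂ}

theorem IsFundamental.eq_pow_mul (h : IsFundamental p a β F E H) : F = β ^ p * H := by
  rw [← h.mul_eq, ← mul_assoc, h.pow_mul, one_mul]

theorem IsFundamental.supportedIn_F (h : IsFundamental p a β F E H) (hp : 0 < p) :
    F.SupportedIn 0 := by
  have hp' : (p : ℚ) ≠ 0 := by exact_mod_cast hp.ne'
  rw [h.eq_pow_mul]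
  exact ((h.supportedIn.pow p).mul h.supportedIn_H).add_int ⟨-1, by push_cast; field_simp; ring⟩

theorem IsFundamental.order_β (h : IsFundamental p a β F E H) (hp : 0 < p) :
    β.order = -1 / p := by
  have hp' : (p : ℚ) ≠ 0 := by exact_mod_cast hp.ne'
  have h1 : β ^ p ≠ 0 := fun h0 => one_ne_zero (h.pow_mul.symm.trans (by rw [h0, zero_mul]))
  have hE : E ≠ 0 := fun h0 => one_ne_zero (h.pow_mul.symm.trans (by rw [h0, mul_zero]))
  have h2 := congrArg order h.pow_mul
  rw [order_mul h1 hE, order_pow, h.order_E, order_one, nsmul_eq_mul] at h2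
  field_simp
  linarith

theorem IsFundamental.order_F (h : IsFundamental p a β F E H) : F.order = -1 := by
  have hE : E ≠ 0 := fun h0 => h.ne_zero (h.mul_eq.symm.trans (by rw [h0, zero_mul]))
  have hF : F ≠ 0 := fun h0 => h.ne_zero (h.mul_eq.symm.trans (by rw [h0, mul_zero]))
  have h2 := congrArg order h.mul_eq
  rw [order_mul hE hF, h.order_E, h.order_H] at h2
  linarith

theorem twistSolution_supportedIn (h : IsFundamental p a β F E H) (hp : 0 < p) (n : ℕ) (κ : ℂ)
    (N : R) : (twistSolution p n κ β F N).SupportedIn (-1 / p) := by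
  rw [twistSolution]
  refine ((supportedIn_mapAlgHom _ ((supportedIn_C κ).mul h.supportedIn)).mul
    (SupportedIn.sum (α := 0) fun i _ => ?_)).add_int ⟨0, by push_cast; ring⟩
  exact ((((supportedIn_mapAlgHom _ (h.supportedIn_F hp)).mul (supportedIn_C N)).pow i).smul
    _).add_int ⟨0, by push_cast; ring⟩

/-- The `p`-th power of the solution is the inverse of `δ (E + H N)`. -/
theorem twistSolution_pow_mul (h : IsFundamental p a β F E H) (hp : 0 < p) {n : ℕ} {κ δ : ℂ}
    (hκ : κ ^ p * δ = 1) {N : R} (hN : N ^ n = 0) :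
    twistSolution p n κ β F N ^ p * (algebraMap ℂ _ δ * (mapAlgHom (Algebra.ofId ℂ R) E +
      mapAlgHom (Algebra.ofId ℂ R) H * C N)) = 1 := by
  set ι := mapAlgHom (Algebra.ofId ℂ R)
  have hU : (ι F * C N) ^ n = 0 := by rw [mul_pow, ← map_pow C, hN, map_zero, mul_zero]
  have h1 := PowerSeries.sum_choose_pow_mul hU hp
  have h2 : ι β ^ p * ι E = 1 := by rw [← map_pow, ← map_mul, h.pow_mul, map_one]
  have h3 : ι E * ι F = ι H := by rw [← map_mul, h.mul_eq]
  have h4 : ι (C κ) = algebraMap ℂ (HahnSeries ℚ R) κ := ι.commutes κ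
  have h5 : algebraMap ℂ (HahnSeries ℚ R) κ ^ p * algebraMap ℂ (HahnSeries ℚ R) δ = 1 := by
    rw [← map_pow, ← map_mul, hκ, map_one]
  rw [twistSolution, map_mul, h4, ← h3]
  set Q := ∑ i ∈ Finset.range n, ((Ring.choose (-1 / p : ℚ) i : ℚ) : ℂ) • (ι F * C N) ^ i
  have h6 : (algebraMap ℂ (HahnSeries ℚ R) κ * ι β * Q) ^ p =
    algebraMap ℂ (HahnSeries ℚ R) κ ^ p * ι β ^ p * Q ^ p := by rw [mul_pow, mul_pow]
  rw [h6]
  calc _ = (algebraMap ℂ (HahnSeries ℚ R) κ ^ p * algebraMap ℂ (HahnSeries ℚ R) δ) *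
        (ι β ^ p * ι E) * (Q ^ p * (1 + ι F * C N)) := by ring
    _ = 1 := by rw [h5, h2, h1]; ring

/-- `V = δ (E + H N)` solves `V' = a V + δ` for every `N`. -/
theorem euler_fundamental (h : IsFundamental p a β F E H) (δ : ℂ) (N : R) :
    euler (algebraMap ℂ _ δ * (mapAlgHom (Algebra.ofId ℂ R) E +
      mapAlgHom (Algebra.ofId ℂ R) H * C N)) = single 1 1 * (algebraMap ℂ _ a *
      (algebraMap ℂ _ δ * (mapAlgHom (Algebra.ofId ℂ R) E +
      mapAlgHom (Algebra.ofId ℂ R) H * C N)) + algebraMap ℂ _ δ) := by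
  set ι := mapAlgHom (Algebra.ofId ℂ R)
  have h4 : ι (C a) = algebraMap ℂ (HahnSeries ℚ R) a := ι.commutes a
  have h5 : ι (single 1 1) = single 1 1 := by rw [mapAlgHom_single, map_one]
  have hE := congrArg ι h.euler_E
  have hH := congrArg ι h.euler_H
  rw [mapAlgHom_euler, map_mul ι, map_add ι, map_mul ι, map_one ι, h4, h5] at hE
  rw [mapAlgHom_euler, map_mul ι, map_mul ι, h4, h5] at hH
  rw [euler_mul, HahnSeries.algebraMap_apply, euler_C, euler_add, euler_mul, euler_C]
  rw [HahnSeries.algebraMap_apply] at hE hH ⊢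
  linear_combination (C (algebraMap ℂ R δ)) * hE + (C (algebraMap ℂ R δ)) * C N * hH

theorem euler_twistSolution {c₁ : ℂ} (h : IsFundamental p (-c₁ * p) β F E H) (hp : 0 < p)
    {n : ℕ} {κ c : ℂ} (hκ : κ ^ p * (-p * c) = 1) {N : R} (hN : N ^ n = 0) :
    euler (twistSolution p n κ β F N) = single 1 1 * aeval (twistSolution p n κ β F N)
      (Polynomial.C c₁ * X + Polynomial.C c * X ^ (p + 1)) :=
  euler_eq_of_pow_mul_eq_one hp (twistSolution_pow_mul h hp hκ hN) (euler_fundamental h _ N)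

end TwistSolution

end HahnSeries

/-! ### Jordan blocks -/

section JordanBlock

theorem toLin'_jordanBlock_apply (n : ℕ) (w : Fin n → ℂ) (k : Fin n) :
    Matrix.toLin' (jordanBlock ℂ n) w k = if h : (k : ℕ) + 1 < n then w ⟨k + 1, h⟩ else 0 := by
  rw [Matrix.toLin'_apply, Matrix.mulVec, dotProduct]
  simp only [jordanBlock, Matrix.of_apply, ite_mul, one_mul, zero_mul]
  split_ifs with h
  · rw [Finset.sum_eq_single ⟨k + 1, h⟩]
    · simp
    · intro j _ hj
      rw [if_neg]
      intro h1
      exact hj (Fin.ext h1.symm)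
    · simp
  · refine Finset.sum_eq_zero fun j _ => if_neg ?_
    have := j.2
    omega

theorem toLin'_jordanBlock_pow_apply (n i : ℕ) (w : Fin n → ℂ) (k : Fin n) :
    (Matrix.toLin' (jordanBlock ℂ n) ^ i) w k = if h : (k : ℕ) + i < n then w ⟨k + i, h⟩ else 0 := by
  induction i generalizing k with
  | zero => simp
  | succ i ih =>
    rw [pow_succ', Module.End.mul_apply, toLin'_jordanBlock_apply]
    split_ifs with h1 h2 h2
    · rw [ih, dif_pos (by simp only; omega)]
      congr 2
      simp only
      omega
    · rw [ih, dif_neg (by simp only; omega)]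
    · omega
    · rfl

theorem toLin'_jordanBlock_pow_eq_zero (n : ℕ) : Matrix.toLin' (jordanBlock ℂ n) ^ n = 0 := by
  refine LinearMap.ext fun w => funext fun k => ?_
  rw [toLin'_jordanBlock_pow_apply, dif_neg (by omega)]
  rfl

theorem Matrix.smul_pow_of_commRing {S ι : Type*} [CommRing S] [Fintype ι] [DecidableEq ι] (c : S)
    (A : Matrix ι ι S) (i : ℕ) : (c • A) ^ i = c ^ i • A ^ i :=
  _root_.smul_pow c A i

/-- The coefficients of the matrix series `G • (E_n + F J_n)^m` as operators. -/
theorem toLin'_coeff_smul_unipotentPow (n : ℕ) (G F : HahnSeries ℚ ℂ) (m e : ℚ) :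
    Matrix.toLin' ((G • unipotentPow F (jordanBlock (HahnSeries ℚ ℂ) n) m).map
      fun h => h.coeff e) = ∑ i ∈ Finset.range n,
      (G * (HahnSeries.C ((Ring.choose m i : ℚ) : ℂ) * F ^ i)).coeff e •
        Matrix.toLin' (jordanBlock ℂ n) ^ i := by
  have hJ : jordanBlock (HahnSeries ℚ ℂ) n =
      (HahnSeries.C : ℂ →+* HahnSeries ℚ ℂ).mapMatrix (jordanBlock ℂ n) := by
    ext i j : 2
    simp only [jordanBlock, Matrix.of_apply, RingHom.mapMatrix_apply, Matrix.map_apply]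
    split_ifs <;> simp
  have h : (G • unipotentPow F (jordanBlock (HahnSeries ℚ ℂ) n) m).map (fun h => h.coeff e) =
      ∑ i ∈ Finset.range n, (G * (HahnSeries.C ((Ring.choose m i : ℚ) : ℂ) * F ^ i)).coeff e •
        jordanBlock ℂ n ^ i := by
    ext a b
    rw [Matrix.map_apply, unipotentPow, Finset.smul_sum, Matrix.sum_apply, Matrix.sum_apply,
      HahnSeries.coeff_sum']
    refine Finset.sum_congr rfl fun i _ => ?_
    have hpow := Matrix.smul_pow_of_commRing F (jordanBlock (HahnSeries ℚ ℂ) n) i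
    rw [hpow, hJ, ← map_pow]
    simp only [Matrix.smul_apply, RingHom.mapMatrix_apply, Matrix.map_apply, smul_eq_mul]
    rw [← mul_assoc, ← mul_assoc, HahnSeries.C_apply ((jordanBlock ℂ n ^ i) a b),
      HahnSeries.coeff_mul_single_zero, mul_assoc]
  rw [h, map_sum]
  refine Finset.sum_congr rfl fun i _ => ?_
  rw [map_smul, Matrix.toLin'_pow]

end JordanBlock

section CyclicNilpotent

open Module

variable {M : Type*} [AddCommGroup M] [Module ℂ M]

/-- The map `w ↦ (λ (N^i w))_i` intertwines `N` with the Jordan block. -/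
theorem toLin'_jordanBlock_pi_comp {N : Module.End ℂ M} {k : ℕ} (hN : N ^ k = 0)
    (μ : Module.Dual ℂ M) (w : M) :
    LinearMap.pi (fun i : Fin k => μ ∘ₗ (N ^ (i : ℕ))) (N w) =
      Matrix.toLin' (jordanBlock ℂ k) (LinearMap.pi (fun i : Fin k => μ ∘ₗ (N ^ (i : ℕ))) w) := by
  funext i
  rw [toLin'_jordanBlock_apply]
  simp only [LinearMap.pi_apply, LinearMap.comp_apply]
  rw [← Module.End.mul_apply, ← pow_succ]
  split_ifs with h
  · rfl
  · rw [show (i : ℕ) + 1 = k by omega, hN, LinearMap.zero_apply, map_zero]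

/-- A nilpotent operator without nontrivial invariant decompositions is a single Jordan block. The
cyclic subspace of a vector `v` with `N^(k-1) v ≠ 0`, where `k` is the nilpotency index, has the
invariant complement `{w | μ (N^i w) = 0 for all i}`, for any form `μ` with `μ (N^(k-1) v) ≠ 0`. -/
theorem exists_equiv_jordanBlock [FiniteDimensional ℂ M] [Nontrivial M] {N : Module.End ℂ M}
    (hN : IsNilpotent N)
    (hind : ∀ W₁ W₂ : Submodule ℂ M, (∀ w ∈ W₁, N w ∈ W₁) → (∀ w ∈ W₂, N w ∈ W₂) →
      IsCompl W₁ W₂ → W₁ = ⊥ ∨ W₂ = ⊥) {n : ℕ} (hn : finrank ℂ M = n) :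
    ∃ φ : M ≃ₗ[ℂ] (Fin n → ℂ), ∀ w, φ (N w) = Matrix.toLin' (jordanBlock ℂ n) (φ w) := by
  set k := nilpotencyClass N with hk
  have hNk : N ^ k = 0 := pow_nilpotencyClass hN
  have hkpos : 0 < k := pos_nilpotencyClass_iff.2 hN
  have hNk1 : N ^ (k - 1) ≠ 0 := pow_pred_nilpotencyClass hN
  obtain ⟨v, hv⟩ : ∃ v, (N ^ (k - 1)) v ≠ 0 := by
    by_contra! h
    exact hNk1 (LinearMap.ext h)
  obtain ⟨μ, hμ⟩ : ∃ μ : Module.Dual ℂ M, μ ((N ^ (k - 1)) v) ≠ 0 := by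
    by_contra! h
    exact hv ((Module.forall_dual_apply_eq_zero_iff ℂ _).1 h)
  set Φ : M →ₗ[ℂ] (Fin k → ℂ) := LinearMap.pi (fun i : Fin k => μ ∘ₗ (N ^ (i : ℕ))) with hΦ
  set Ψ : (Fin k → ℂ) →ₗ[ℂ] M := Fintype.linearCombination ℂ fun j : Fin k => (N ^ (j : ℕ)) v
    with hΨ
  have hzero : ∀ j, k ≤ j → N ^ j = 0 := fun j hj => pow_eq_zero_of_le hj hNk
  have hΦN : ∀ w, Φ (N w) = Matrix.toLin' (jordanBlock ℂ k) (Φ w) :=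
    toLin'_jordanBlock_pi_comp hNk μ
  have hcomp : ∀ a i, Φ (Ψ a) i = ∑ j : Fin k, a j * μ ((N ^ ((i : ℕ) + j)) v) := by
    intro a i
    simp only [hΦ, hΨ, LinearMap.pi_apply, LinearMap.comp_apply, Fintype.linearCombination_apply,
      map_sum, map_smul, smul_eq_mul, pow_add, Module.End.mul_apply]
  have hinj : Function.Injective (Φ ∘ₗ Ψ) := by
    rw [injective_iff_map_eq_zero]
    intro a ha
    have key : ∀ m : ℕ, ∀ hm : m < k, a ⟨m, hm⟩ = 0 := by
      intro m
      induction m using Nat.strong_induction_on with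
      | _ m ih =>
        intro hm
        have h := congrFun ha ⟨k - 1 - m, by omega⟩
        rw [LinearMap.comp_apply, hcomp, Finset.sum_eq_single ⟨m, hm⟩] at h
        · rw [show k - 1 - m + m = k - 1 by omega] at h
          exact (mul_eq_zero.1 h).resolve_right hμ
        · intro j _ hj
          rcases lt_or_gt_of_ne (fun h0 => hj (Fin.ext h0) : (j : ℕ) ≠ m) with hlt | hgt
          · rw [ih j hlt j.2, zero_mul]
          · rw [hzero _ (by simp only; omega), LinearMap.zero_apply, map_zero, mul_zero]
        · simp
    funext i
    exact key i i.2
  have hsurj : Function.Surjective (Φ ∘ₗ Ψ) := LinearMap.injective_iff_surjective.1 hinj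
  have hcompl : IsCompl (LinearMap.range Ψ) (LinearMap.ker Φ) := by
    constructor
    · rw [Submodule.disjoint_def]
      rintro _ ⟨a, rfl⟩ h
      rw [hinj (a₁ := a) (a₂ := 0) (by rw [map_zero]; exact h), map_zero]
    · rw [codisjoint_iff, Submodule.eq_top_iff']
      intro w
      obtain ⟨a, ha⟩ := hsurj (Φ w)
      refine Submodule.mem_sup.2 ⟨Ψ a, ⟨a, rfl⟩, w - Ψ a, ?_, by abel⟩
      rw [LinearMap.mem_ker, map_sub, ← ha]
      exact sub_self _
  have hΨstable : ∀ w ∈ LinearMap.range Ψ, N w ∈ LinearMap.range Ψ := by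
    rintro _ ⟨a, rfl⟩
    rw [hΨ, Fintype.linearCombination_apply, map_sum]
    refine Submodule.sum_mem _ fun j _ => ?_
    rw [map_smul, ← Module.End.mul_apply, ← pow_succ']
    refine Submodule.smul_mem _ _ ?_
    by_cases hj : (j : ℕ) + 1 < k
    · exact ⟨Pi.single ⟨j + 1, hj⟩ 1, by rw [Fintype.linearCombination_apply_single, one_smul]⟩
    · rw [hzero _ (by omega)]
      exact Submodule.zero_mem _
  have hΦstable : ∀ w ∈ LinearMap.ker Φ, N w ∈ LinearMap.ker Φ := by
    intro w hw
    rw [LinearMap.mem_ker] at hw ⊢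
    rw [hΦN, hw, map_zero]
  have hker : LinearMap.ker Φ = ⊥ := by
    refine (hind _ _ hΨstable hΦstable hcompl).resolve_left fun h => ?_
    have hmem : v ∈ LinearMap.range Ψ := ⟨Pi.single ⟨0, hkpos⟩ 1, by
      rw [hΨ, Fintype.linearCombination_apply_single, one_smul]; simp⟩
    rw [h, Submodule.mem_bot] at hmem
    exact hv (by rw [hmem, map_zero])
  have hbij : Function.Bijective Φ :=
    ⟨LinearMap.ker_eq_bot.1 hker, fun b => (hsurj b).imp' Ψ fun _ h => h⟩
  have hkn : k = n := by
    rw [← hn, LinearEquiv.finrank_eq (LinearEquiv.ofBijective Φ hbij), finrank_fin_fun]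
  clear_value k
  subst hkn
  exact ⟨LinearEquiv.ofBijective Φ hbij, hΦN⟩

/-- The Jordan block has a one-dimensional kernel. -/
theorem exists_smul_of_jordanBlock_eq_zero {n : ℕ} {v w : Fin n → ℂ}
    (hv : Matrix.toLin' (jordanBlock ℂ n) v = 0) (hw : Matrix.toLin' (jordanBlock ℂ n) w = 0)
    (hv0 : v ≠ 0) : ∃ c : ℂ, w = c • v := by
  have key : ∀ u : Fin n → ℂ, Matrix.toLin' (jordanBlock ℂ n) u = 0 →
      ∀ i : Fin n, (i : ℕ) ≠ 0 → u i = 0 := by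
    intro u hu i hi
    have h := congrFun hu ⟨i - 1, by omega⟩
    rw [toLin'_jordanBlock_apply, dif_pos (by simp only; omega)] at h
    rw [Pi.zero_apply] at h
    convert h using 2
    ext
    simp only
    omega
  obtain ⟨i, hi⟩ := Function.ne_iff.1 hv0
  have hi0 : (i : ℕ) = 0 := by
    by_contra h
    exact hi (key v hv i h)
  refine ⟨w i / v i, ?_⟩
  funext j
  by_cases hj : (j : ℕ) = 0
  · have hij : j = i := Fin.ext (by omega)
    rw [hij, Pi.smul_apply, smul_eq_mul, div_mul_cancel₀ _ hi]
  · rw [Pi.smul_apply, key v hv j hj, key w hw j hj, smul_zero]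

/-- Two nonzero subspaces invariant under `c` intersect, if `c` is nilpotent and its kernel is that
of the Jordan block. -/
theorem eq_bot_or_eq_bot_of_ker_le {n : ℕ} {c : Module.End ℂ (Fin n → ℂ)} (hc : IsNilpotent c)
    (hker : ∀ w, c w = 0 → Matrix.toLin' (jordanBlock ℂ n) w = 0)
    {W₁ W₂ : Submodule ℂ (Fin n → ℂ)} (h₁ : ∀ w ∈ W₁, c w ∈ W₁) (h₂ : ∀ w ∈ W₂, c w ∈ W₂)
    (hW : Disjoint W₁ W₂) : W₁ = ⊥ ∨ W₂ = ⊥ := by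
  have key : ∀ W : Submodule ℂ (Fin n → ℂ), (∀ w ∈ W, c w ∈ W) → W ≠ ⊥ →
      ∃ w ∈ W, w ≠ 0 ∧ c w = 0 := by
    intro W hcW hne
    obtain ⟨w, hw, hw0⟩ := W.ne_bot_iff.1 hne
    have hpow : ∀ k, (c ^ k) w ∈ W := by
      intro k
      induction k with
      | zero => simpa using hw
      | succ k ih => rw [pow_succ', Module.End.mul_apply]; exact hcW _ ih
    have hex : ∃ k, (c ^ k) w = 0 := hc.imp fun k hk => by rw [hk, LinearMap.zero_apply]
    classical
    have hfind := Nat.find_spec hex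
    have hpos : Nat.find hex ≠ 0 := fun h0 => hw0 (by rw [h0] at hfind; simpa using hfind)
    obtain ⟨k, hk⟩ := Nat.exists_eq_succ_of_ne_zero hpos
    refine ⟨(c ^ k) w, hpow k, Nat.find_min hex (by omega), ?_⟩
    rw [← Module.End.mul_apply, ← pow_succ', ← Nat.succ_eq_add_one, ← hk]
    exact hfind
  by_contra! h
  obtain ⟨v, hv, hv0, hcv⟩ := key W₁ h₁ h.1
  obtain ⟨w, hw, hw0, hcw⟩ := key W₂ h₂ h.2
  obtain ⟨a, rfl⟩ := exists_smul_of_jordanBlock_eq_zero (hker v hcv) (hker w hcw) hv0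
  exact hw0 (Submodule.disjoint_def.1 hW _ (W₁.smul_mem a hv) hw)

end CyclicNilpotent

/-- A nilpotent element of an algebra is the image of one of a commutative algebra. -/
theorem exists_commutative_lift_of_pow_eq_zero {A : Type*} [Ring A] [Algebra ℂ A] {J : A} {n : ℕ}
    (hJ : J ^ n = 0) :
    ∃ (R : Type) (_ : CommRing R) (_ : Algebra ℂ R) (ρ : R →ₐ[ℂ] A) (N : R),
      N ^ n = 0 ∧ ρ N = J := by
  have hI : ∀ a ∈ Ideal.span {(X : ℂ[X]) ^ n}, aeval J a = 0 := by
    intro a ha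
    obtain ⟨b, rfl⟩ := Ideal.mem_span_singleton'.1 ha
    rw [map_mul, map_pow, aeval_X, hJ, mul_zero]
  refine ⟨ℂ[X] ⧸ Ideal.span {(X : ℂ[X]) ^ n}, inferInstance, inferInstance,
    Ideal.Quotient.liftₐ _ (aeval J) hI, Ideal.Quotient.mk _ X, ?_, ?_⟩
  · rw [← map_pow, Ideal.Quotient.eq_zero_iff_mem]
    exact Ideal.mem_span_singleton_self _
  · exact aeval_X J

/-! ### Modules attached to nilpotent elements -/

theorem sum_smul_pow_eq_of_pow_eq_zero {R : Type*} [CommRing R] [Algebra ℂ R] {N : R} {n : ℕ}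
    (hN : N ^ n = 0) (a : ℕ → ℂ) (h0 : a 0 = 0) :
    ∑ i ∈ Finset.range n, a i • N ^ i =
      N * (algebraMap ℂ R (a 1) + N * ∑ i ∈ Finset.range n, a (i + 2) • N ^ i) := by
  have h1 : ∑ i ∈ Finset.range n, a i • N ^ i = ∑ i ∈ Finset.range (n + 2), a i • N ^ i := by
    rw [Finset.sum_range_succ, Finset.sum_range_succ, pow_succ, hN, zero_mul, smul_zero, smul_zero,
      add_zero, add_zero]
  have h2 : ∑ i ∈ Finset.range n, a (i + 2) • N ^ (i + 2) =
      N * N * ∑ i ∈ Finset.range n, a (i + 2) • N ^ i := by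
    rw [Finset.mul_sum]
    refine Finset.sum_congr rfl fun i _ => ?_
    rw [mul_smul_comm]
    ring_nf
  rw [h1, Finset.sum_range_succ', Finset.sum_range_succ', h0, zero_smul, add_zero]
  simp only [add_assoc, Nat.reduceAdd]
  rw [h2, Algebra.smul_def]
  ring

namespace HahnSeries

/-- The coefficient of `x^(-1/p-1)` generates the same ideal as `N`. -/
theorem exists_isUnit_coeff_twistSolution {R : Type*} [CommRing R] [Algebra ℂ R] {p : ℕ}
    (hp : 0 < p) {a : ℂ} {β F E H : HahnSeries ℚ ℂ} (h : IsFundamental p a β F E H) {n : ℕ} {κ : ℂ}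
    (hκ : κ ≠ 0) {N : R} (hN : N ^ n = 0) :
    ∃ u : R, IsUnit u ∧ (twistSolution p n κ β F N).coeff (-1 / p - 1) = N * u := by
  have hp' : (p : ℚ) ≠ 0 := by exact_mod_cast hp.ne'
  have hβ : β ≠ 0 := fun h0 => one_ne_zero
    (h.pow_mul.symm.trans (by rw [h0, zero_pow hp.ne', zero_mul]))
  have hF : F ≠ 0 := fun h0 => h.ne_zero (h.mul_eq.symm.trans (by rw [h0, mul_zero]))
  have hrw : ∀ i : ℕ, (C κ * β * (C ((Ring.choose (-1 / p : ℚ) i : ℚ) : ℂ) * F ^ i)).coeff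
      (-1 / p - 1) = κ * ((Ring.choose (-1 / p : ℚ) i : ℚ) : ℂ) *
        (β * F ^ i).coeff (-1 / p - 1) := by
    intro i
    rw [mul_mul_mul_comm, ← map_mul, C_mul_eq_smul, HahnSeries.coeff_smul, smul_eq_mul]
  have hord : (β * F).order = -1 / p - 1 := by
    rw [order_mul hβ hF, h.order_β hp, h.order_F]
    ring
  have h1 : (C κ * β * (C ((Ring.choose (-1 / p : ℚ) 1 : ℚ) : ℂ) * F ^ 1)).coeff (-1 / p - 1) ≠
      0 := by
    rw [hrw, pow_one, Ring.choose_one_right, ← hord]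
    refine mul_ne_zero (mul_ne_zero hκ ?_) (coeff_order_eq_zero.not.2 (mul_ne_zero hβ hF))
    push_cast
    exact div_ne_zero (by norm_num) (by exact_mod_cast hp.ne')
  refine ⟨_, ?_, (coeff_twistSolution p n κ β F N _).trans
    (sum_smul_pow_eq_of_pow_eq_zero hN (fun i => (C κ * β * (C ((Ring.choose (-1 / p : ℚ) i : ℚ) :
      ℂ) * F ^ i)).coeff (-1 / p - 1)) ?_)⟩
  · rw [add_comm]
    exact (Commute.isNilpotent_mul_right (Commute.all _ _) ⟨n, hN⟩).isUnit_add_right_of_commute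
      ((IsUnit.mk0 _ h1).map (algebraMap ℂ R)) (Commute.all _ _)
  · rw [hrw, pow_zero, mul_one, coeff_eq_zero_of_lt_order, mul_zero]
    rw [h.order_β hp]
    linarith

end HahnSeries

namespace TwistedModule

open HahnSeries

variable {g : ℂ[X] ≃ₐ[ℂ] ℂ[X]} {ξ : ℂ} {p : ℕ} {f : ℂ[X]}

section Intertwine

variable {M : Type*} [AddCommGroup M] [Module ℂ M] [FiniteDimensional ℂ M]
  {M' : Type*} [AddCommGroup M'] [Module ℂ M'] [FiniteDimensional ℂ M']
  {Y : TwistedModule (f • derivative' : Derivation ℂ ℂ[X] ℂ[X]).vertexAlgebra g.toLinearEquiv p ξ M}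
  {Z : TwistedModule (f • derivative' : Derivation ℂ ℂ[X] ℂ[X]).vertexAlgebra g.toLinearEquiv p ξ
    M'}

/-- A linear bijection that intertwines `Y(t, x)` is an isomorphism. -/
theorem mode_conj_of_mode_X (hξ : g X = Polynomial.C ξ * X) (hprim : IsPrimitiveRoot ξ p)
    (hp : 1 < p) (φ : M ≃ₗ[ℂ] M') (hφ : ∀ i w, φ (Y.mode X i w) = Z.mode X i (φ w)) (v : ℂ[X])
    (i : ℚ) (w : M) : φ (Y.mode v i w) = Z.mode v i (φ w) := by
  have hp0 : 0 < p := by omega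
  have hs : mapAlgHom (φ.conjAlgEquiv ℂ : Module.End ℂ M →ₐ[ℂ] Module.End ℂ M') (Y.series hp0 X) =
      Z.series hp0 X := by
    ext e w
    rw [mapAlgHom_coeff, series_coeff, series_coeff]
    change φ (Y.mode X (-e - 1) (φ.symm w)) = _
    rw [hφ, LinearEquiv.apply_symm_apply]
  have h := congrArg (fun T => (aeval T v).coeff (-i - 1) (φ w)) hs
  simp only [← mapAlgHom_aeval, ← series_eq_aeval _ hξ hprim hp hp0, mapAlgHom_coeff] at h
  rw [← mode_eq_series_coeff, ← mode_eq_series_coeff] at h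
  rw [← h]
  change _ = φ (Y.mode v i (φ.symm (φ w)))
  rw [LinearEquiv.symm_apply_apply]

/-- Stability under the coefficients of `Y(t, x)` suffices for a submodule. -/
theorem isStable_of_mode_X (hξ : g X = Polynomial.C ξ * X) (hprim : IsPrimitiveRoot ξ p)
    (hp : 1 < p) {W : Submodule ℂ M} (hW : ∀ i, ∀ w ∈ W, Y.mode X i w ∈ W) : Y.IsStable W := by
  have hp0 : 0 < p := by omega
  have hpow : ∀ (k : ℕ) (e : ℚ), ∀ w ∈ W, (Y.series hp0 X ^ k).coeff e w ∈ W := by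
    intro k
    induction k with
    | zero =>
      intro e w hw
      rw [pow_zero, HahnSeries.coeff_one]
      split_ifs
      · exact hw
      · exact W.zero_mem
    | succ k ih =>
      intro e w hw
      rw [pow_succ, HahnSeries.coeff_mul, LinearMap.sum_apply]
      exact W.sum_mem fun ij _ => ih _ _ (hW _ _ hw)
  intro v i w hw
  rw [Y.mode_eq_series_coeff hp0, Y.series_eq_aeval hξ hprim hp, coeff_aeval, LinearMap.sum_apply]
  exact W.sum_mem fun k _ => W.smul_mem _ (hpow k _ w hw)

end Intertwine

/-- A twisted module is determined by `Y(t, x)`. -/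
theorem eq_of_mode_X {M : Type*} [AddCommGroup M] [Module ℂ M] [FiniteDimensional ℂ M]
    {Y Z : TwistedModule (f • derivative' : Derivation ℂ ℂ[X] ℂ[X]).vertexAlgebra g.toLinearEquiv
      p ξ M} (hξ : g X = Polynomial.C ξ * X) (hprim : IsPrimitiveRoot ξ p) (hp : 1 < p)
    (h : Y.mode X = Z.mode X) : Y = Z := by
  have h1 : Y.mode = Z.mode := by
    refine LinearMap.ext fun v => funext fun i => LinearMap.ext fun w => ?_
    exact mode_conj_of_mode_X hξ hprim hp (LinearEquiv.refl ℂ M) (fun i w => by rw [h]; rfl) v i w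
  cases Y
  cases Z
  cases h1
  rfl

theorem HasSeries.mode_X_eq {n : ℕ} {Y Z : TwistedModule
    (f • derivative' : Derivation ℂ ℂ[X] ℂ[X]).vertexAlgebra g.toLinearEquiv p ξ (Fin n → ℂ)}
    {T : Matrix (Fin n) (Fin n) (HahnSeries ℚ ℂ)} (hY : Y.HasSeries X T) (hZ : Z.HasSeries X T) :
    Y.mode X = Z.mode X := by
  funext i
  have h := (hY (-i - 1)).trans (hZ (-i - 1)).symm
  rwa [coeff, coeff, show -(-i - 1) - 1 = i by ring] at h

/-- A nilpotent element of a commutative algebra acting on `M` defines a twisted module. -/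
theorem exists_of_pow_eq_zero {R : Type*} [CommRing R] [Algebra ℂ R] {M : Type*} [AddCommGroup M]
    [Module ℂ M] (ρ : R →ₐ[ℂ] Module.End ℂ M) (hξ : g X = Polynomial.C ξ * X)
    (hprim : IsPrimitiveRoot ξ p) (hp : 0 < p) {c₁ c : ℂ}
    (hf : f = Polynomial.C c₁ * X + Polynomial.C c * X ^ (p + 1)) {β F E H : HahnSeries ℚ ℂ}
    (h : IsFundamental p (-c₁ * p) β F E H) {n : ℕ} {κ : ℂ} (hκ : κ ^ p * (-p * c) = 1) {N : R}
    (hN : N ^ n = 0) :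
    ∃ Y : TwistedModule (f • derivative' : Derivation ℂ ℂ[X] ℂ[X]).vertexAlgebra g.toLinearEquiv
      p ξ M, (∀ i, Y.mode X i = ρ ((twistSolution p n κ β F N).coeff (-i - 1))) ∧
        (Nontrivial M → Y.mode X ≠ 0) := by
  refine ⟨ofSolution ρ hp hξ hprim _ (twistSolution_supportedIn h hp n κ N)
    (hf ▸ euler_twistSolution h hp hκ hN), fun i => ?_, fun hM h0 => ?_⟩
  · rw [ofSolution_mode, aeval_X]
  · have hS : HahnSeries.mapAlgHom ρ (twistSolution p n κ β F N) = 0 := by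
      ext1
      funext e
      have h1 := congrFun h0 (-e - 1)
      rw [ofSolution_mode, aeval_X, show -(-e - 1) - 1 = e by ring] at h1
      exact h1
    have h2 := congrArg (HahnSeries.mapAlgHom ρ) (twistSolution_pow_mul h hp hκ hN)
    rw [map_mul, map_pow, hS, zero_pow hp.ne', zero_mul, map_one] at h2
    exact zero_ne_one h2

/-- The twisted module on `ℂ^n` defined by the Jordan block. -/
theorem exists_jordan (hξ : g X = Polynomial.C ξ * X) (hprim : IsPrimitiveRoot ξ p) (hp : 0 < p)
    {c₁ c : ℂ} (hf : f = Polynomial.C c₁ * X + Polynomial.C c * X ^ (p + 1)) {n : ℕ} (hn : 0 < n)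
    {κ : ℂ} (hκ : κ ^ p * (-p * c) = 1) :
    ∃ Y : TwistedModule (f • derivative' : Derivation ℂ ℂ[X] ℂ[X]).vertexAlgebra g.toLinearEquiv
      p ξ (Fin n → ℂ), Y.HasSeries X (twistSeries p c₁ κ n) ∧ Y.Indecomposable ∧ Y.mode X ≠ 0 := by
  obtain ⟨β, F, E, H, h, hseries⟩ := exists_isFundamental hp c₁
  obtain ⟨R, _, _, ρ, N, hN, hρN⟩ :=
    exists_commutative_lift_of_pow_eq_zero (toLin'_jordanBlock_pow_eq_zero n)
  obtain ⟨Y, hY, hY0⟩ := exists_of_pow_eq_zero ρ hξ hprim hp hf h hκ hN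
  have : NeZero n := ⟨hn.ne'⟩
  have hκ0 : κ ≠ 0 := fun h0 => zero_ne_one (by rw [← hκ, h0, zero_pow hp.ne', zero_mul])
  refine ⟨Y, fun e => ?_, ⟨inferInstance, fun W₁ W₂ h₁ h₂ hW => ?_⟩, hY0 inferInstance⟩
  · rw [coeff, hY, show -(-e - 1) - 1 = e by ring, hseries, toLin'_coeff_smul_unipotentPow,
      coeff_twistSolution, map_sum]
    refine Finset.sum_congr rfl fun i _ => ?_
    rw [map_smul, map_pow, hρN]
  · obtain ⟨u, hu, hcu⟩ := exists_isUnit_coeff_twistSolution hp h hκ0 hN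
    have hc : Y.mode X (1 / p) = ρ (N * u) := by
      rw [hY, ← hcu]
      congr 2
      ring
    refine eq_bot_or_eq_bot_of_ker_le (c := Y.mode X (1 / p)) ?_ ?_ (h₁ X _) (h₂ X _) hW.disjoint
    · refine ⟨n, ?_⟩
      rw [hc, ← map_pow, mul_pow, hN, zero_mul, map_zero]
    · intro w hw
      obtain ⟨u', hu'⟩ := hu.exists_left_inv
      rw [← hρN, show N = u' * (N * u) by linear_combination -N * hu', map_mul, ← hc,
        Module.End.mul_apply, hw, map_zero]

end TwistedModule

/-! ### Classification of the indecomposable modules -/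

theorem Polynomial.InClass.classPart_eq {p m : ℕ} {f : ℂ[X]} (hf : f.InClass p m) :
    classPart p m f = f := by
  ext k
  rw [coeff_classPart]
  split_ifs with h
  · rfl
  · by_contra h0
    exact h (hf k (Ne.symm h0))

theorem Polynomial.inClass_bernoulli (p : ℕ) (c₁ c : ℂ) :
    (C c₁ * X + C c * X ^ (p + 1)).InClass p 1 := by
  intro k hk
  rw [coeff_add, coeff_C_mul_X, coeff_C_mul_X_pow] at hk
  by_cases h1 : k = 1
  · rw [h1]
  · by_cases h2 : k = p + 1
    · rw [h2, Nat.ModEq, Nat.add_mod_left]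
    · rw [if_neg h1, if_neg h2, add_zero] at hk
      exact absurd rfl hk

/-- Roots of unity do not deform. -/
theorem eq_of_pow_eq_of_isNilpotent_sub {A : Type*} [CommRing A] [Algebra ℂ A] {p : ℕ} (hp : 0 < p)
    {u z : A} (hu : u ^ p = 1) (hz : z ^ p = 1) (h : IsNilpotent (z - u)) : u = z := by
  have hev : ∀ y : A, y ^ p = 1 → aeval y (X ^ p - 1 : ℂ[X]) = 0 := by
    intro y hy
    rw [map_sub, map_pow, aeval_X, map_one, hy, sub_self]
  have hder : IsUnit (aeval z (derivative (X ^ p - 1 : ℂ[X]))) := by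
    rw [derivative_sub, derivative_X_pow, derivative_one, sub_zero, map_mul, aeval_C, map_pow,
      aeval_X]
    exact ((IsUnit.mk0 (p : ℂ) (by exact_mod_cast hp.ne')).map (algebraMap ℂ A)).mul
      ((IsUnit.of_pow_eq_one hz hp.ne').pow _)
  obtain ⟨r, -, hr⟩ := existsUnique_nilpotent_sub_and_aeval_eq_zero
    (x := z) (P := (X ^ p - 1 : ℂ[X])) (by rw [hev z hz]; exact IsNilpotent.zero) hder
  rw [hr u ⟨h, hev u hu⟩, hr z ⟨by rw [sub_self]; exact IsNilpotent.zero, hev z hz⟩]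

namespace HahnSeries

variable {R : Type*} [CommRing R] [Algebra ℂ R]

theorem isNilpotent_of_mapAlgHom_eq_zero [IsNoetherianRing R] {χ : R →ₐ[ℂ] ℂ}
    (hχ : ∀ r, χ r = 0 → IsNilpotent r) {Q : HahnSeries ℚ R} (hQ : mapAlgHom χ Q = 0) :
    IsNilpotent Q :=
  isNilpotent_of_coeff fun e => hχ _ (congrArg (fun h : HahnSeries ℚ ℂ => h.coeff e) hQ)

/-- A solution of `Δ' = a Δ` is determined by its constant term. -/
theorem eq_zero_of_euler_eq_of_coeff_zero {a : ℂ} {Δ : HahnSeries ℚ R}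
    (h : euler Δ = single 1 1 * (algebraMap ℂ _ a * Δ)) (h0 : Δ.coeff 0 = 0) : Δ = 0 := by
  by_contra hne
  have h1 := congrArg (fun t : HahnSeries ℚ R => t.coeff Δ.order) h
  simp only [euler_coeff] at h1
  rw [coeff_single_mul, one_mul, ← Algebra.smul_def, coeff_smul_complex,
    coeff_eq_zero_of_lt_order (sub_one_lt _), smul_zero] at h1
  rcases smul_eq_zero.1 h1 with h2 | h2
  · rw [Rat.cast_eq_zero] at h2
    exact hne (coeff_order_eq_zero.1 (by rw [h2]; exact h0))
  · exact hne (coeff_order_eq_zero.1 h2)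

theorem twistSolution_mul (p n : ℕ) (κ z : ℂ) (β F : HahnSeries ℚ ℂ) (N : R) :
    algebraMap ℂ _ z * twistSolution p n κ β F N = twistSolution p n (κ * z) β F N := by
  have h : mapAlgHom (Algebra.ofId ℂ R) (C z) = algebraMap ℂ (HahnSeries ℚ R) z :=
    (mapAlgHom (Algebra.ofId ℂ R)).commutes _
  simp only [twistSolution, map_mul, h]
  ring

/-- Over a local algebra with residue field `ℂ`, the solutions of the Bernoulli equation are the
explicit ones. The inverse `p`-th power `V` of a solution `T` satisfies a linear equation, hence is
determined by its constant term, which yields `N`; the `p`-th root is unique up to a root of unity,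
since this holds over `ℂ` and roots of unity do not deform. -/
theorem exists_eq_twistSolution [IsNoetherianRing R] {χ : R →ₐ[ℂ] ℂ}
    (hχ : ∀ r, χ r = 0 → IsNilpotent r) {p : ℕ} (hp : 1 < p) {c₁ c : ℂ} (hc : c ≠ 0)
    {β F E H : HahnSeries ℚ ℂ} (h : IsFundamental p (-c₁ * p) β F E H) {γ : ℂ}
    (hγ : γ ^ p * (-p * c) = 1) {ζ : ℂ} (hζ : IsPrimitiveRoot ζ p)
    {n : ℕ} (hn : ∀ r : R, IsNilpotent r → r ^ n = 0)
    {T : HahnSeries ℚ R} (hT0 : T ≠ 0) (hsupp : T.SupportedIn (-1 / p))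
    (hT : euler T = single 1 1 * aeval T (Polynomial.C c₁ * X + Polynomial.C c * X ^ (p + 1))) :
    ∃ N : R, IsNilpotent N ∧ ∃ l < p, T = twistSolution p n (γ * ζ ^ l) β F N := by
  have hp0 : 0 < p := by omega
  have hpC : (p : ℂ) ≠ 0 := by exact_mod_cast hp0.ne'
  set ι := mapAlgHom (Algebra.ofId ℂ R) with hι
  set s := mapAlgHom χ T with hs
  have hχι : ∀ h : HahnSeries ℚ ℂ, mapAlgHom χ (ι h) = h := fun h => by
    ext e; exact χ.commutes _
  have hnil : ∀ Q : HahnSeries ℚ R, IsNilpotent (Q - ι (mapAlgHom χ Q)) := fun Q =>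
    isNilpotent_of_mapAlgHom_eq_zero hχ (by rw [map_sub, hχι, sub_self])
  have hs0 : s ≠ 0 := by
    intro h0
    refine hT0 (eq_zero_of_euler_eq hp hsupp (inClass_bernoulli p c₁ c) hT fun e => hχ _ ?_)
    exact congrArg (fun h : HahnSeries ℚ ℂ => h.coeff e) h0
  have hTunit : IsUnit T := by
    have := (hnil T).isUnit_add_right_of_commute ((IsUnit.mk0 s hs0).map ι) (Commute.all _ _)
    rwa [sub_add_cancel] at this
  obtain ⟨V, hTV⟩ := (hTunit.pow p).exists_right_inv
  have hV := euler_eq_of_bernoulli hp0 hTV hT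
  -- The constant term of `V` determines `N`, and it is nilpotent because `χ(V)` has order `1`.
  have hV0 : χ (V.coeff 0) = 0 := by
    have hsV : s ^ p * mapAlgHom χ V = 1 := by rw [hs, ← map_pow, ← map_mul, hTV, map_one]
    have hord := (order_and_form_of_euler_eq hp hs0 (supportedIn_mapAlgHom χ hsupp)
      (inClass_bernoulli p c₁ c) (mapAlgHom_euler_eq χ hT)).1
    have hsp : s ^ p ≠ 0 := pow_ne_zero _ hs0
    have hχV : mapAlgHom χ V ≠ 0 := fun h0 => one_ne_zero (hsV.symm.trans (by rw [h0, mul_zero]))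
    have h1 := congrArg order hsV
    rw [order_mul hsp hχV, order_pow, hord, order_one, nsmul_eq_mul] at h1
    have hp' : (p : ℚ) ≠ 0 := by exact_mod_cast hp0.ne'
    field_simp at h1
    exact coeff_eq_zero_of_lt_order (x := mapAlgHom χ V) (by linarith)
  have hδ : -(p : ℂ) * c ≠ 0 := mul_ne_zero (neg_ne_zero.2 hpC) hc
  have hH0 : H.coeff 0 ≠ 0 := by
    have := coeff_order_eq_zero.not.2 h.ne_zero
    rwa [h.order_H] at this
  have hE0 : E.coeff 0 = 0 := coeff_eq_zero_of_lt_order (by rw [h.order_E]; norm_num)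
  set N : R := ((-(p : ℂ) * c) * H.coeff 0)⁻¹ • V.coeff 0 with hN
  have hNnil : IsNilpotent N := hχ _ (by rw [hN, map_smul, hV0, smul_zero])
  have hVeq : V = algebraMap ℂ _ (-(p : ℂ) * c) * (ι E + ι H * C N) := by
    rw [← sub_eq_zero]
    refine eq_zero_of_euler_eq_of_coeff_zero (a := -c₁ * p) ?_ ?_
    · rw [euler_sub, hV, euler_fundamental h]
      ring
    · rw [HahnSeries.coeff_sub, ← Algebra.smul_def, coeff_smul_complex, HahnSeries.coeff_add,
        hι, coeff_mapAlgHom_mul_C, mapAlgHom_coeff, hE0, map_zero, zero_add, hN, smul_smul,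
        smul_smul, mul_inv_cancel₀ (mul_ne_zero hδ hH0), one_smul, sub_self]
  have hSV := twistSolution_pow_mul h hp0 hγ (hn N hNnil)
  rw [← hι, ← hVeq] at hSV
  set S := twistSolution p n γ β F N
  obtain ⟨q, rfl⟩ : ∃ q, p = q + 1 := ⟨p - 1, by omega⟩
  -- `w = T / S` is a `p`-th root of unity.
  set w := T * S ^ q * V with hw
  have hwS : w * S = T := by linear_combination T * hSV
  have hwp : w ^ (q + 1) = 1 := by
    calc w ^ (q + 1) = (T ^ (q + 1) * V) * (S ^ (q + 1) * V) ^ q := by rw [hw]; ring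
      _ = 1 := by rw [hTV, hSV]; simp
  have hχw : mapAlgHom χ w ^ (q + 1) = 1 := by rw [← map_pow, hwp, map_one]
  have hζ' : IsPrimitiveRoot (C ζ : HahnSeries ℚ ℂ) (q + 1) := hζ.map_of_injective C_injective
  obtain ⟨l, hl, hlw⟩ := hζ'.eq_pow_of_pow_eq_one hχw
  have hιζ : ι (mapAlgHom χ w) = algebraMap ℂ _ (ζ ^ l) := by
    rw [← hlw, ← map_pow]
    exact ι.commutes _
  have hz : (algebraMap ℂ (HahnSeries ℚ R) (ζ ^ l)) ^ (q + 1) = 1 := by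
    rw [← map_pow, ← pow_mul, mul_comm, pow_mul, hζ.pow_eq_one, one_pow, map_one]
  have hweq : w = algebraMap ℂ _ (ζ ^ l) := by
    refine eq_of_pow_eq_of_isNilpotent_sub hp0 hwp hz ?_
    rw [← neg_sub, isNilpotent_neg_iff, ← hιζ]
    exact hnil w
  exact ⟨N, hNnil, l, hl, by rw [← twistSolution_mul, ← hweq, hwS]⟩

end HahnSeries

namespace TwistedModule

open HahnSeries

variable {g : ℂ[X] ≃ₐ[ℂ] ℂ[X]} {ξ : ℂ} {p : ℕ} {f : ℂ[X]} {M : Type u} [AddCommGroup M] [Module ℂ M]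
  [FiniteDimensional ℂ M]
  {Y : TwistedModule (f • derivative' : Derivation ℂ ℂ[X] ℂ[X]).vertexAlgebra g.toLinearEquiv p ξ M}

/-- The coefficient algebra of an indecomposable module is local with residue field `ℂ`, by
Fitting's lemma. -/
theorem Indecomposable.exists_character (hY : Y.Indecomposable) (hξ : g X = Polynomial.C ξ * X)
    (hprim : IsPrimitiveRoot ξ p) (hp : 1 < p) {R : Type*} [CommRing R] [Algebra ℂ R]
    [FiniteDimensional ℂ R] {ρ : R →ₐ[ℂ] Module.End ℂ M} (hρ : Function.Injective ρ)
    (hmode : ∀ i, Y.mode X i ∈ ρ.range) :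
    ∃ χ : R →ₐ[ℂ] ℂ, ∀ r, χ r = 0 → IsNilpotent r := by
  obtain ⟨hM, hdec⟩ := hY
  have hR : Nontrivial R := by
    refine ⟨1, 0, fun h => ?_⟩
    have h1 := congrArg ρ h
    rw [map_one, map_zero] at h1
    exact one_ne_zero h1
  have key : ∀ r : R, ∃ μ : ℂ, IsNilpotent (r - algebraMap ℂ R μ) := by
    intro r
    obtain ⟨μ, hμ⟩ := Module.End.exists_eigenvalue (ρ r)
    obtain ⟨v, hv, hv0⟩ := hμ.exists_hasEigenvector
    rw [Module.End.mem_eigenspace_iff] at hv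
    set d := r - algebraMap ℂ R μ
    have hdv : ρ d v = 0 := by
      rw [map_sub, AlgHom.commutes, LinearMap.sub_apply, hv, Module.algebraMap_end_apply, sub_self]
    obtain ⟨k, hk, hk0⟩ := ((LinearMap.eventually_isCompl_ker_pow_range_pow (ρ d)).and
      (Filter.eventually_gt_atTop 0)).exists
    have hcomm : ∀ i w, ((ρ d) ^ k) (Y.mode X i w) = Y.mode X i (((ρ d) ^ k) w) := by
      intro i w
      obtain ⟨t, ht⟩ := hmode i
      change ρ t = _ at ht
      rw [← ht, ← map_pow, ← Module.End.mul_apply, ← Module.End.mul_apply, ← map_mul, ← map_mul,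
        mul_comm]
    have h1 : Y.IsStable (LinearMap.ker ((ρ d) ^ k)) := by
      refine isStable_of_mode_X hξ hprim hp fun i w hw => ?_
      rw [LinearMap.mem_ker] at hw ⊢
      rw [hcomm, hw, map_zero]
    have h2 : Y.IsStable (LinearMap.range ((ρ d) ^ k)) := by
      refine isStable_of_mode_X hξ hprim hp ?_
      rintro i _ ⟨w, rfl⟩
      exact ⟨Y.mode X i w, hcomm i w⟩
    refine ⟨μ, k, hρ ?_⟩
    rw [map_pow, map_zero]
    refine LinearMap.range_eq_bot.1 ((hdec _ _ h1 h2 hk).resolve_left fun h0 => hv0 ?_)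
    rw [← Submodule.mem_bot ℂ, ← h0, LinearMap.mem_ker]
    obtain ⟨j, rfl⟩ := Nat.exists_eq_succ_of_ne_zero hk0.ne'
    rw [Nat.succ_eq_add_one, pow_succ, Module.End.mul_apply, hdv, map_zero]
  obtain ⟨χ, -⟩ := exists_character_of_not_isNilpotent (R := R) (c := 1)
    (IsUnit.not_isNilpotent isUnit_one)
  refine ⟨χ, fun r hr => ?_⟩
  obtain ⟨μ, hμ⟩ := key r
  have h1 := (hμ.map χ).eq_zero
  rw [map_sub, hr, AlgHom.commutes, zero_sub, neg_eq_zero] at h1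
  have h2 : μ = 0 := h1
  rwa [h2, map_zero, sub_zero] at hμ

/-- Up to a linear bijection, `Y(t, x)` of an indecomposable module is one of the explicit
matrix series. -/
theorem Indecomposable.exists_coeff_conj (hY : Y.Indecomposable) (hξ : g X = Polynomial.C ξ * X)
    (hprim : IsPrimitiveRoot ξ p) (hp : 1 < p) {c₁ c : ℂ} (hc : c ≠ 0)
    (hf : f = Polynomial.C c₁ * X + Polynomial.C c * X ^ (p + 1)) {γ : ℂ}
    (hγ : γ ^ p * (-p * c) = 1) {ζ : ℂ} (hζ : IsPrimitiveRoot ζ p) (hY0 : Y.mode X ≠ 0) {n : ℕ}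
    (hn : Module.finrank ℂ M = n) :
    ∃ l < p, ∃ φ : M ≃ₗ[ℂ] (Fin n → ℂ), ∀ e w, φ (Y.coeff X e w) =
      Matrix.toLin' ((twistSeries p c₁ (γ * ζ ^ l) n).map fun h => h.coeff e) (φ w) := by
  have hp0 : 0 < p := by omega
  obtain ⟨R, _, _, _, ρ, T, hρ, hT, hsupp, hode⟩ := Y.exists_model hξ hprim hp hp0
  rw [hf, (inClass_bernoulli p c₁ c).classPart_eq] at hode
  have hnoeth : IsNoetherianRing R := isNoetherian_of_tower ℂ inferInstance
  have hmode : ∀ i, Y.mode X i = ρ (T.coeff (-i - 1)) := fun i => by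
    rw [Y.mode_eq_series_coeff hp0, ← hT, mapAlgHom_coeff]
  have hT0 : T ≠ 0 := by
    rintro rfl
    refine hY0 (funext fun i => ?_)
    rw [hmode, HahnSeries.coeff_zero, map_zero]
    rfl
  obtain ⟨χ, hχ⟩ := hY.exists_character hξ hprim hp hρ fun i => ⟨_, (hmode i).symm⟩
  obtain ⟨β, F, E, H, h, hseries⟩ := exists_isFundamental hp0 c₁
  -- Cayley-Hamilton: nilpotent operators on an `n`-dimensional space have vanishing `n`-th power.
  have hpow : ∀ r : R, IsNilpotent r → r ^ n = 0 := by
    intro r hr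
    refine hρ ?_
    have h1 := IsNilpotent.charpoly_eq_X_pow_finrank (hr.map ρ)
    have h2 := LinearMap.aeval_self_charpoly (ρ r)
    rw [h1, map_pow, aeval_X, hn] at h2
    rw [map_pow, h2, map_zero]
  obtain ⟨N, hN, l, hl, hTN⟩ := exists_eq_twistSolution hχ hp hc h hγ hζ hpow hT0 hsupp hode
  have hcoeff : ∀ e, Y.coeff X e = ∑ i ∈ Finset.range n, (HahnSeries.C (γ * ζ ^ l) * β *
      (HahnSeries.C ((Ring.choose (-1 / p : ℚ) i : ℚ) : ℂ) * F ^ i)).coeff e • ρ N ^ i := by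
    intro e
    rw [coeff, hmode, show -(-e - 1) - 1 = e by ring, hTN, coeff_twistSolution, map_sum]
    exact Finset.sum_congr rfl fun i _ => by rw [map_smul, map_pow]
  obtain ⟨hM, hdec⟩ := hY
  have hstable : ∀ W : Submodule ℂ M, (∀ w ∈ W, ρ N w ∈ W) → Y.IsStable W := by
    intro W hW
    refine isStable_of_mode_X hξ hprim hp fun i w hw => ?_
    have h1 := hcoeff (-i - 1)
    rw [coeff, show -(-i - 1) - 1 = i by ring] at h1
    rw [h1, LinearMap.sum_apply]
    refine W.sum_mem fun j hj => W.smul_mem _ ?_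
    clear hj
    induction j with
    | zero => exact hw
    | succ j ih => rw [pow_succ', Module.End.mul_apply]; exact hW _ ih
  obtain ⟨φ, hφ⟩ := exists_equiv_jordanBlock (hN.map ρ)
    (fun W₁ W₂ h₁ h₂ hW => hdec W₁ W₂ (hstable W₁ h₁) (hstable W₂ h₂) hW) hn
  have hφpow : ∀ i w, φ ((ρ N ^ i) w) = (Matrix.toLin' (jordanBlock ℂ n) ^ i) (φ w) := by
    intro i
    induction i with
    | zero => intro w; rfl
    | succ i ih => intro w; rw [pow_succ, pow_succ, Module.End.mul_apply, ih, hφ]; rfl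
  refine ⟨l, hl, φ, fun e w => ?_⟩
  rw [hseries, toLin'_coeff_smul_unipotentPow, hcoeff, LinearMap.sum_apply, LinearMap.sum_apply,
    map_sum]
  refine Finset.sum_congr rfl fun i _ => ?_
  rw [LinearMap.smul_apply, LinearMap.smul_apply, map_smul, hφpow]

end TwistedModule

theorem theorem3p4 (p : ℕ) (hp : 1 < p)
    (g : ℂ[X] ≃ₐ[ℂ] ℂ[X]) (hg : orderOf g = p)
    (ξ : ℂ) (hξ : g X = C ξ * X)
    (ζ : ℂ) (hζ : IsPrimitiveRoot ζ p)
    (f : ℂ[X]) :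
    ((∃ (M : Type u) (_ : AddCommGroup M) (_ : Module ℂ M) (_ : FiniteDimensional ℂ M)
        (Y : TwistedModule (f • derivative' : Derivation ℂ ℂ[X] ℂ[X]).vertexAlgebra
          g.toLinearEquiv p ξ M), Y.mode X ≠ 0) ↔
      ∃ c₁ c : ℂ, c ≠ 0 ∧ f = C c₁ * X + C c * X ^ (p + 1)) ∧
    ∀ c₁ c : ℂ, c ≠ 0 → f = C c₁ * X + C c * X ^ (p + 1) →
      ∀ γ : ℂ, γ ^ p = (-(p : ℂ) * c)⁻¹ →
      ∀ n : ℕ, 0 < n →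
        ∃ N : Fin p → TwistedModule (f • derivative' : Derivation ℂ ℂ[X] ℂ[X]).vertexAlgebra
            g.toLinearEquiv p ξ (Fin n → ℂ),
          (∀ l : Fin p,
            (N l).HasSeries X (twistSeries p c₁ (γ * ζ ^ (l : ℕ)) n) ∧
            (∀ Z : TwistedModule (f • derivative' : Derivation ℂ ℂ[X] ℂ[X]).vertexAlgebra
                g.toLinearEquiv p ξ (Fin n → ℂ),
              Z.HasSeries X (twistSeries p c₁ (γ * ζ ^ (l : ℕ)) n) → Z = N l) ∧
            (N l).Indecomposable ∧ (N l).mode X ≠ 0) ∧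
          ∀ (M : Type u) [AddCommGroup M] [Module ℂ M] [FiniteDimensional ℂ M]
            (Y : TwistedModule (f • derivative' : Derivation ℂ ℂ[X] ℂ[X]).vertexAlgebra
              g.toLinearEquiv p ξ M),
            Module.finrank ℂ M = n → Y.Indecomposable → Y.mode X ≠ 0 →
              ∃ l : Fin p, Y.Isomorphic (N l) := by
  have hp0 : 0 < p := by omega
  have hpC : (p : ℂ) ≠ 0 := by exact_mod_cast hp0.ne'
  have hprim := isPrimitiveRoot_of_orderOf_scale hξ hg
  refine ⟨⟨?_, ?_⟩, ?_⟩
  · rintro ⟨M, _, _, _, Y, hY⟩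
    exact Y.exists_form hξ hprim hp hY
  · rintro ⟨c₁, c, hc, hf⟩
    obtain ⟨κ, hκ⟩ := IsAlgClosed.exists_pow_nat_eq (-(p : ℂ) * c)⁻¹ hp0
    obtain ⟨β, F, E, H, h, -⟩ := HahnSeries.exists_isFundamental hp0 c₁
    have hκ1 : κ ^ p * (-p * c) = 1 := by
      rw [hκ, inv_mul_cancel₀ (mul_ne_zero (neg_ne_zero.2 hpC) hc)]
    obtain ⟨Y, -, hY⟩ := TwistedModule.exists_of_pow_eq_zero
      (Algebra.ofId ℂ (Module.End ℂ (ULift.{u} ℂ))) hξ hprim hp0 hf h hκ1 (pow_one (0 : ℂ))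
    -- The one-dimensional module of the nilpotent element `0`, in the required universe.
    exact ⟨ULift.{u} ℂ, inferInstance, inferInstance, inferInstance, Y, hY inferInstance⟩
  · intro c₁ c hc hf γ hγ n hn
    have hγ1 : γ ^ p * (-p * c) = 1 := by
      rw [hγ, inv_mul_cancel₀ (mul_ne_zero (neg_ne_zero.2 hpC) hc)]
    have hκ : ∀ l : ℕ, (γ * ζ ^ l) ^ p * (-p * c) = 1 := fun l => by
      rw [mul_pow, ← pow_mul, mul_comm l, pow_mul, hζ.pow_eq_one, one_pow, mul_one, hγ1]
    choose N hN using fun l : Fin p =>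
      TwistedModule.exists_jordan hξ hprim hp0 hf hn (hκ (l : ℕ))
    refine ⟨N, fun l => ⟨(hN l).1, fun Z hZ => TwistedModule.eq_of_mode_X hξ hprim hp
      (hZ.mode_X_eq (hN l).1), (hN l).2⟩, fun M _ _ _ Y hMn hY hY0 => ?_⟩
    obtain ⟨l, hl, φ, hφ⟩ := hY.exists_coeff_conj hξ hprim hp hc hf hγ1 hζ hY0 hMn
    refine ⟨⟨l, hl⟩, φ, TwistedModule.mode_conj_of_mode_X hξ hprim hp φ fun i w => ?_⟩
    have h1 := hφ (-i - 1) w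
    rw [← (hN ⟨l, hl⟩).1, TwistedModule.coeff, TwistedModule.coeff,
      show -(-i - 1) - 1 = i by ring] at h1
    exact h1
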